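/- Let $X$ and $Y$ be smooth ($C^\infty$), real, finite-dimensional, Hausdorff, paracompact, connected manifolds, $n=\dim X$, and let $\pi:Y\to X$ be a locally trivial smooth bundle. Let $J^\infty Y=\varprojlim J^rY$ be its infinite order jet space with the projective limit topology, and let $(x^\lambda,y^i_\Lambda)$ be the jet coordinates induced by bundle coordinates $(x^\lambda,y^i)$ of $Y$. Let $\mathcal T^0_\infty$ be the ring of real functions on $J^\infty Y$ which near every point are pull-backs of smooth functions on some finite order jet manifold, and let $\mathfrak T^{k,n}_\infty$ be the sheaf on $J^\infty Y$ of $k$-contact and $n$-horizontal exterior forms which are locally pull-backs of smooth forms on finite order jet manifolds. With $\theta^i_\Lambda=dy^i_\Lambda-y^i_{\lambda+\Lambda}dx^\lambda$, $\theta^i=\theta^i_\emptyset$, $\partial_i^\Lambda=\partial/\partial y^i_\Lambda$ and the total derivatives $d_\lambda=\partial_\lambda+\sum_{\Lambda}y^i_{\lambda+\Lambda}\partial_i^\Lambda$ (acting on forms as Lie derivatives), let $$\tau(\phi)=\frac1k\sum_{|\Lambda|\ge 0}(-1)^{|\Lambda|}\,\theta^i\wedge d_\Lambda(\partial_i^\Lambda\rfloor\phi),\qquad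 \phi\in\mathfrak T^{k,n}_\infty,\quad k>0,$$ and let $\mathfrak E_k=\tau(\mathfrak T^{k,n}_\infty)$ be the image sheaf, a sheaf of real vector spaces on $J^\infty Y$. Then for every $k>0$ the sheaf $\mathfrak E_k$ is fine: for every locally finite open covering $\{U_i\}_{i\in I}$ of $J^\infty Y$ there are $\mathbb R$-linear sheaf endomorphisms $\overline h_i$ of $\mathfrak E_k$ such that each $\overline h_i$ is zero on all stalks outside some closed set contained in $U_i$, and $\sum_{i\in I}\overline h_i$ is the identity on every stalk. More precisely, every locally finite open covering $\{U_i\}_{i\in I}$ of $J^\infty Y$ admits a partition of unity $\{f_i\}_{i\in I}$ with $f_i\in\mathcal T^0_\infty$, $f_i\ge 0$, $\operatorname{supp}f_i\subset U_i$ and $\sum_i f_i=1$; and for every such partition of unity the maps $\overline h_i(\varphi)=\tau(f_i\varphi)$ are well-defined endomorphisms of $\mathfrak E_k$ with these properties. -/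

import Mathlib

open CategoryTheory TopologicalSpace Topology Filter Set
open scoped Manifold ContDiff

universe u v w

noncomputable section

/-! ## Fine sheaves -/

/-- A family of endomorphisms `h i` of a sheaf of real vector spaces, indexed like a covering `U`:
every `h i` vanishes on all stalks outside some closed subset of `U i`, and the `h i` add up to the
identity on every stalk. -/
def IsFineFamily {Z : TopCat.{u}} (S : TopCat.Sheaf (ModuleCat.{u} ℝ) Z) {ι : Type w}
    (U : ι → Opens Z) (h : ι → (S.presheaf ⟶ S.presheaf)) : Prop :=
  (∀ i, ∃ A : Set Z, IsClosed A ∧ A ⊆ U i ∧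
    ∀ x ∉ A, (TopCat.Presheaf.stalkFunctor (ModuleCat.{u} ℝ) x).map (h i) = 0) ∧
  ∀ x, ∑ᶠ i, (TopCat.Presheaf.stalkFunctor (ModuleCat.{u} ℝ) x).map (h i) = 𝟙 _

/-- A sheaf is fine if every locally finite open covering carries such a family. -/
def IsFine {Z : TopCat.{u}} (S : TopCat.Sheaf (ModuleCat.{u} ℝ) Z) : Prop :=
  ∀ (ι : Type w) (U : ι → Opens Z), (⨆ i, U i) = ⊤ → LocallyFinite (fun i => (U i : Set Z)) →
    ∃ h : ι → (S.presheaf ⟶ S.presheaf), IsFineFamily S U h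

/-! ## The sheaf with prescribed germs -/

section GermSheaf

variable {Z : Type u} [TopologicalSpace Z] {T : Z → Type u} [∀ z, AddCommGroup (T z)]
  [∀ z, Module ℝ (T z)]

/-- The sections over `U`: the families `s` such that, near every point `z ∈ U`,
`s` coincides with an element of `P z`. -/
def germSections (P : ∀ _ : Z, Submodule ℝ (∀ z, T z)) (U : Opens Z) :
    Submodule ℝ (∀ z : U, T z) where
  carrier := {s | ∀ z ∈ U, ∃ φ ∈ P z, ∀ᶠ z' in 𝓝 z, ∀ h : z' ∈ U, s ⟨z', h⟩ = φ z'}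
  add_mem' := by
    intro s t hs ht z hz
    obtain ⟨φ, hφ, h1⟩ := hs z hz
    obtain ⟨ψ, hψ, h2⟩ := ht z hz
    refine ⟨φ + ψ, (P z).add_mem hφ hψ, ?_⟩
    filter_upwards [h1, h2] with z' a b h
    simp [a h, b h]
  zero_mem' := fun z _ => ⟨0, (P z).zero_mem, by simp⟩
  smul_mem' := by
    intro r s hs z hz
    obtain ⟨φ, hφ, h1⟩ := hs z hz
    refine ⟨r • φ, (P z).smul_mem r hφ, ?_⟩
    filter_upwards [h1] with z' a h
    simp [a h]

theorem germSections_res (P : ∀ _ : Z, Submodule ℝ (∀ z, T z)) {U V : Opens Z} (i : V ≤ U)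
    (s : ∀ z : U, T z) (hs : s ∈ germSections P U) :
    (fun z : V => s ⟨z, i z.2⟩) ∈ germSections P V := by
  intro z hz
  obtain ⟨φ, hφ, h1⟩ := hs z (i hz)
  refine ⟨φ, hφ, ?_⟩
  filter_upwards [h1] with z' a h using a (i h)

/-- The presheaf of real vector spaces `U ↦ germSections P U` with the usual restrictions. -/
def germPresheaf (P : ∀ _ : Z, Submodule ℝ (∀ z, T z)) :
    TopCat.Presheaf (ModuleCat.{u} ℝ) (TopCat.of Z) where
  obj U := ModuleCat.of ℝ (germSections P U.unop)
  map {U V} i := ModuleCat.ofHom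
    { toFun := fun s => ⟨fun z => s.1 ⟨z.1, i.unop.le z.2⟩, germSections_res P i.unop.le s.1 s.2⟩
      map_add' := fun _ _ => rfl
      map_smul' := fun _ _ => rfl }

/-- Membership in `germSections` as a local predicate. -/
def germPredicate (P : ∀ _ : Z, Submodule ℝ (∀ z, T z)) :
    TopCat.LocalPredicate (X := TopCat.of Z) T where
  pred {U} s := s ∈ germSections P U
  res i s hs := germSections_res P i.le s hs
  locality := by
    intro U s hs z hz
    obtain ⟨V, hzV, i, hV⟩ := hs ⟨z, hz⟩
    obtain ⟨φ, hφ, h1⟩ := hV z hzV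
    refine ⟨φ, hφ, ?_⟩
    filter_upwards [h1, V.2.mem_nhds hzV] with z' a hz' h using a hz'

theorem germPresheaf_isSheaf (P : ∀ _ : Z, Submodule ℝ (∀ z, T z)) :
    (germPresheaf P).IsSheaf := by
  rw [TopCat.Presheaf.isSheaf_iff_isSheaf_comp (forget (ModuleCat.{u} ℝ))]
  exact TopCat.subpresheafToTypes.isSheaf (germPredicate P)

/-- The sheaf of real vector spaces whose sections are locally elements of the `P z`. -/
def germSheaf (P : ∀ _ : Z, Submodule ℝ (∀ z, T z)) :
    TopCat.Sheaf (ModuleCat.{u} ℝ) (TopCat.of Z) :=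
  ⟨germPresheaf P, germPresheaf_isSheaf P⟩

open Classical in
/-- Extension by zero of a section over `U`. -/
def extendByZero {U : Opens Z} (s : ∀ z : U, T z) : ∀ z, T z :=
  fun z => if h : z ∈ U then s ⟨z, h⟩ else 0

end GermSheaf

/-! ## Smooth bundles, bundle charts and jets of sections -/

/-- `π : Y → X` is a locally trivial smooth bundle with typical fibre `F`. -/
def IsSmoothBundle (n m : ℕ) {X Y : Type u} (F : Type v)
    [TopologicalSpace X] [ChartedSpace (EuclideanSpace ℝ (Fin n)) X]
    [TopologicalSpace Y] [ChartedSpace (EuclideanSpace ℝ (Fin (n + m))) Y]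
    [TopologicalSpace F] [ChartedSpace (EuclideanSpace ℝ (Fin m)) F] (π : Y → X) : Prop :=
  ∀ x : X, ∃ e : Bundle.Trivialization F π, x ∈ e.baseSet ∧
    ContMDiffOn (𝓡 (n + m)) ((𝓡 n).prod (𝓡 m)) ∞ e.toOpenPartialHomeomorph e.source ∧
    ContMDiffOn ((𝓡 n).prod (𝓡 m)) (𝓡 (n + m)) ∞ e.toOpenPartialHomeomorph.symm e.target

section Jets

variable {n m : ℕ} {X Y : Type u}
  [TopologicalSpace X] [ChartedSpace (EuclideanSpace ℝ (Fin n)) X]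
  [TopologicalSpace Y] [ChartedSpace (EuclideanSpace ℝ (Fin (n + m))) Y]

/-- Bundle coordinates `(x^λ, y^i)` on an open subset of `Y`, together with the coordinates
`(x^λ)` on an open subset of `X`. -/
structure BundleChart (n m : ℕ) {X Y : Type u}
    [TopologicalSpace X] [ChartedSpace (EuclideanSpace ℝ (Fin n)) X]
    [TopologicalSpace Y] [ChartedSpace (EuclideanSpace ℝ (Fin (n + m))) Y] (π : Y → X) where
  /-- the coordinates `x^λ` -/
  base : OpenPartialHomeomorph X (Fin n → ℝ)
  /-- the coordinates `(x^λ, y^i)` -/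
  total : OpenPartialHomeomorph Y ((Fin n → ℝ) × (Fin m → ℝ))
  contMDiffOn_base : ContMDiffOn (𝓡 n) 𝓘(ℝ, Fin n → ℝ) ∞ base base.source
  contMDiffOn_base_symm : ContMDiffOn 𝓘(ℝ, Fin n → ℝ) (𝓡 n) ∞ base.symm base.target
  contMDiffOn_total :
    ContMDiffOn (𝓡 (n + m)) 𝓘(ℝ, (Fin n → ℝ) × (Fin m → ℝ)) ∞ total total.source
  contMDiffOn_total_symm :
    ContMDiffOn 𝓘(ℝ, (Fin n → ℝ) × (Fin m → ℝ)) (𝓡 (n + m)) ∞ total.symm total.target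
  mapsTo : ∀ y ∈ total.source, π y ∈ base.source
  fst_total : ∀ y ∈ total.source, (total y).1 = base (π y)

/-- A point `x` of `X` with a smooth section of `π` defined near `x`. -/
structure LocalSection (n m : ℕ) {X Y : Type u}
    [TopologicalSpace X] [ChartedSpace (EuclideanSpace ℝ (Fin n)) X]
    [TopologicalSpace Y] [ChartedSpace (EuclideanSpace ℝ (Fin (n + m))) Y] (π : Y → X) where
  pt : X
  toFun : X → Y
  isSection : ∃ U : Set X, IsOpen U ∧ pt ∈ U ∧
    ContMDiffOn (𝓡 n) (𝓡 (n + m)) ∞ toFun U ∧ ∀ x ∈ U, π (toFun x) = x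

/-- Multi-indices of partial derivatives: `Λ l` is the multiplicity of the index `l`. -/
abbrev MultiIndex (n : ℕ) := Fin n → ℕ

/-- The length `|Λ|`. -/
def MultiIndex.len (Λ : MultiIndex n) : ℕ := ∑ l, Λ l

/-- `λ + Λ`. -/
def MultiIndex.cons (l : Fin n) (Λ : MultiIndex n) : MultiIndex n := Λ + Pi.single l 1

/-- `D_Λ`, the composition of the operators `D l`, each repeated `Λ l` times. -/
def iterOp {A : Type*} (D : Fin n → A → A) (Λ : MultiIndex n) (a : A) : A :=
  (List.finRange n).foldr (fun l b => (D l)^[Λ l] b) a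

variable {π : Y → X}

/-- The partial derivative `∂_Λ s^i` of a local section at its base point, in a bundle chart. -/
def LocalSection.partialDeriv (s : LocalSection n m π) (c : BundleChart n m π) (i : Fin m)
    (Λ : MultiIndex n) : ℝ :=
  iterOp (fun l (f : (Fin n → ℝ) → ℝ) x => fderiv ℝ f x (Pi.single l 1)) Λ
    (fun x => (c.total (s.toFun (c.base.symm x))).2 i) (c.base s.pt)

/-- Two local sections have the same `r`-jet: same base point, same value, and the same partial
derivatives of order at most `r` in all bundle charts. -/
def jetSetoid (π : Y → X) (r : ℕ) : Setoid (LocalSection n m π) where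
  r s t := s.pt = t.pt ∧ s.toFun s.pt = t.toFun t.pt ∧
    ∀ c : BundleChart n m π, s.toFun s.pt ∈ c.total.source →
      ∀ (i : Fin m) (Λ : MultiIndex n), Λ.len ≤ r → s.partialDeriv c i Λ = t.partialDeriv c i Λ
  iseqv :=
    { refl := fun _ => ⟨rfl, rfl, fun _ _ _ _ _ => rfl⟩
      symm := fun {_ _} h => ⟨h.1.symm, h.2.1.symm, fun c hc i Λ hΛ =>
        (h.2.2 c (by rw [h.2.1]; exact hc) i Λ hΛ).symm⟩
      trans := fun {_ _ _} h h' => ⟨h.1.trans h'.1, h.2.1.trans h'.2.1, fun c hc i Λ hΛ =>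
        (h.2.2 c hc i Λ hΛ).trans (h'.2.2 c (by rw [← h.2.1]; exact hc) i Λ hΛ)⟩ }

/-- The jet manifold `J^r Y` (as a set). -/
def Jet (n m : ℕ) {X Y : Type u}
    [TopologicalSpace X] [ChartedSpace (EuclideanSpace ℝ (Fin n)) X]
    [TopologicalSpace Y] [ChartedSpace (EuclideanSpace ℝ (Fin (n + m))) Y]
    (π : Y → X) (r : ℕ) : Type u :=
  Quotient (jetSetoid (n := n) (m := m) π r)

/-- The projection `J^r Y → Y`. -/
def Jet.val {r : ℕ} : Jet n m π r → Y :=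
  Quotient.lift (fun s => s.toFun s.pt) (fun _ _ h => h.2.1)

open Classical in
/-- The jet coordinate `y^i_Λ`, `|Λ| ≤ r`, in a bundle chart (zero outside the chart). -/
def Jet.fibreCoord {r : ℕ} (c : BundleChart n m π) (i : Fin m)
    (Λ : {Λ : MultiIndex n // Λ.len ≤ r}) : Jet n m π r → ℝ :=
  Quotient.lift
    (fun s => if s.toFun s.pt ∈ c.total.source then s.partialDeriv c i Λ else 0)
    (fun s t h => by
      have hv : s.toFun s.pt = t.toFun t.pt := h.2.1
      by_cases hs : s.toFun s.pt ∈ c.total.source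
      · have ht : t.toFun t.pt ∈ c.total.source := by rw [← hv]; exact hs
        simp only [if_pos hs, if_pos ht]
        exact h.2.2 c hs i Λ Λ.2
      · have ht : t.toFun t.pt ∉ c.total.source := by rw [← hv]; exact hs
        simp only [if_neg hs, if_neg ht])

/-- The jet coordinates `(x^λ, y^i_Λ)`, `|Λ| ≤ r`, on `J^r Y`. -/
def Jet.coord {r : ℕ} (c : BundleChart n m π) (j : Jet n m π r) :
    (Fin n → ℝ) × (Fin m × {Λ : MultiIndex n // Λ.len ≤ r} → ℝ) :=
  (c.base (π j.val), fun a => j.fibreCoord c a.1 a.2)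

/-- The manifold topology of `J^r Y`: it is generated by the coordinate domains and the preimages
in them of open sets under the jet coordinates. -/
instance Jet.instTopologicalSpace {r : ℕ} : TopologicalSpace (Jet n m π r) :=
  generateFrom {s | ∃ (c : BundleChart n m π)
    (W : Set ((Fin n → ℝ) × (Fin m × {Λ : MultiIndex n // Λ.len ≤ r} → ℝ))), IsOpen W ∧
    s = {j | j.val ∈ c.total.source ∧ j.coord c ∈ W}}

/-- The projection `J^{r+1} Y → J^r Y`. -/
def Jet.proj (r : ℕ) : Jet n m π (r + 1) → Jet n m π r :=
  Quotient.map id (fun _ _ h => ⟨h.1, h.2.1, fun c hc i Λ hΛ => h.2.2 c hc i Λ (hΛ.trans r.le_succ)⟩)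

/-- The infinite order jet space `J^∞ Y`, the projective limit of the `J^r Y`, with the projective
limit topology. -/
abbrev InfJet (n m : ℕ) {X Y : Type u}
    [TopologicalSpace X] [ChartedSpace (EuclideanSpace ℝ (Fin n)) X]
    [TopologicalSpace Y] [ChartedSpace (EuclideanSpace ℝ (Fin (n + m))) Y] (π : Y → X) : Type u :=
  {q : ∀ r, Jet n m π r // ∀ r, Jet.proj r (q (r + 1)) = q r}

/-- The part of `J^∞ Y` over the domain of a bundle chart. -/
def BundleChart.dom (c : BundleChart n m π) : Set (InfJet n m π) :=
  {q | (q.1 0).val ∈ c.total.source}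

/-- The model of `J^∞ Y`: its points are all the `(x^λ, y^i_Λ)`. It is at the same time the space of
components `(v^λ, v^i_Λ)` of tangent vectors. -/
abbrev Model (n m : ℕ) := (Fin n → ℝ) × (Fin m × MultiIndex n → ℝ)

/-- The coordinates `(x^λ, y^i_Λ)` on `J^∞ Y`. -/
def BundleChart.coord (c : BundleChart n m π) (q : InfJet n m π) : Model n m :=
  (c.base (π (q.1 0).val), fun a => (q.1 a.2.len).fibreCoord c a.1 ⟨a.2, le_rfl⟩)

/-- A function on `J^∞ Y` read in the coordinates of `c` (zero off the image of `c`). -/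
def BundleChart.read {V : Type*} [Zero V] (c : BundleChart n m π)
    (f : ∀ q : InfJet n m π, q ∈ c.dom → V) : Model n m → V :=
  Function.extend (fun q : c.dom => c.coord q.1) (fun q : c.dom => f q.1 q.2) 0

/-- The tangent map of the change of coordinates from `c` to `c'` at `q`: it sends the components of
a tangent vector in `c` to its components in `c'`. -/
def changeVec (c c' : BundleChart n m π) (q : InfJet n m π) (v : Model n m) : Model n m :=
  (fun l => lineDeriv ℝ (c.read fun q' _ => (c'.coord q').1 l) (c.coord q) v,
   fun a => lineDeriv ℝ (c.read fun q' _ => (c'.coord q').2 a) (c.coord q) v)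

end Jets

/-! ## Calculus of forms in coordinates -/

section Coordinates

variable {n m : ℕ}

/-- A form of degree `p` in coordinates: its values on the points of the model and the
`p`-tuples of vectors. -/
abbrev ModelForm (n m p : ℕ) := Model n m → (Fin p → Model n m) → ℝ

/-- Restriction to finitely many jet coordinates. -/
def restrictTo (S : Finset (Fin m × MultiIndex n)) (z : Model n m) : (Fin n → ℝ) × (S → ℝ) :=
  (z.1, fun a => z.2 a)

/-- The total derivative `d_λ = ∂_λ + ∑ y^i_{λ+Λ} ∂_i^Λ`, as a vector at the point `z`. -/
def totalVec (l : Fin n) (z : Model n m) : Model n m :=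
  (Pi.single l 1, fun a => z.2 (a.1, a.2.cons l))

/-- The derivative of the vector field `d_λ` in the direction of `v`. -/
def shiftVec (l : Fin n) (v : Model n m) : Model n m :=
  (0, fun a => v.2 (a.1, a.2.cons l))

/-- The total derivative `d_λ φ` of a form, that is its Lie derivative along the vector field `d_λ`;
so `d_λ (dx^μ) = 0` and `d_λ (dy^i_Λ) = dy^i_{λ+Λ}`. -/
def totalDeriv {p : ℕ} (l : Fin n) (φ : ModelForm n m p) : ModelForm n m p := fun z v =>
  lineDeriv ℝ (fun z' => φ z' v) z (totalVec l z) +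
    ∑ j, φ z (Function.update v j (shiftVec l (v j)))

/-- The contact form `θ^i_Λ = dy^i_Λ - y^i_{λ+Λ} dx^λ`. -/
def contactForm (i : Fin m) (Λ : MultiIndex n) (z v : Model n m) : ℝ :=
  v.2 (i, Λ) - ∑ l, z.2 (i, Λ.cons l) * v.1 l

/-- The exterior product `α ∧ φ` of a one-form and a form. -/
def wedgeOne {p : ℕ} (α : Model n m → Model n m → ℝ) (φ : ModelForm n m p) :
    ModelForm n m (p + 1) := fun z v =>
  ∑ j : Fin (p + 1), (-1) ^ (j : ℕ) * α z (v j) * φ z (fun l => v (j.succAbove l))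

open Classical in
/-- The interior product `∂_i^Λ ⌋ φ`. -/
def interiorDy {p : ℕ} (i : Fin m) (Λ : MultiIndex n) (φ : ModelForm n m (p + 1)) :
    ModelForm n m p := fun z v =>
  φ z (Fin.cons (0, Pi.single (i, Λ) 1) v)

/-- The horizontal part `v^λ d_λ` of a vector at `z`. -/
def horizPart (z v : Model n m) : Model n m := ∑ l, v.1 l • totalVec l z

/-- The `k`-contact part of the value `α` at the point `z` of a form of degree `p`, the other
`p - k` factors being horizontal: `k` of the arguments are replaced by their vertical parts and the
others by their horizontal parts, in all possible ways. -/
def contactPart {p : ℕ} (k : ℕ) (z : Model n m) (α : (Fin p → Model n m) → ℝ) :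
    (Fin p → Model n m) → ℝ := fun v =>
  ∑ A ∈ (Finset.univ : Finset (Fin p)).powersetCard k,
    α (fun j => if j ∈ A then v j - horizPart z (v j) else horizPart z (v j))

/-- `∑ (-1)^|Λ| θ^i ∧ d_Λ (∂_i^Λ ⌋ φ)`; for forms of finite order the sum is finite. -/
def tauBar {p : ℕ} (φ : ModelForm n m (p + 1)) : ModelForm n m (p + 1) := fun z v =>
  ∑ᶠ a : Fin m × MultiIndex n, (-1) ^ a.2.len *
    wedgeOne (contactForm a.1 0) (iterOp totalDeriv a.2 (interiorDy a.1 a.2 φ)) z v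

end Coordinates

/-! ## Exterior forms on `J^∞ Y` and the sheaves of variational forms -/

section Forms

variable {n m : ℕ} {X Y : Type u}
  [TopologicalSpace X] [ChartedSpace (EuclideanSpace ℝ (Fin n)) X]
  [TopologicalSpace Y] [ChartedSpace (EuclideanSpace ℝ (Fin (n + m))) Y]

/-- The value at `q` of a form of degree `p`, given by its components in all the charts around `q`
(no condition is imposed here; see `IsExteriorFormAt`). -/
abbrev FormValue (p : ℕ) {π : Y → X} (q : InfJet n m π) : Type u :=
  ∀ _ : {c : BundleChart n m π // q ∈ c.dom}, (Fin p → Model n m) → ℝ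

variable {π : Y → X}

/-- Near `q`, the family `φ` is an exterior form of finite jet order: its components in
different charts are related by pull-back along the change of coordinates, and in every chart
around `q` it is the pull-back of a smooth exterior form in finitely many jet coordinates. -/
def IsExteriorFormAt {p : ℕ} (φ : ∀ q : InfJet n m π, FormValue p q) (q : InfJet n m π) : Prop :=
  (∀ᶠ q' in 𝓝 q, ∀ c c' : {c : BundleChart n m π // q' ∈ c.dom}, ∀ v : Fin p → Model n m,
    φ q' c v = φ q' c' (fun j => changeVec c.1 c'.1 q' (v j))) ∧
  ∀ c : BundleChart n m π, q ∈ c.dom →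
    ∃ (S : Finset (Fin m × MultiIndex n)) (W : Set ((Fin n → ℝ) × (S → ℝ)))
      (α : (Fin n → ℝ) × (S → ℝ) → ((Fin n → ℝ) × (S → ℝ)) [⋀^Fin p]→L[ℝ] ℝ),
      IsOpen W ∧ restrictTo S (c.coord q) ∈ W ∧ ContDiffOn ℝ ∞ α W ∧
      ∀ᶠ q' in 𝓝 q, ∀ hq' : q' ∈ c.dom, ∀ v : Fin p → Model n m,
        φ q' ⟨c, hq'⟩ v = α (restrictTo S (c.coord q')) (fun j => restrictTo S (v j))

/-- Near `q`, the family `φ` of degree `p` is a `k`-contact and `(p-k)`-horizontal exterior form of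
finite jet order, that is, it is its own `k`-contact part. -/
def IsContactFormAt {p : ℕ} (k : ℕ) (φ : ∀ q : InfJet n m π, FormValue p q)
    (q : InfJet n m π) : Prop :=
  IsExteriorFormAt φ q ∧
  ∀ᶠ q' in 𝓝 q, ∀ c : {c : BundleChart n m π // q' ∈ c.dom},
    contactPart k (c.1.coord q') (φ q' c) = φ q' c

/-- The operator `τ = (1/k) τ̄ ∘ h_k` on forms of degree `p + 1 = k + n` (on which the projection
`h^n` is contained in `h_k`), computed in every chart by the coordinate formula. -/
def tau {p : ℕ} (k : ℕ) (φ : ∀ q : InfJet n m π, FormValue (p + 1) q) :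
    ∀ q : InfJet n m π, FormValue (p + 1) q := fun q c v =>
  (1 / (k : ℝ)) * tauBar
    (fun z => contactPart k z (c.1.read (fun q' hq' => φ q' ⟨c.1, hq'⟩) z)) (c.1.coord q) v

/-- The germs at `q` of the forms `τ φ`, where `φ` is a `k`-contact and `n`-horizontal form
near `q`, `k > 0`. Since `τ` is linear on such forms, taking the span adds nothing: it only makes
this a subspace by definition. -/
def variationalGerms (n m : ℕ) {X Y : Type u}
    [TopologicalSpace X] [ChartedSpace (EuclideanSpace ℝ (Fin n)) X]
    [TopologicalSpace Y] [ChartedSpace (EuclideanSpace ℝ (Fin (n + m))) Y] (π : Y → X) (k : ℕ)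
    (q : InfJet n m π) : Submodule ℝ (∀ q : InfJet n m π, FormValue (k - 1 + n + 1) q) :=
  Submodule.span ℝ {ψ | ∃ φ, IsContactFormAt k φ q ∧ ψ = tau k φ}

/-- The sheaf `𝔈_k = τ(𝔗^{k,n}_∞)`, `k > 0`, of variational forms on `J^∞ Y`: the image of the sheaf
of `k`-contact and `n`-horizontal forms (of degree `k + n`) under `τ`. -/
def variationalSheaf (n m : ℕ) {X Y : Type u}
    [TopologicalSpace X] [ChartedSpace (EuclideanSpace ℝ (Fin n)) X]
    [TopologicalSpace Y] [ChartedSpace (EuclideanSpace ℝ (Fin (n + m))) Y] (π : Y → X) (k : ℕ) :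
    TopCat.Sheaf (ModuleCat.{u} ℝ) (TopCat.of (InfJet n m π)) :=
  germSheaf (variationalGerms n m π k)

/-- The ring `𝒯^0_∞`: real functions on `J^∞ Y` which near every point are pull-backs of smooth
functions in finitely many jet coordinates. -/
def IsLocallyFiniteOrder (f : InfJet n m π → ℝ) : Prop :=
  ∀ (q : InfJet n m π) (c : BundleChart n m π), q ∈ c.dom →
    ∃ (S : Finset (Fin m × MultiIndex n)) (W : Set ((Fin n → ℝ) × (S → ℝ)))
      (g : (Fin n → ℝ) × (S → ℝ) → ℝ),
      IsOpen W ∧ restrictTo S (c.coord q) ∈ W ∧ ContDiffOn ℝ ∞ g W ∧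
      ∀ᶠ q' in 𝓝 q, f q' = g (restrictTo S (c.coord q'))

/-- A partition of unity by elements of `𝒯^0_∞` associated with a locally finite covering `U`. -/
def IsPartitionOfUnityFor {ι : Type w} (U : ι → Opens (InfJet n m π))
    (f : ι → InfJet n m π → ℝ) : Prop :=
  (∀ i, IsLocallyFiniteOrder (f i)) ∧ (∀ i q, 0 ≤ f i q) ∧
    (∀ i, tsupport (f i) ⊆ U i) ∧ ∀ q, ∑ᶠ i, f i q = 1

/-- The endomorphism `h` of `𝔈_k` is `τ ∘ f`: multiply a section by `f`, then apply `τ`. -/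
def IsTauMul (k : ℕ) (f : InfJet n m π → ℝ)
    (h : (variationalSheaf n m π k).presheaf ⟶ (variationalSheaf n m π k).presheaf) : Prop :=
  ∀ (V : Opens (InfJet n m π)) (s : germSections (variationalGerms n m π k) V) (q : V),
    (show germSections (variationalGerms n m π k) V from h.app (Opposite.op V) s).1 q =
      tau k (fun q' => f q' • extendByZero s.1 q') q

end Forms

end

/-!
The theorem rests on two facts: `J^∞ Y` has partitions of unity by functions of locally finite
order, and `τ` is an `ℝ`-linear projector of the sheaf of `k`-contact, `n`-horizontal forms onto
`𝔈_k`. Given both, `φ ↦ τ (f_i φ)` is an endomorphism of `𝔈_k` which vanishes off the support of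
`f_i`, and on every stalk `∑ τ (f_i φ) = τ ((∑ f_i) φ) = τ φ = φ`, the sums being locally finite
(`isFineFamily_tauMulHom`).

The operator `τ` is defined chart by chart, so it has to be shown that it yields a form at all,
that is, that `τ̄` is invariant under changes of jet coordinates (`IsContactFormAt.tau`), besides
that `τ` is a projector (`tau_tau`). Both are statements about forms of finite order on the model
space of all the `(x^λ, y^i_Λ)`. The calculus there avoids topological vector space theory:
everything is differentiated along curves, and near a point only finitely many coordinates matter
(`FiniteOrderAt`, `FiniteOrderFormAt`).

* A form is `k`-contact exactly if it has the eigenvalue `k` for the derivation which replaces the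
  arguments by their vertical parts (`contactPart_eq_self_iff`). This condition is natural, it is
  preserved by total derivatives, and in degree `k + n` it implies `dx^ν ∧ φ = 0`.
* Write `E_i φ = ∑ (-1)^|Λ| d_Λ (∂_i^Λ ⌋ φ)` and `τ̄ φ = ∑ θ^i ∧ E_i φ`. Shifting the summation
  index gives `E_i (d_λ φ) = 0` (`eulerOp_totalDeriv`), hence the rule of integration by parts
  `E_j (θ^i_Λ ∧ ψ) = (-1)^|Λ| E_j (θ^i ∧ d_Λ ψ)`. Since `k φ = ∑ θ^i_Λ ∧ (∂_i^Λ ⌋ φ)` for a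
  `k`-contact form, it follows that `E_j (τ̄ φ) = k E_j φ`, whence `τ̄ τ̄ = k τ̄`
  (`tauBar_tauBar`).
* Let `T` be a change of jet coordinates. The new total derivatives are the images of the fields
  `∑ B_μ^λ(x) d_λ`, and on forms of maximal horizontal degree the Lie derivative along such a field
  is `φ ↦ ∑ d_λ (B_μ^λ φ)`, a total derivative. As the new coordinate `y'^j_{μ+Λ}` is the derivative
  of `y'^j_Λ` along that field, induction on `Λ` and integration by parts express `E_i (T^* φ)`
  by the `T^* (E'_j φ)` and the `∂y'^j/∂y^i` (`eulerSum_coordinate`, `eulerOp_formPullback`); with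
  `T^* θ'^j = ∑ (∂y'^j/∂y^i) θ^i` this is the invariance of `τ̄` (`tauBar_formPullback`).

That changes of bundle charts induce such maps `T` is checked on jets of sections; polynomial
sections have arbitrary jets of any order, so that a bundle chart identifies its part of `J^∞ Y`,
with the projective limit topology, with an open subset of the model (`exists_coord_eq`,
`nhds_eq_comap_coord`). For the partitions of unity, `Y` is second countable, hence so is `J^∞ Y`;
countably many bump functions with supports in the sets of the covering are made into a locally
finite family and normalized (`exists_bump`, `exists_locallyFinite_family`).
-/

noncomputable section

/-! ### Functions of finite order on the model -/

section FiniteOrder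

variable {n m : ℕ} {V V' : Type*} [NormedAddCommGroup V] [NormedSpace ℝ V]
  [NormedAddCommGroup V'] [NormedSpace ℝ V']

/-- Near `z`, the function `f` is a smooth function of finitely many of the coordinates. -/
def FiniteOrderAt (f : Model n m → V) (z : Model n m) : Prop :=
  ∃ (S : Finset (Fin m × MultiIndex n)) (W : Set ((Fin n → ℝ) × (S → ℝ)))
    (g : (Fin n → ℝ) × (S → ℝ) → V),
    IsOpen W ∧ restrictTo S z ∈ W ∧ ContDiffOn ℝ ∞ g W ∧
      ∀ᶠ z' in 𝓝 z, f z' = g (restrictTo S z')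

/-- `restrictTo S` as a continuous linear map. -/
def restrictCLM (S : Finset (Fin m × MultiIndex n)) :
    Model n m →L[ℝ] (Fin n → ℝ) × (S → ℝ) where
  toFun := restrictTo S
  map_add' _ _ := rfl
  map_smul' _ _ := rfl
  cont := by unfold restrictTo; fun_prop

theorem continuous_restrictTo (S : Finset (Fin m × MultiIndex n)) :
    Continuous (restrictTo (n := n) S) := (restrictCLM S).continuous

/-- The projection forgetting the coordinates outside a smaller finite set. -/
def restrictRestrict {S S' : Finset (Fin m × MultiIndex n)} (h : S ⊆ S') :
    ((Fin n → ℝ) × (S' → ℝ)) →L[ℝ] (Fin n → ℝ) × (S → ℝ) where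
  toFun x := (x.1, fun a => x.2 ⟨a.1, h a.2⟩)
  map_add' _ _ := rfl
  map_smul' _ _ := rfl
  cont := by fun_prop

theorem restrictRestrict_apply {S S' : Finset (Fin m × MultiIndex n)} (h : S ⊆ S')
    (z : Model n m) : restrictRestrict h (restrictTo S' z) = restrictTo S z := rfl

theorem FiniteOrderAt.exists_of_superset {f : Model n m → V} {z : Model n m}
    (hf : FiniteOrderAt f z) : ∃ S : Finset (Fin m × MultiIndex n), ∀ S', S ⊆ S' →
      ∃ (W : Set ((Fin n → ℝ) × (S' → ℝ))) (g : (Fin n → ℝ) × (S' → ℝ) → V),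
        IsOpen W ∧ restrictTo S' z ∈ W ∧ ContDiffOn ℝ ∞ g W ∧
          ∀ᶠ z' in 𝓝 z, f z' = g (restrictTo S' z') := by
  obtain ⟨S, W, g, hW, hz, hg, h⟩ := hf
  refine ⟨S, fun S' hS => ⟨restrictRestrict hS ⁻¹' W, g ∘ restrictRestrict hS,
    hW.preimage (restrictRestrict hS).continuous, hz, ?_, h⟩⟩
  exact hg.comp (restrictRestrict hS).contDiff.contDiffOn (fun _ h => h)

theorem FiniteOrderAt.congr {f f' : Model n m → V} {z : Model n m} (hf : FiniteOrderAt f z)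
    (h : f' =ᶠ[𝓝 z] f) : FiniteOrderAt f' z := by
  obtain ⟨S, W, g, hW, hz, hg, hfg⟩ := hf
  exact ⟨S, W, g, hW, hz, hg, by filter_upwards [h, hfg] with z' a b using a.trans b⟩

theorem FiniteOrderAt.eventually {f : Model n m → V} {z : Model n m} (hf : FiniteOrderAt f z) :
    ∀ᶠ z' in 𝓝 z, FiniteOrderAt f z' := by
  obtain ⟨S, W, g, hW, hz, hg, hfg⟩ := hf
  filter_upwards [(hW.preimage (continuous_restrictTo S)).mem_nhds hz, hfg.eventually_nhds]
    with z' a b using ⟨S, W, g, hW, a, hg, b⟩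

theorem FiniteOrderAt.comp {f : Model n m → V} {z : Model n m} (hf : FiniteOrderAt f z)
    {g : V → V'} {W : Set V} (hW : IsOpen W) (hg : ContDiffOn ℝ ∞ g W) (hz : f z ∈ W) :
    FiniteOrderAt (fun z => g (f z)) z := by
  obtain ⟨S, W', k, hW', hz', hk, hfk⟩ := hf
  have hfz : f z = k (restrictTo S z) := hfk.self_of_nhds
  refine ⟨S, W' ∩ k ⁻¹' W, g ∘ k, hk.continuousOn.isOpen_inter_preimage hW' hW,
    ⟨hz', by rwa [mem_preimage, ← hfz]⟩, hg.comp (hk.mono inter_subset_left) (fun _ h => h.2), ?_⟩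
  filter_upwards [hfk] with z' h using by simp [h]

theorem FiniteOrderAt.contDiff_comp {f : Model n m → V} {z : Model n m} (hf : FiniteOrderAt f z)
    {g : V → V'} (hg : ContDiff ℝ ∞ g) : FiniteOrderAt (fun z => g (f z)) z :=
  hf.comp isOpen_univ hg.contDiffOn (mem_univ _)

theorem finiteOrderAt_const (c : V) (z : Model n m) : FiniteOrderAt (fun _ => c) z :=
  ⟨∅, univ, fun _ => c, isOpen_univ, mem_univ _, contDiffOn_const, .of_forall fun _ => rfl⟩

theorem FiniteOrderAt.prodMk {f : Model n m → V} {f' : Model n m → V'} {z : Model n m}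
    (hf : FiniteOrderAt f z) (hf' : FiniteOrderAt f' z) :
    FiniteOrderAt (fun z => (f z, f' z)) z := by
  classical
  obtain ⟨S, h⟩ := hf.exists_of_superset
  obtain ⟨S', h'⟩ := hf'.exists_of_superset
  obtain ⟨W, g, hW, hz, hg, e⟩ := h (S ∪ S') Finset.subset_union_left
  obtain ⟨W', g', hW', hz', hg', e'⟩ := h' (S ∪ S') Finset.subset_union_right
  refine ⟨S ∪ S', W ∩ W', fun x => (g x, g' x), hW.inter hW', ⟨hz, hz'⟩,
    (hg.mono inter_subset_left).prodMk (hg'.mono inter_subset_right), ?_⟩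
  filter_upwards [e, e'] with z' a b using by rw [a, b]

theorem FiniteOrderAt.pi {κ : Type*} [Fintype κ] {f : κ → Model n m → V} {z : Model n m}
    (hf : ∀ a, FiniteOrderAt (f a) z) : FiniteOrderAt (fun z a => f a z) z := by
  classical
  choose S h using fun a => (hf a).exists_of_superset
  choose W g hW hz hg e using fun a =>
    h a (Finset.univ.biUnion S) (Finset.subset_biUnion_of_mem S (Finset.mem_univ a))
  refine ⟨_, ⋂ a, W a, fun x a => g a x, isOpen_iInter_of_finite hW, mem_iInter.2 hz,
    contDiffOn_pi.2 fun a => (hg a).mono (iInter_subset _ _), ?_⟩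
  filter_upwards [eventually_all.2 e] with z' h using funext h

theorem FiniteOrderAt.of_restrictTo (S : Finset (Fin m × MultiIndex n)) {z : Model n m}
    {g : (Fin n → ℝ) × (S → ℝ) → V} {W : Set ((Fin n → ℝ) × (S → ℝ))} (hW : IsOpen W)
    (hz : restrictTo S z ∈ W) (hg : ContDiffOn ℝ ∞ g W) :
    FiniteOrderAt (fun z => g (restrictTo S z)) z :=
  ⟨S, W, g, hW, hz, hg, .of_forall fun _ => rfl⟩

theorem FiniteOrderAt.of_fst {z : Model n m} {g : (Fin n → ℝ) → V} {W : Set (Fin n → ℝ)}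
    (hW : IsOpen W) (hz : z.1 ∈ W) (hg : ContDiffOn ℝ ∞ g W) :
    FiniteOrderAt (fun z : Model n m => g z.1) z :=
  .of_restrictTo ∅ (g := fun x => g x.1) (hW.preimage continuous_fst) hz
    (hg.comp contDiffOn_fst fun _ h => h)

theorem finiteOrderAt_fst (z : Model n m) (l : Fin n) : FiniteOrderAt (fun z => z.1 l) z :=
  .of_fst (g := fun x => x l) isOpen_univ (mem_univ _) (contDiff_apply ℝ ℝ l).contDiffOn

theorem finiteOrderAt_snd (z : Model n m) (a : Fin m × MultiIndex n) :
    FiniteOrderAt (fun z => z.2 a) z :=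
  .of_restrictTo {a} (g := fun x => x.2 ⟨a, Finset.mem_singleton_self a⟩) isOpen_univ
    (mem_univ _) (by fun_prop)

theorem FiniteOrderAt.add {f g : Model n m → V} {z : Model n m} (hf : FiniteOrderAt f z)
    (hg : FiniteOrderAt g z) : FiniteOrderAt (fun z => f z + g z) z :=
  (hf.prodMk hg).contDiff_comp (contDiff_fst.add contDiff_snd)

theorem FiniteOrderAt.sub {f g : Model n m → V} {z : Model n m} (hf : FiniteOrderAt f z)
    (hg : FiniteOrderAt g z) : FiniteOrderAt (fun z => f z - g z) z :=
  (hf.prodMk hg).contDiff_comp (contDiff_fst.sub contDiff_snd)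

theorem FiniteOrderAt.smul {f : Model n m → ℝ} {g : Model n m → V} {z : Model n m}
    (hf : FiniteOrderAt f z) (hg : FiniteOrderAt g z) : FiniteOrderAt (fun z => f z • g z) z :=
  (hf.prodMk hg).contDiff_comp (contDiff_fst.smul contDiff_snd)

theorem FiniteOrderAt.mul {f g : Model n m → ℝ} {z : Model n m}
    (hf : FiniteOrderAt f z) (hg : FiniteOrderAt g z) : FiniteOrderAt (fun z => f z * g z) z :=
  hf.smul hg

theorem FiniteOrderAt.sum {κ : Type*} {s : Finset κ} {f : κ → Model n m → V} {z : Model n m}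
    (hf : ∀ a ∈ s, FiniteOrderAt (f a) z) : FiniteOrderAt (fun z => ∑ a ∈ s, f a z) z := by
  classical
  induction s using Finset.induction_on with
  | empty => simpa using finiteOrderAt_const 0 z
  | insert a s ha ih =>
    simp only [Finset.sum_insert ha]
    exact (hf a (Finset.mem_insert_self a s)).add
      (ih fun b hb => hf b (Finset.mem_insert_of_mem hb))

theorem FiniteOrderAt.prod {κ : Type*} {s : Finset κ} {f : κ → Model n m → ℝ} {z : Model n m}
    (hf : ∀ a ∈ s, FiniteOrderAt (f a) z) : FiniteOrderAt (fun z => ∏ a ∈ s, f a z) z := by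
  classical
  induction s using Finset.induction_on with
  | empty => simpa using finiteOrderAt_const (1 : ℝ) z
  | insert a s ha ih =>
    simp only [Finset.prod_insert ha]
    exact (hf a (Finset.mem_insert_self a s)).mul
      (ih fun b hb => hf b (Finset.mem_insert_of_mem hb))

/-- All the components of the map `T` are of finite order near `z`. -/
def FiniteOrderMapAt (T : Model n m → Model n m) (z : Model n m) : Prop :=
  (∀ l, FiniteOrderAt (fun z => (T z).1 l) z) ∧ ∀ a, FiniteOrderAt (fun z => (T z).2 a) z

theorem FiniteOrderAt.continuousAt {f : Model n m → V} {z : Model n m} (hf : FiniteOrderAt f z) :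
    ContinuousAt f z := by
  obtain ⟨S, W, g, hW, hz, hg, e⟩ := hf
  have h : ContinuousAt (g ∘ restrictTo S) z :=
    (hg.continuousOn.continuousAt (hW.mem_nhds hz)).comp (continuous_restrictTo S).continuousAt
  exact h.congr (by filter_upwards [e] with z' h using h.symm)

theorem FiniteOrderMapAt.continuousAt {T : Model n m → Model n m} {z : Model n m}
    (hT : FiniteOrderMapAt T z) : ContinuousAt T z :=
  ContinuousAt.prodMk (continuousAt_pi.2 fun l => (hT.1 l).continuousAt)
    (continuousAt_pi.2 fun a => (hT.2 a).continuousAt)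

theorem FiniteOrderMapAt.restrictTo {T : Model n m → Model n m} {z : Model n m}
    (hT : FiniteOrderMapAt T z) (S : Finset (Fin m × MultiIndex n)) :
    FiniteOrderAt (fun z => restrictTo S (T z)) z :=
  (FiniteOrderAt.pi hT.1).prodMk (FiniteOrderAt.pi fun a : S => hT.2 a)

theorem FiniteOrderAt.comp_map {f : Model n m → V} {T : Model n m → Model n m} {z : Model n m}
    (hf : FiniteOrderAt f (T z)) (hT : FiniteOrderMapAt T z) :
    FiniteOrderAt (fun z => f (T z)) z := by
  obtain ⟨S, W, g, hW, hz, hg, e⟩ := hf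
  exact ((hT.restrictTo S).comp hW hg hz).congr (hT.continuousAt.eventually e)

theorem finiteOrderMapAt_id (z : Model n m) : FiniteOrderMapAt (fun z => z) z :=
  ⟨finiteOrderAt_fst z, finiteOrderAt_snd z⟩

theorem finiteOrderMapAt_const (v z : Model n m) : FiniteOrderMapAt (fun _ => v) z :=
  ⟨fun _ => finiteOrderAt_const _ z, fun _ => finiteOrderAt_const _ z⟩

theorem finiteOrderMapAt_totalVec (l : Fin n) (z : Model n m) :
    FiniteOrderMapAt (totalVec l) z :=
  ⟨fun _ => finiteOrderAt_const _ z, fun _ => finiteOrderAt_snd z _⟩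

theorem FiniteOrderMapAt.add {T U : Model n m → Model n m} {z : Model n m}
    (hT : FiniteOrderMapAt T z) (hU : FiniteOrderMapAt U z) :
    FiniteOrderMapAt (fun z => T z + U z) z :=
  ⟨fun l => (hT.1 l).add (hU.1 l), fun a => (hT.2 a).add (hU.2 a)⟩

theorem FiniteOrderMapAt.smul {T : Model n m → Model n m} {f : Model n m → ℝ} {z : Model n m}
    (hf : FiniteOrderAt f z) (hT : FiniteOrderMapAt T z) :
    FiniteOrderMapAt (fun z => f z • T z) z :=
  ⟨fun l => hf.mul (hT.1 l), fun a => hf.mul (hT.2 a)⟩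

theorem FiniteOrderMapAt.sum {κ : Type*} {s : Finset κ} {T : κ → Model n m → Model n m}
    {z : Model n m} (hT : ∀ a ∈ s, FiniteOrderMapAt (T a) z) :
    FiniteOrderMapAt (fun z => ∑ a ∈ s, T a z) z := by
  classical
  induction s using Finset.induction_on with
  | empty => simpa using finiteOrderMapAt_const 0 z
  | insert a s ha ih =>
    simp only [Finset.sum_insert ha]
    exact (hT a (Finset.mem_insert_self a s)).add
      (ih fun b hb => hT b (Finset.mem_insert_of_mem hb))

theorem FiniteOrderMapAt.sub {T U : Model n m → Model n m} {z : Model n m}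
    (hT : FiniteOrderMapAt T z) (hU : FiniteOrderMapAt U z) :
    FiniteOrderMapAt (fun z => T z - U z) z :=
  ⟨fun l => (hT.1 l).sub (hU.1 l), fun a => (hT.2 a).sub (hU.2 a)⟩

theorem FiniteOrderMapAt.congr {T U : Model n m → Model n m} {z : Model n m}
    (hT : FiniteOrderMapAt T z) (h : U =ᶠ[𝓝 z] T) : FiniteOrderMapAt U z :=
  ⟨fun l => (hT.1 l).congr (h.mono fun z' e => by simp [e]),
    fun a => (hT.2 a).congr (h.mono fun z' e => by simp [e])⟩

/-! ### Derivatives along curves and vectors -/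

/-- The curve `γ` in the model has the velocity `w` at the time `t`. -/
def HasCurveDeriv (γ : ℝ → Model n m) (w : Model n m) (t : ℝ) : Prop :=
  (∀ l, HasDerivAt (fun s => (γ s).1 l) (w.1 l) t) ∧
    ∀ a, HasDerivAt (fun s => (γ s).2 a) (w.2 a) t

theorem HasCurveDeriv.continuousAt {γ : ℝ → Model n m} {w : Model n m} {t : ℝ}
    (h : HasCurveDeriv γ w t) : ContinuousAt γ t :=
  ContinuousAt.prodMk (continuousAt_pi.2 fun l => (h.1 l).continuousAt)
    (continuousAt_pi.2 fun a => (h.2 a).continuousAt)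

theorem HasCurveDeriv.restrictTo {γ : ℝ → Model n m} {w : Model n m} {t : ℝ}
    (h : HasCurveDeriv γ w t) (S : Finset (Fin m × MultiIndex n)) :
    HasDerivAt (fun s => restrictTo S (γ s)) (restrictTo S w) t :=
  (hasDerivAt_pi.2 h.1).prodMk (hasDerivAt_pi.2 fun a : S => h.2 a)

theorem hasCurveDeriv_line (z v : Model n m) (t : ℝ) :
    HasCurveDeriv (fun t => z + t • v) v t := by
  constructor
  · intro l
    simpa using ((hasDerivAt_id t).mul_const (v.1 l)).const_add (z.1 l)
  · intro a
    simpa using ((hasDerivAt_id t).mul_const (v.2 a)).const_add (z.2 a)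

/-- The derivative of the map `T` at `z`, component by component. -/
def mapDeriv (T : Model n m → Model n m) (z v : Model n m) : Model n m :=
  (fun l => lineDeriv ℝ (fun z => (T z).1 l) z v, fun a => lineDeriv ℝ (fun z => (T z).2 a) z v)

theorem FiniteOrderAt.exists_lineDeriv_eq {f : Model n m → V} {z : Model n m}
    (hf : FiniteOrderAt f z) : ∃ (S : Finset (Fin m × MultiIndex n))
      (W : Set ((Fin n → ℝ) × (S → ℝ))) (g : (Fin n → ℝ) × (S → ℝ) → V), IsOpen W ∧
      restrictTo S z ∈ W ∧ ContDiffOn ℝ ∞ g W ∧ ∀ᶠ z' in 𝓝 z, restrictTo S z' ∈ W ∧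
        f z' = g (restrictTo S z') ∧
        (∀ v, lineDeriv ℝ f z' v = fderiv ℝ g (restrictTo S z') (restrictTo S v)) ∧
        ∀ γ w t, γ t = z' → HasCurveDeriv γ w t →
          HasDerivAt (fun s => f (γ s)) (lineDeriv ℝ f z' w) t := by
  obtain ⟨S, W, g, hW, hz, hg, e⟩ := hf
  refine ⟨S, W, g, hW, hz, hg, ?_⟩
  filter_upwards [(hW.preimage (continuous_restrictTo S)).mem_nhds hz, e.eventually_nhds]
    with z' hz' e'
  have hgd : HasFDerivAt g (fderiv ℝ g (restrictTo S z')) (restrictTo S z') :=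
    ((hg.contDiffAt (hW.mem_nhds hz')).differentiableAt (by simp)).hasFDerivAt
  have key : ∀ γ w t, γ t = z' → HasCurveDeriv γ w t →
      HasDerivAt (fun s => f (γ s)) (fderiv ℝ g (restrictTo S z') (restrictTo S w)) t := by
    intro γ w t h hγ
    have h1 : HasDerivAt (fun s => g (restrictTo S (γ s)))
        (fderiv ℝ g (restrictTo S z') (restrictTo S w)) t := by
      subst h
      exact hgd.comp_hasDerivAt t (hγ.restrictTo S)
    refine h1.congr_of_eventuallyEq ?_
    have := hγ.continuousAt.eventually (h ▸ e')
    filter_upwards [this] with s hs using hs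
  have hl : ∀ v, lineDeriv ℝ f z' v = fderiv ℝ g (restrictTo S z') (restrictTo S v) := fun v =>
    (key (fun t => z' + t • v) v 0 (by simp) (hasCurveDeriv_line z' v 0)).deriv
  exact ⟨hz', e'.self_of_nhds, hl, fun γ w t h hγ => hl w ▸ key γ w t h hγ⟩

/-- The chain rule along curves. -/
theorem FiniteOrderAt.hasDerivAt_curve {f : Model n m → V} {γ : ℝ → Model n m} {w : Model n m}
    {t : ℝ} (hf : FiniteOrderAt f (γ t)) (hγ : HasCurveDeriv γ w t) :
    HasDerivAt (fun s => f (γ s)) (lineDeriv ℝ f (γ t) w) t := by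
  obtain ⟨S, W, g, -, -, -, e⟩ := hf.exists_lineDeriv_eq
  exact e.self_of_nhds.2.2.2 γ w t rfl hγ

theorem FiniteOrderAt.hasDerivAt_line {f : Model n m → V} {z : Model n m}
    (hf : FiniteOrderAt f z) (v : Model n m) :
    HasDerivAt (fun t : ℝ => f (z + t • v)) (lineDeriv ℝ f z v) 0 := by
  have := FiniteOrderAt.hasDerivAt_curve (f := f) (γ := fun t : ℝ => z + t • v) (t := 0)
    (by simpa using hf) (hasCurveDeriv_line z v 0)
  simpa using this

theorem FiniteOrderAt.lineDeriv_add_vec {f : Model n m → V} {z : Model n m}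
    (hf : FiniteOrderAt f z) (v w : Model n m) :
    lineDeriv ℝ f z (v + w) = lineDeriv ℝ f z v + lineDeriv ℝ f z w := by
  obtain ⟨S, W, g, -, -, -, e⟩ := hf.exists_lineDeriv_eq
  simp only [e.self_of_nhds.2.2.1]
  rw [← map_add]; rfl

theorem FiniteOrderAt.lineDeriv_sum_vec {f : Model n m → V} {z : Model n m}
    (hf : FiniteOrderAt f z) {κ : Type*} (s : Finset κ) (v : κ → Model n m) :
    lineDeriv ℝ f z (∑ a ∈ s, v a) = ∑ a ∈ s, lineDeriv ℝ f z (v a) := by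
  classical
  induction s using Finset.induction_on with
  | empty => simp [lineDeriv_zero]
  | insert a s ha ih => simp only [Finset.sum_insert ha, hf.lineDeriv_add_vec, ih]

theorem lineDeriv_congr_nhds {f g : Model n m → V} {z : Model n m} (h : f =ᶠ[𝓝 z] g)
    (v : Model n m) : lineDeriv ℝ f z v = lineDeriv ℝ g z v := by
  refine Filter.EventuallyEq.deriv_eq ?_
  have hc : ContinuousAt (fun t : ℝ => z + t • v) 0 := (hasCurveDeriv_line z v 0).continuousAt
  exact hc.eventually (p := fun z' => f z' = g z') (by simpa [Filter.EventuallyEq] using h)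

theorem FiniteOrderMapAt.hasCurveDeriv_line {T : Model n m → Model n m} {z : Model n m}
    (hT : FiniteOrderMapAt T z) (v : Model n m) :
    HasCurveDeriv (fun t : ℝ => T (z + t • v)) (mapDeriv T z v) 0 :=
  ⟨fun l => (hT.1 l).hasDerivAt_line v, fun a => (hT.2 a).hasDerivAt_line v⟩

theorem lineDeriv_comp_map {f : Model n m → V} {T : Model n m → Model n m} {z : Model n m}
    (hf : FiniteOrderAt f (T z)) (hT : FiniteOrderMapAt T z) (v : Model n m) :
    lineDeriv ℝ (fun z => f (T z)) z v = lineDeriv ℝ f (T z) (mapDeriv T z v) := by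
  have h := FiniteOrderAt.hasDerivAt_curve (f := f) (γ := fun t : ℝ => T (z + t • v)) (t := 0)
    (by simpa using hf) (hT.hasCurveDeriv_line v)
  simpa [lineDeriv] using h.deriv

theorem mapDeriv_add {T : Model n m → Model n m} {z : Model n m} (hT : FiniteOrderMapAt T z)
    (v w : Model n m) : mapDeriv T z (v + w) = mapDeriv T z v + mapDeriv T z w :=
  Prod.ext (funext fun l => (hT.1 l).lineDeriv_add_vec v w)
    (funext fun a => (hT.2 a).lineDeriv_add_vec v w)

theorem mapDeriv_smul (T : Model n m → Model n m) (z : Model n m)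
    (c : ℝ) (v : Model n m) : mapDeriv T z (c • v) = c • mapDeriv T z v :=
  Prod.ext (funext fun l => lineDeriv_smul (f := fun z => (T z).1 l))
    (funext fun a => lineDeriv_smul (f := fun z => (T z).2 a))

theorem mapDeriv_sum {T : Model n m → Model n m} {z : Model n m} (hT : FiniteOrderMapAt T z)
    {κ : Type*} (s : Finset κ) (v : κ → Model n m) :
    mapDeriv T z (∑ a ∈ s, v a) = ∑ a ∈ s, mapDeriv T z (v a) := by
  refine Prod.ext (funext fun l => ?_) (funext fun a => ?_)
  · simpa [Prod.fst_sum, mapDeriv] using (hT.1 l).lineDeriv_sum_vec s v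
  · simpa [Prod.snd_sum, mapDeriv] using (hT.2 a).lineDeriv_sum_vec s v

theorem lineDeriv_add_fun {f g : Model n m → V} {z : Model n m} (hf : FiniteOrderAt f z)
    (hg : FiniteOrderAt g z) (v : Model n m) :
    lineDeriv ℝ (fun z => f z + g z) z v = lineDeriv ℝ f z v + lineDeriv ℝ g z v :=
  ((hf.hasDerivAt_line v).add (hg.hasDerivAt_line v)).deriv

theorem lineDeriv_sum_fun {κ : Type*} {s : Finset κ} {f : κ → Model n m → V} {z : Model n m}
    (hf : ∀ a ∈ s, FiniteOrderAt (f a) z) (v : Model n m) :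
    lineDeriv ℝ (fun z => ∑ a ∈ s, f a z) z v = ∑ a ∈ s, lineDeriv ℝ (f a) z v :=
  (HasDerivAt.fun_sum fun a ha => (hf a ha).hasDerivAt_line v).deriv

theorem lineDeriv_mul_fun {f g : Model n m → ℝ} {z : Model n m} (hf : FiniteOrderAt f z)
    (hg : FiniteOrderAt g z) (v : Model n m) :
    lineDeriv ℝ (fun z => f z * g z) z v =
      lineDeriv ℝ f z v * g z + f z * lineDeriv ℝ g z v := by
  simpa [lineDeriv] using ((hf.hasDerivAt_line v).fun_mul (hg.hasDerivAt_line v)).deriv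

theorem lineDeriv_const_fun (c : V) (z v : Model n m) :
    lineDeriv ℝ (fun _ : Model n m => c) z v = 0 := by simp [lineDeriv]

theorem lineDeriv_fst (z v : Model n m) (l : Fin n) :
    lineDeriv ℝ (fun z : Model n m => z.1 l) z v = v.1 l :=
  ((hasCurveDeriv_line z v 0).1 l).deriv

theorem lineDeriv_snd (z v : Model n m) (a : Fin m × MultiIndex n) :
    lineDeriv ℝ (fun z : Model n m => z.2 a) z v = v.2 a :=
  ((hasCurveDeriv_line z v 0).2 a).deriv

theorem mapDeriv_const (u z v : Model n m) : mapDeriv (fun _ => u) z v = 0 :=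
  Prod.ext (funext fun _ => lineDeriv_const_fun _ z v) (funext fun _ => lineDeriv_const_fun _ z v)

theorem mapDeriv_totalVec (l : Fin n) (z v : Model n m) :
    mapDeriv (totalVec l) z v = shiftVec l v :=
  Prod.ext (funext fun _ => lineDeriv_const_fun _ z v) (funext fun _ => lineDeriv_snd z v _)

/-- The derivative of a function along a vector field, differentiated once more along `v`: the
second derivatives commute, and the derivative of the field itself contributes the second term. -/
theorem lineDeriv_lineDeriv_field {f : Model n m → V} {w : Model n m → Model n m} {z : Model n m}
    (hf : FiniteOrderAt f z) (hw : FiniteOrderMapAt w z) (v : Model n m) :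
    lineDeriv ℝ (fun z' => lineDeriv ℝ f z' (w z')) z v =
      lineDeriv ℝ (fun z' => lineDeriv ℝ f z' v) z (w z) + lineDeriv ℝ f z (mapDeriv w z v) := by
  obtain ⟨S, W, g, hW, hz, hg, e⟩ := hf.exists_lineDeriv_eq
  have hgz : ContDiffAt ℝ ∞ g (restrictTo S z) := hg.contDiffAt (hW.mem_nhds hz)
  have hd : HasFDerivAt (fderiv ℝ g) (fderiv ℝ (fderiv ℝ g) (restrictTo S z)) (restrictTo S z) :=
    ((hgz.fderiv_right (m := ∞) (by simp)).differentiableAt (by simp)).hasFDerivAt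
  have hsymm : ∀ x y, fderiv ℝ (fderiv ℝ g) (restrictTo S z) x y =
      fderiv ℝ (fderiv ℝ g) (restrictTo S z) y x := by
    have := hgz.isSymmSndFDerivAt (by simpa using WithTop.coe_le_coe.2 (le_top (a := (2 : ℕ∞))))
    exact fun x y => this.eq x y
  have key : ∀ (w : Model n m → Model n m) (v : Model n m), FiniteOrderMapAt w z →
      lineDeriv ℝ (fun z' => lineDeriv ℝ f z' (w z')) z v =
        fderiv ℝ (fderiv ℝ g) (restrictTo S z) (restrictTo S v) (restrictTo S (w z)) +
          lineDeriv ℝ f z (mapDeriv w z v) := by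
    intro w v hw
    rw [lineDeriv_congr_nhds
      (g := fun z' => fderiv ℝ g (restrictTo S z') (restrictTo S (w z')))
      (e.mono fun z' h => h.2.2.1 _), e.self_of_nhds.2.2.1]
    have h1 : HasDerivAt (fun t : ℝ => fderiv ℝ g (restrictTo S (z + t • v)))
        (fderiv ℝ (fderiv ℝ g) (restrictTo S z) (restrictTo S v)) 0 := by
      have := HasFDerivAt.comp_hasDerivAt (0 : ℝ) (l := fderiv ℝ g)
        (f := fun t : ℝ => restrictTo S (z + t • v)) (by simpa using hd)
        ((hasCurveDeriv_line z v 0).restrictTo S)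
      simpa [Function.comp_def] using this
    have h2 := (hw.hasCurveDeriv_line v).restrictTo S
    simpa [lineDeriv] using (h1.clm_apply h2).deriv
  rw [key w v hw, key (fun _ => v) (w z) (finiteOrderMapAt_const v z), mapDeriv_const, hsymm]
  simp [lineDeriv_zero]

theorem FiniteOrderAt.lineDeriv_field {f : Model n m → V} {w : Model n m → Model n m}
    {z : Model n m} (hf : FiniteOrderAt f z) (hw : FiniteOrderMapAt w z) :
    FiniteOrderAt (fun z' => lineDeriv ℝ f z' (w z')) z := by
  obtain ⟨S, W, g, hW, hz, hg, e⟩ := hf.exists_lineDeriv_eq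
  have h1 : FiniteOrderAt (fun z' => fderiv ℝ g (restrictTo S z')) z :=
    .of_restrictTo S hW hz (hg.fderiv_of_isOpen hW (by simp))
  have h2 := (h1.prodMk (hw.restrictTo S)).contDiff_comp
    (g := fun p : (((Fin n → ℝ) × (S → ℝ)) →L[ℝ] V) × ((Fin n → ℝ) × (S → ℝ)) => p.1 p.2)
    (contDiff_fst.clm_apply contDiff_snd)
  exact h2.congr (e.mono fun z' h => h.2.2.1 _)

theorem FiniteOrderAt.lineDeriv_const {f : Model n m → V} {z : Model n m} (hf : FiniteOrderAt f z)
    (v : Model n m) : FiniteOrderAt (fun z' => lineDeriv ℝ f z' v) z :=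
  hf.lineDeriv_field (finiteOrderMapAt_const v z)

/-- The derivatives of a function of finite order near `z` only see finitely many components
of a vector. -/
theorem FiniteOrderAt.exists_lineDeriv_congr {f : Model n m → V} {z : Model n m}
    (hf : FiniteOrderAt f z) : ∃ S : Finset (Fin m × MultiIndex n), ∀ᶠ z' in 𝓝 z,
      ∀ v w, restrictTo S v = restrictTo S w → lineDeriv ℝ f z' v = lineDeriv ℝ f z' w := by
  obtain ⟨S, W, g, hW, hz, hg, e⟩ := hf.exists_lineDeriv_eq
  refine ⟨S, e.mono fun z' h v w hvw => ?_⟩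
  rw [h.2.2.1, h.2.2.1, hvw]

theorem FiniteOrderMapAt.mapDeriv_field {T w : Model n m → Model n m}
    {z : Model n m} (hT : FiniteOrderMapAt T z) (hw : FiniteOrderMapAt w z) :
    FiniteOrderMapAt (fun z' => mapDeriv T z' (w z')) z :=
  ⟨fun l => (hT.1 l).lineDeriv_field hw, fun a => (hT.2 a).lineDeriv_field hw⟩

theorem mapDeriv_mapDeriv_field {T w : Model n m → Model n m} {z : Model n m}
    (hT : FiniteOrderMapAt T z) (hw : FiniteOrderMapAt w z) (v : Model n m) :
    mapDeriv (fun z' => mapDeriv T z' (w z')) z v =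
      mapDeriv (fun z' => mapDeriv T z' v) z (w z) + mapDeriv T z (mapDeriv w z v) :=
  Prod.ext (funext fun l => lineDeriv_lineDeriv_field (hT.1 l) hw v)
    (funext fun a => lineDeriv_lineDeriv_field (hT.2 a) hw v)

theorem mapDeriv_comp_map {U T : Model n m → Model n m} {z : Model n m}
    (hU : FiniteOrderMapAt U (T z)) (hT : FiniteOrderMapAt T z) (v : Model n m) :
    mapDeriv (fun z => U (T z)) z v = mapDeriv U (T z) (mapDeriv T z v) :=
  Prod.ext (funext fun l => lineDeriv_comp_map (hU.1 l) hT v)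
    (funext fun a => lineDeriv_comp_map (hU.2 a) hT v)

theorem mapDeriv_congr_nhds {U T : Model n m → Model n m} {z : Model n m} (h : U =ᶠ[𝓝 z] T)
    (v : Model n m) : mapDeriv U z v = mapDeriv T z v :=
  Prod.ext
    (funext fun l => lineDeriv_congr_nhds (h.fun_comp fun z => z.1 l) v)
    (funext fun a => lineDeriv_congr_nhds (h.fun_comp fun z => z.2 a) v)

end FiniteOrder

/-! ### Pointwise exterior algebra -/

section PointwiseAlgebra

variable {n m p : ℕ}

/-- The function `α` of `p` vectors is an alternating form. -/
def IsAlternating (α : (Fin p → Model n m) → ℝ) : Prop :=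
  ∃ a : Model n m [⋀^Fin p]→ₗ[ℝ] ℝ, ⇑a = α

/-- The action of an endomorphism `C` on forms as a derivation. -/
def derivAction (C : Model n m → Model n m) (α : (Fin p → Model n m) → ℝ) :
    (Fin p → Model n m) → ℝ := fun v => ∑ j, α (Function.update v j (C (v j)))

/-- The exterior product of a covector and an alternating form, so that `wedgeOne α φ z` is
`wedgeCovector (α z) (φ z)`. -/
def wedgeCovector (a : Model n m → ℝ) (α : (Fin p → Model n m) → ℝ) :
    (Fin (p + 1) → Model n m) → ℝ := fun v =>
  ∑ j : Fin (p + 1), (-1) ^ (j : ℕ) * a (v j) * α (fun l => v (j.succAbove l))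

theorem wedgeOne_eq (a : Model n m → Model n m → ℝ) (φ : ModelForm n m p) (z : Model n m) :
    wedgeOne a φ z = wedgeCovector (a z) (φ z) := rfl

theorem IsAlternating.add {α β : (Fin p → Model n m) → ℝ} (hα : IsAlternating α)
    (hβ : IsAlternating β) : IsAlternating (α + β) := by
  obtain ⟨a, rfl⟩ := hα
  obtain ⟨b, rfl⟩ := hβ
  exact ⟨a + b, rfl⟩

theorem IsAlternating.smul {α : (Fin p → Model n m) → ℝ} (hα : IsAlternating α) (c : ℝ) :
    IsAlternating (c • α) := by
  obtain ⟨a, rfl⟩ := hα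
  exact ⟨c • a, rfl⟩

theorem isAlternating_zero : IsAlternating (0 : (Fin p → Model n m) → ℝ) := ⟨0, rfl⟩

theorem IsAlternating.comp_linear {α : (Fin p → Model n m) → ℝ} (hα : IsAlternating α)
    (L : Model n m →ₗ[ℝ] Model n m) : IsAlternating (fun v => α (fun j => L (v j))) := by
  obtain ⟨a, rfl⟩ := hα
  exact ⟨a.compLinearMap L, rfl⟩

theorem IsAlternating.cons {α : (Fin (p + 1) → Model n m) → ℝ} (hα : IsAlternating α)
    (u : Model n m) : IsAlternating (fun v => α (Fin.cons u v)) := by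
  obtain ⟨a, rfl⟩ := hα
  exact ⟨a.curryLeft u, rfl⟩

theorem IsAlternating.wedgeCovector {α : (Fin p → Model n m) → ℝ} (hα : IsAlternating α)
    (a : Model n m →ₗ[ℝ] ℝ) : IsAlternating (wedgeCovector a α) := by
  obtain ⟨b, rfl⟩ := hα
  refine ⟨AlternatingMap.alternatizeUncurryFin (a.smulRight b), funext fun v => ?_⟩
  rw [AlternatingMap.alternatizeUncurryFin_apply]
  refine Finset.sum_congr rfl fun j _ => ?_
  simp only [LinearMap.smulRight_apply, AlternatingMap.smul_apply, smul_eq_mul, zsmul_eq_mul]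
  push_cast
  rw [mul_assoc]; rfl

theorem IsAlternating.update_eq {α : (Fin (p + 1) → Model n m) → ℝ} (hα : IsAlternating α)
    (v : Fin (p + 1) → Model n m) (j : Fin (p + 1)) (x : Model n m) :
    α (Function.update v j x) = (-1) ^ (j : ℕ) * α (Fin.cons x fun l => v (j.succAbove l)) := by
  obtain ⟨a, rfl⟩ := hα
  have := AlternatingMap.map_insertNth a j x (fun l => v (j.succAbove l))
  rw [show j.insertNth x (fun l => v (j.succAbove l)) = Function.update v j x from
    Fin.insertNth_removeNth j x v] at this
  rw [this, zsmul_eq_mul]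
  push_cast; rfl

theorem IsAlternating.derivAction {α : (Fin p → Model n m) → ℝ} (hα : IsAlternating α)
    (C : Model n m →ₗ[ℝ] Model n m) : IsAlternating (derivAction C α) := by
  cases p with
  | zero => exact ⟨0, funext fun v => by simp [_root_.derivAction]⟩
  | succ p =>
    have hα' := hα
    obtain ⟨a, rfl⟩ := hα
    refine ⟨AlternatingMap.alternatizeUncurryFin (a.curryLeft ∘ₗ C), funext fun v => ?_⟩
    rw [AlternatingMap.alternatizeUncurryFin_apply]
    refine Finset.sum_congr rfl fun j _ => ?_
    rw [hα'.update_eq, zsmul_eq_mul]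
    push_cast; rfl

theorem wedgeCovector_cons {α : (Fin (p + 1) → Model n m) → ℝ} (hα : IsAlternating α)
    (a : Model n m → ℝ) (u : Model n m) (v : Fin (p + 1) → Model n m) :
    wedgeCovector a (fun w => α (Fin.cons u w)) v = ∑ j, a (v j) * α (Function.update v j u) := by
  refine Finset.sum_congr rfl fun j _ => ?_
  rw [hα.update_eq]; ring

/-- Leibniz rule. -/
theorem derivAction_wedgeCovector (C : Model n m → Model n m) (a : Model n m → ℝ)
    (α : (Fin p → Model n m) → ℝ) : derivAction C (wedgeCovector a α) =
      wedgeCovector (fun v => a (C v)) α + wedgeCovector a (derivAction C α) := by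
  funext v
  simp only [derivAction, wedgeCovector, Pi.add_apply, Finset.mul_sum]
  rw [Finset.sum_comm, ← Finset.sum_add_distrib]
  refine Finset.sum_congr rfl fun i _ => ?_
  rw [Fin.sum_univ_succAbove _ i]
  congr 1
  · simp
  · refine Finset.sum_congr rfl fun j _ => ?_
    rw [Function.update_of_ne (Fin.succAbove_ne i j).symm]
    congr 2
    funext l
    by_cases h : l = j
    · subst h; simp
    · rw [Function.update_of_ne h,
        Function.update_of_ne fun e => h (Fin.succAbove_right_injective e)]

theorem derivAction_cons (C : Model n m → Model n m) (α : (Fin (p + 1) → Model n m) → ℝ)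
    (u : Model n m) (v : Fin p → Model n m) : derivAction C α (Fin.cons u v) =
      α (Fin.cons (C u) v) + derivAction C (fun w => α (Fin.cons u w)) v := by
  simp only [derivAction]
  rw [Fin.sum_univ_succ]
  simp

/-- Contraction of the exterior product with a covector. -/
theorem wedgeCovector_cons_left (a : Model n m → ℝ) (α : (Fin (p + 1) → Model n m) → ℝ)
    (u : Model n m) (v : Fin (p + 1) → Model n m) : wedgeCovector a α (Fin.cons u v) =
      a u * α v - wedgeCovector a (fun w => α (Fin.cons u w)) v := by
  simp only [wedgeCovector]
  rw [Fin.sum_univ_succ, sub_eq_add_neg, ← Finset.sum_neg_distrib]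
  congr 1
  · simp
  · refine Finset.sum_congr rfl fun j _ => ?_
    have : (fun l => (Fin.cons u v : Fin (p + 2) → Model n m) (j.succ.succAbove l)) =
        Fin.cons u fun l => v (j.succAbove l) := by
      funext l
      refine Fin.cases ?_ (fun l => ?_) l <;> simp
    rw [this]
    simp [pow_succ]

/-- The vertical part of a vector at the point `z`, along the splitting by the total derivatives. -/
def vertPart (z : Model n m) : Model n m →ₗ[ℝ] Model n m where
  toFun v := v - horizPart z v
  map_add' v w := by
    have : horizPart z (v + w) = horizPart z v + horizPart z w := by
      simp [horizPart, add_smul, Finset.sum_add_distrib]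
    rw [this]; abel
  map_smul' c v := by
    have : horizPart z (c • v) = c • horizPart z v := by
      simp [horizPart, mul_smul, Finset.smul_sum]
    rw [this, smul_sub]; rfl

theorem vertPart_apply (z v : Model n m) : vertPart z v = v - horizPart z v := rfl

theorem horizPart_fst (z v : Model n m) : (horizPart z v).1 = v.1 := by
  funext l
  simp [horizPart, totalVec, Prod.fst_sum, Finset.sum_apply, Pi.single_apply]

theorem horizPart_snd (z v : Model n m) (a : Fin m × MultiIndex n) :
    (horizPart z v).2 a = ∑ l, v.1 l * z.2 (a.1, a.2.cons l) := by
  simp [horizPart, totalVec, Prod.snd_sum, Finset.sum_apply]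

theorem vertPart_fst (z v : Model n m) : (vertPart z v).1 = 0 := by
  rw [vertPart_apply, Prod.fst_sub, horizPart_fst, sub_self]

theorem vertPart_snd (z v : Model n m) (a : Fin m × MultiIndex n) :
    (vertPart z v).2 a = contactForm a.1 a.2 z v := by
  rw [vertPart_apply, Prod.snd_sub, Pi.sub_apply, horizPart_snd, contactForm]
  simp [mul_comm]

theorem horizPart_of_fst_eq_zero {z v : Model n m} (h : v.1 = 0) : horizPart z v = 0 := by
  simp [horizPart, h]

theorem horizPart_congr {z v w : Model n m} (h : v.1 = w.1) : horizPart z v = horizPart z w := by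
  simp [horizPart, h]

theorem vertPart_vertPart (z v : Model n m) : vertPart z (vertPart z v) = vertPart z v := by
  rw [vertPart_apply z (vertPart z v), horizPart_of_fst_eq_zero (vertPart_fst z v), sub_zero]

theorem vertPart_horizPart (z v : Model n m) : vertPart z (horizPart z v) = 0 := by
  rw [vertPart_apply, horizPart_congr (horizPart_fst z v), sub_self]

theorem vertPart_totalVec (z : Model n m) (l : Fin n) : vertPart z (totalVec l z) = 0 := by
  have : totalVec l z = horizPart z (totalVec l z) := by
    simp [horizPart, totalVec, Pi.single_apply]
  rw [this, vertPart_horizPart]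

/-- The vectors `v` with the arguments in `A` replaced by their vertical parts and the other ones
by their horizontal parts. -/
def splitAt (z : Model n m) (A : Finset (Fin p)) (v : Fin p → Model n m) : Fin p → Model n m :=
  fun j => if j ∈ A then v j - horizPart z (v j) else horizPart z (v j)

theorem contactPart_eq (k : ℕ) (z : Model n m) (α : (Fin p → Model n m) → ℝ)
    (v : Fin p → Model n m) : contactPart k z α v =
      ∑ A ∈ (Finset.univ : Finset (Fin p)).powersetCard k, α (splitAt z A v) := rfl

theorem IsAlternating.eq_sum_splitAt {α : (Fin p → Model n m) → ℝ} (hα : IsAlternating α)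
    (z : Model n m) (v : Fin p → Model n m) : α v = ∑ A : Finset (Fin p), α (splitAt z A v) := by
  obtain ⟨a, rfl⟩ := hα
  have := a.map_add_univ (fun j => vertPart z (v j)) (fun j => horizPart z (v j))
  have h2 : ((fun j => vertPart z (v j)) + fun j => horizPart z (v j)) = v := by
    funext j; simp [vertPart_apply]
  rw [h2] at this
  rw [this]
  refine Finset.sum_congr rfl fun A _ => congrArg a (funext fun j => ?_)
  simp [splitAt, Finset.piecewise, vertPart_apply]

theorem derivAction_vertPart_splitAt {α : (Fin p → Model n m) → ℝ} (hα : IsAlternating α)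
    (z : Model n m) (A : Finset (Fin p)) (v : Fin p → Model n m) :
    derivAction (vertPart z) α (splitAt z A v) = A.card * α (splitAt z A v) := by
  obtain ⟨a, rfl⟩ := hα
  have h : ∀ j, a (Function.update (splitAt z A v) j (vertPart z (splitAt z A v j))) =
      if j ∈ A then a (splitAt z A v) else 0 := by
    intro j
    split_ifs with hj
    · congr 1
      rw [Function.update_eq_self_iff]
      simp only [splitAt, if_pos hj]
      exact vertPart_vertPart z (v j)
    · refine a.map_coord_zero j ?_
      simp only [Function.update_self, splitAt, if_neg hj]
      exact vertPart_horizPart z (v j)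
  simp only [derivAction, h]
  rw [← Finset.sum_filter]; simp

/-- A form is its own `k`-contact part if and only if it is an eigenvector with eigenvalue `k` of
the derivation which replaces the arguments by their vertical parts, one at a time. -/
theorem contactPart_eq_self_iff {α : (Fin p → Model n m) → ℝ} (hα : IsAlternating α)
    (k : ℕ) (z : Model n m) :
    contactPart k z α = α ↔ derivAction (vertPart z) α = (k : ℝ) • α := by
  constructor
  · intro h
    funext v
    -- every summand of the `k`-contact part has `k` vertical arguments, which are reproduced
    have h1 : ∀ (A : Finset (Fin p)) (j : Fin p),
        α (splitAt z A (Function.update v j (vertPart z (v j)))) =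
          if j ∈ A then α (splitAt z A v) else 0 := by
      intro A j
      split_ifs with hj
      · congr 1
        funext i
        by_cases hi : i = j
        · subst hi
          simp only [splitAt, if_pos hj, Function.update_self]
          exact vertPart_vertPart z (v i)
        · simp [splitAt, Function.update_of_ne hi]
      · obtain ⟨a, rfl⟩ := hα
        refine a.map_coord_zero j ?_
        simp only [splitAt, if_neg hj, Function.update_self]
        exact horizPart_of_fst_eq_zero (vertPart_fst z _)
    rw [← h]
    simp only [derivAction, contactPart_eq, h1, Pi.smul_apply, smul_eq_mul, Finset.mul_sum]
    rw [Finset.sum_comm]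
    refine Finset.sum_congr rfl fun A hA => ?_
    rw [← Finset.sum_filter]
    simp [(Finset.mem_powersetCard.1 hA).2]
  · intro h
    funext v
    -- the summand with the vertical arguments `A` is an eigenvector with eigenvalue `#A`
    rw [hα.eq_sum_splitAt z v, contactPart_eq]
    refine Finset.sum_subset (Finset.subset_univ _) fun A _ hA => ?_
    have hc : (A.card : ℝ) ≠ k := by
      intro e
      exact hA (Finset.mem_powersetCard.2 ⟨Finset.subset_univ _, by exact_mod_cast e⟩)
    have h2 := derivAction_vertPart_splitAt hα z A v
    rw [h, Pi.smul_apply, smul_eq_mul] at h2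
    by_contra h0
    exact hc (mul_right_cancel₀ h0 h2).symm

/-- The covector `dx^ν`. -/
def dxCovector (ν : Fin n) : Model n m →ₗ[ℝ] ℝ where
  toFun v := v.1 ν
  map_add' _ _ := rfl
  map_smul' _ _ := rfl

/-- A `k`-contact form of degree `k + n` is horizontal of the maximal degree `n`: its product with
any `dx^ν` vanishes, since `n + 1` horizontal vectors are linearly dependent. -/
theorem wedgeCovector_dx_eq_zero {α : (Fin p → Model n m) → ℝ} (hα : IsAlternating α) {k : ℕ}
    {z : Model n m} (hp : p = k + n) (h : derivAction (vertPart z) α = (k : ℝ) • α) (ν : Fin n) :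
    wedgeCovector (dxCovector ν) α = 0 := by
  have halt := hα.wedgeCovector (dxCovector ν)
  have h0 : ∀ v, dxCovector ν (vertPart z v) = (0 : ℝ) := fun v => by
    change (vertPart z v).1 ν = 0
    rw [vertPart_fst]; rfl
  have h1 : derivAction (vertPart z) (wedgeCovector (dxCovector ν) α) =
      (k : ℝ) • wedgeCovector (dxCovector ν) α := by
    rw [derivAction_wedgeCovector, h]
    funext v
    simp only [h0, wedgeCovector, Pi.add_apply, Pi.smul_apply, smul_eq_mul, Finset.mul_sum]
    simp only [mul_zero, zero_mul, Finset.sum_const_zero, zero_add]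
    exact Finset.sum_congr rfl fun j _ => by ring
  rw [← (contactPart_eq_self_iff halt k z).2 h1]
  funext v
  rw [contactPart_eq]
  refine Finset.sum_eq_zero fun A hA => ?_
  obtain ⟨b, hb⟩ := halt
  rw [← hb]
  -- the degree is `k + n + 1` and `k` arguments are vertical, so that `n + 1` are horizontal
  refine b.map_linearDependent _ fun hli => ?_
  let L : (Fin n → ℝ) →ₗ[ℝ] Model n m := ∑ l, (LinearMap.proj l).smulRight (totalVec l z)
  have hL : ∀ j : {j // j ∉ A}, splitAt z A v j = L (v j).1 := by
    intro j
    simp [splitAt, j.2, horizPart, L, LinearMap.sum_apply]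
  have h2 : LinearIndependent ℝ (fun j : {j // j ∉ A} => (v j).1) := by
    have h3 := hli.comp (fun j : {j // j ∉ A} => j.1) Subtype.val_injective
    rw [show splitAt z A v ∘ (fun j : {j // j ∉ A} => j.1) =
      L ∘ fun j : {j // j ∉ A} => (v j).1 from funext hL] at h3
    exact LinearIndependent.of_comp L h3
  have h3 := h2.fintype_card_le_finrank
  rw [Fintype.card_subtype_compl, Fintype.card_fin] at h3
  simp [(Finset.mem_powersetCard.1 hA).2] at h3
  omega

/-- The form only depends on finitely many components of its arguments. -/
def SeesOnly (S : Finset (Fin m × MultiIndex n)) (α : (Fin p → Model n m) → ℝ) : Prop :=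
  ∀ v w, (∀ j, restrictTo S (v j) = restrictTo S (w j)) → α v = α w

theorem SeesOnly.mono {S S' : Finset (Fin m × MultiIndex n)} (h : S ⊆ S')
    {α : (Fin p → Model n m) → ℝ} (hα : SeesOnly S α) : SeesOnly S' α := fun v w e =>
  hα v w fun j => by rw [← restrictRestrict_apply h, e, restrictRestrict_apply]

/-- The tangent vector `∂_i^Λ`. -/
def fibreVec (a : Fin m × MultiIndex n) : Model n m := (0, Pi.single a 1)

theorem interiorDy_apply (i : Fin m) (Λ : MultiIndex n) (φ : ModelForm n m (p + 1))
    (z : Model n m) (v : Fin p → Model n m) :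
    interiorDy i Λ φ z v = φ z (Fin.cons (fibreVec (i, Λ)) v) := by
  unfold interiorDy fibreVec
  congr!

theorem restrictTo_eq_sum_fibreVec (S : Finset (Fin m × MultiIndex n)) {v : Model n m}
    (h : v.1 = 0) : restrictTo S v = restrictTo S (∑ a ∈ S, v.2 a • fibreVec a) := by
  refine Prod.ext ?_ (funext fun a => ?_)
  · change v.1 = (∑ a ∈ S, v.2 a • fibreVec a : Model n m).1
    simp [h, Prod.fst_sum, fibreVec]
  · change v.2 a = (∑ a ∈ S, v.2 a • fibreVec a : Model n m).2 a
    simp [Prod.snd_sum, fibreVec, Finset.sum_apply, Pi.single_apply]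

theorem SeesOnly.update_eq_sum {S : Finset (Fin m × MultiIndex n)}
    {α : (Fin p → Model n m) → ℝ} (hS : SeesOnly S α) (hα : IsAlternating α)
    (v : Fin p → Model n m) (j : Fin p) {x : Model n m} (hx : x.1 = 0) :
    α (Function.update v j x) = ∑ a ∈ S, x.2 a * α (Function.update v j (fibreVec a)) := by
  rw [hS _ (Function.update v j (∑ a ∈ S, x.2 a • fibreVec a))]
  · obtain ⟨b, rfl⟩ := hα
    simp [AlternatingMap.map_update_sum, AlternatingMap.map_update_smul]
  · intro l
    by_cases h : l = j
    · subst h; simpa using restrictTo_eq_sum_fibreVec S hx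
    · simp [Function.update_of_ne h]

theorem SeesOnly.cons_eq_sum {S : Finset (Fin m × MultiIndex n)}
    {α : (Fin (p + 1) → Model n m) → ℝ} (hS : SeesOnly S α) (hα : IsAlternating α)
    (v : Fin p → Model n m) {x : Model n m} (hx : x.1 = 0) :
    α (Fin.cons x v) = ∑ a ∈ S, x.2 a * α (Fin.cons (fibreVec a) v) := by
  simpa using hS.update_eq_sum hα (Fin.cons 0 v) 0 hx

theorem SeesOnly.cons_fibreVec_eq_zero {S : Finset (Fin m × MultiIndex n)}
    {α : (Fin (p + 1) → Model n m) → ℝ} (hS : SeesOnly S α) (hα : IsAlternating α)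
    {a : Fin m × MultiIndex n} (ha : a ∉ S) (v : Fin p → Model n m) :
    α (Fin.cons (fibreVec a) v) = 0 := by
  rw [hS.cons_eq_sum hα v rfl]
  refine Finset.sum_eq_zero fun b hb => ?_
  have : b ≠ a := fun e => ha (e ▸ hb)
  simp [fibreVec, this]

/-- A form with contact degree `k` is recovered from its contractions with the `∂_i^Λ`. -/
theorem sum_contactForm_wedge {S : Finset (Fin m × MultiIndex n)}
    {α : (Fin (p + 1) → Model n m) → ℝ} (hS : SeesOnly S α) (hα : IsAlternating α)
    (z : Model n m) (v : Fin (p + 1) → Model n m) :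
    ∑ a ∈ S, wedgeCovector (contactForm a.1 a.2 z) (fun w => α (Fin.cons (fibreVec a) w)) v =
      derivAction (vertPart z) α v := by
  simp only [wedgeCovector_cons hα, derivAction]
  rw [Finset.sum_comm]
  refine Finset.sum_congr rfl fun j _ => ?_
  rw [hS.update_eq_sum hα v j (vertPart_fst z _)]
  simp [vertPart_snd]

/-- `contactForm i Λ z` as a linear map. -/
def contactCovector (i : Fin m) (Λ : MultiIndex n) (z : Model n m) : Model n m →ₗ[ℝ] ℝ where
  toFun := contactForm i Λ z
  map_add' v w := by
    simp only [contactForm, Prod.snd_add, Pi.add_apply, Prod.fst_add, mul_add,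
      Finset.sum_add_distrib]
    ring
  map_smul' c v := by
    simp only [contactForm, Prod.smul_snd, Pi.smul_apply, Prod.smul_fst, smul_eq_mul,
      RingHom.id_apply, mul_sub, Finset.mul_sum]
    congr 1
    exact Finset.sum_congr rfl fun l _ => by ring

/-- `shiftVec l` as a linear map. -/
def shiftLin (l : Fin n) : Model n m →ₗ[ℝ] Model n m where
  toFun := shiftVec l
  map_add' v w := by ext <;> simp [shiftVec]
  map_smul' c v := by ext <;> simp [shiftVec]

end PointwiseAlgebra

/-! ### Exterior forms of finite order on the model -/

section FiniteOrderForms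

variable {n m p : ℕ}

/-- Near `z`, the form `φ` is the pull-back of a smooth exterior form in finitely many of the
coordinates. -/
def FiniteOrderFormAt (φ : ModelForm n m p) (z : Model n m) : Prop :=
  ∃ (S : Finset (Fin m × MultiIndex n)) (W : Set ((Fin n → ℝ) × (S → ℝ)))
    (α : (Fin n → ℝ) × (S → ℝ) → ((Fin n → ℝ) × (S → ℝ)) [⋀^Fin p]→L[ℝ] ℝ),
    IsOpen W ∧ restrictTo S z ∈ W ∧ ContDiffOn ℝ ∞ α W ∧
      ∀ᶠ z' in 𝓝 z, ∀ v, φ z' v = α (restrictTo S z') (fun j => restrictTo S (v j))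

theorem FiniteOrderFormAt.congr {φ ψ : ModelForm n m p} {z : Model n m}
    (hφ : FiniteOrderFormAt φ z) (h : ψ =ᶠ[𝓝 z] φ) : FiniteOrderFormAt ψ z := by
  obtain ⟨S, W, α, hW, hz, hα, e⟩ := hφ
  exact ⟨S, W, α, hW, hz, hα, by filter_upwards [h, e] with z' a b v using a ▸ b v⟩

theorem FiniteOrderFormAt.eventually {φ : ModelForm n m p} {z : Model n m}
    (hφ : FiniteOrderFormAt φ z) : ∀ᶠ z' in 𝓝 z, FiniteOrderFormAt φ z' := by
  obtain ⟨S, W, α, hW, hz, hα, e⟩ := hφ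
  filter_upwards [(hW.preimage (continuous_restrictTo S)).mem_nhds hz, e.eventually_nhds]
    with z' a b using ⟨S, W, α, hW, a, hα, b⟩

theorem isAlternating_restrictTo (S : Finset (Fin m × MultiIndex n))
    (a : ((Fin n → ℝ) × (S → ℝ)) [⋀^Fin p]→L[ℝ] ℝ) :
    IsAlternating (fun v : Fin p → Model n m => a (fun j => restrictTo S (v j))) :=
  ⟨a.toAlternatingMap.compLinearMap (restrictCLM S : Model n m →ₗ[ℝ] _), rfl⟩

theorem seesOnly_restrictTo (S : Finset (Fin m × MultiIndex n))
    (a : ((Fin n → ℝ) × (S → ℝ)) [⋀^Fin p]→L[ℝ] ℝ) :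
    SeesOnly S (fun v : Fin p → Model n m => a (fun j => restrictTo S (v j))) :=
  fun v w h => by simp only [h]

theorem FiniteOrderFormAt.exists_seesOnly {φ : ModelForm n m p} {z : Model n m}
    (hφ : FiniteOrderFormAt φ z) : ∃ S, ∀ᶠ z' in 𝓝 z, IsAlternating (φ z') ∧ SeesOnly S (φ z') := by
  obtain ⟨S, W, α, hW, hz, hα, e⟩ := hφ
  refine ⟨S, e.mono fun z' h => ?_⟩
  rw [show φ z' = fun v => α (restrictTo S z') (fun j => restrictTo S (v j)) from funext h]
  exact ⟨isAlternating_restrictTo S _, seesOnly_restrictTo S _⟩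

theorem FiniteOrderFormAt.isAlternating {φ : ModelForm n m p} {z : Model n m}
    (hφ : FiniteOrderFormAt φ z) : IsAlternating (φ z) :=
  let ⟨_, h⟩ := hφ.exists_seesOnly
  h.self_of_nhds.1

/-- The values of a form on fields of finite order, along a map of finite order. -/
theorem FiniteOrderFormAt.apply_field {φ : ModelForm n m p} {T : Model n m → Model n m}
    {w : Fin p → Model n m → Model n m} {z : Model n m} (hφ : FiniteOrderFormAt φ (T z))
    (hT : FiniteOrderMapAt T z) (hw : ∀ j, FiniteOrderMapAt (w j) z) :
    FiniteOrderAt (fun z => φ (T z) (fun j => w j z)) z := by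
  obtain ⟨S, W, α, hW, hz, hα, e⟩ := hφ
  have h1 := (hT.restrictTo S).comp hW hα hz
  have h2 := FiniteOrderAt.pi fun j => (hw j).restrictTo S
  refine ((h1.prodMk h2).contDiff_comp (g := fun q : ((((Fin n → ℝ) × (S → ℝ))) [⋀^Fin p]→L[ℝ] ℝ) ×
    (Fin p → (Fin n → ℝ) × (S → ℝ)) => q.1 q.2) ?_).congr
      ((hT.continuousAt.eventually e).mono fun z' h => h _)
  have h3 : ContDiff ℝ ∞ fun q : (ContinuousMultilinearMap ℝ
      (fun _ : Fin p => (Fin n → ℝ) × (S → ℝ)) ℝ) × (Fin p → (Fin n → ℝ) × (S → ℝ)) => q.1 q.2 :=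
    ((ContinuousLinearMap.id ℝ (ContinuousMultilinearMap ℝ
      (fun _ : Fin p => (Fin n → ℝ) × (S → ℝ)) ℝ)).continuousMultilinearMapOption.contDiff).comp
        (contDiff_pi.2 fun _ => contDiff_id)
  exact h3.comp ((ContinuousAlternatingMap.toContinuousMultilinearMapCLM ℝ).contDiff.prodMap
    contDiff_id)

theorem FiniteOrderFormAt.apply {φ : ModelForm n m p} {z : Model n m} (hφ : FiniteOrderFormAt φ z)
    (v : Fin p → Model n m) : FiniteOrderAt (fun z => φ z v) z :=
  FiniteOrderFormAt.apply_field (T := fun z => z) (w := fun j _ => v j) hφ (finiteOrderMapAt_id z)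
    fun j => finiteOrderMapAt_const (v j) z

/-- Product rule for the values of a form on vector fields, along a map. -/
theorem FiniteOrderFormAt.lineDeriv_apply_field {φ : ModelForm n m p}
    {T : Model n m → Model n m} {w : Fin p → Model n m → Model n m} {z : Model n m}
    (hφ : FiniteOrderFormAt φ (T z)) (hT : FiniteOrderMapAt T z)
    (hw : ∀ j, FiniteOrderMapAt (w j) z) (u : Model n m) :
    lineDeriv ℝ (fun z => φ (T z) (fun j => w j z)) z u =
      lineDeriv ℝ (fun y => φ y (fun j => w j z)) (T z) (mapDeriv T z u) +
        ∑ j, φ (T z) (Function.update (fun j => w j z) j (mapDeriv (w j) z u)) := by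
  have hv := hφ.apply fun j => w j z
  obtain ⟨S, W, α, hW, hz, hα, e⟩ := hφ
  have hαd : HasFDerivAt α (fderiv ℝ α (restrictTo S (T z))) (restrictTo S (T z)) :=
    ((hα.contDiffAt (hW.mem_nhds hz)).differentiableAt (by simp)).hasFDerivAt
  have key : ∀ (w : Fin p → Model n m → Model n m), (∀ j, FiniteOrderMapAt (w j) z) →
      lineDeriv ℝ (fun z => φ (T z) (fun j => w j z)) z u =
        fderiv ℝ α (restrictTo S (T z)) (restrictTo S (mapDeriv T z u))
          (fun j => restrictTo S (w j z)) +
        ∑ j, φ (T z) (Function.update (fun j => w j z) j (mapDeriv (w j) z u)) := by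
    intro w hw
    have h1 : HasDerivAt (fun t : ℝ => α (restrictTo S (T (z + t • u))))
        (fderiv ℝ α (restrictTo S (T z)) (restrictTo S (mapDeriv T z u))) 0 := by
      have := HasFDerivAt.comp_hasDerivAt (0 : ℝ) (l := α)
        (f := fun t : ℝ => restrictTo S (T (z + t • u))) (by simpa using hαd)
        ((hT.hasCurveDeriv_line u).restrictTo S)
      simpa [Function.comp_def] using this
    have h2 := fun j => ((hw j).hasCurveDeriv_line u).restrictTo S
    have h3 := (HasFDerivAt.continuousAlternatingMap_apply h1.hasFDerivAt
      (fun j => (h2 j).hasFDerivAt)).hasDerivAt.deriv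
    rw [lineDeriv_congr_nhds (g := fun z => α (restrictTo S (T z)) (fun j => restrictTo S (w j z)))
      ((hT.continuousAt.eventually e).mono fun z' h => h _)]
    rw [lineDeriv, h3]
    simp only [zero_smul, add_zero, _root_.add_apply, ContinuousLinearMap.comp_apply,
      _root_.sum_apply, ContinuousLinearMap.toSpanSingleton_apply, one_smul]
    congr 1
    refine Finset.sum_congr rfl fun j _ => ?_
    rw [e.self_of_nhds]
    simp only [ContinuousAlternatingMap.toContinuousLinearMap_apply]
    congr 1
    funext i
    by_cases h : i = j
    · subst h; simp
    · simp [Function.update_of_ne h]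
  rw [key w hw, ← lineDeriv_comp_map hv hT]
  -- the case of constant fields identifies the first term
  have h0 := key (fun j _ => w j z) fun j => finiteOrderMapAt_const _ z
  rw [h0]
  obtain ⟨a, ha⟩ := isAlternating_restrictTo S (α (restrictTo S (T z)))
  have h4 : ∀ v, φ (T z) v = a v := fun v => by rw [e.self_of_nhds, ha]
  simp [mapDeriv_const, h4]

theorem FiniteOrderMapAt.lineDeriv_restrictTo {T : Model n m → Model n m} {z : Model n m}
    (hT : FiniteOrderMapAt T z) (S : Finset (Fin m × MultiIndex n)) (v : Model n m) :
    lineDeriv ℝ (fun z => _root_.restrictTo S (T z)) z v =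
      _root_.restrictTo S (mapDeriv T z v) :=
  ((hT.hasCurveDeriv_line v).restrictTo S).deriv

/-- Finitely many components of the image of a vector only depend on finitely many components
of that vector, uniformly near `z`. -/
theorem exists_mapDeriv_congr {T : Model n m → Model n m} {z : Model n m}
    (hT : ∀ᶠ z' in 𝓝 z, FiniteOrderMapAt T z') (S : Finset (Fin m × MultiIndex n)) :
    ∃ S' : Finset (Fin m × MultiIndex n), ∀ᶠ z' in 𝓝 z, ∀ v w,
      restrictTo S' v = restrictTo S' w →
        restrictTo S (mapDeriv T z' v) = restrictTo S (mapDeriv T z' w) := by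
  obtain ⟨S', h⟩ := (hT.self_of_nhds.restrictTo S).exists_lineDeriv_congr
  refine ⟨S', (h.and hT).mono fun z' h v w e => ?_⟩
  rw [← h.2.lineDeriv_restrictTo, ← h.2.lineDeriv_restrictTo, h.1 v w e]

/-- The zero extension of a truncated vector. -/
def extendLin (S : Finset (Fin m × MultiIndex n)) :
    ((Fin n → ℝ) × (S → ℝ)) →ₗ[ℝ] Model n m where
  toFun x := (x.1, fun a => if h : a ∈ S then x.2 ⟨a, h⟩ else 0)
  map_add' x y := by
    refine Prod.ext rfl (funext fun a => ?_)
    by_cases h : a ∈ S <;> simp [h]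
  map_smul' c x := by
    refine Prod.ext rfl (funext fun a => ?_)
    by_cases h : a ∈ S <;> simp [h]

theorem restrictTo_extendLin (S : Finset (Fin m × MultiIndex n)) (x : (Fin n → ℝ) × (S → ℝ)) :
    restrictTo S (extendLin S x) = x := by
  refine Prod.ext rfl (funext fun a => ?_)
  simp [restrictTo, extendLin]

theorem continuous_multilinear_of_finiteDimensional {E : Type*} [NormedAddCommGroup E]
    [NormedSpace ℝ E] [FiniteDimensional ℝ E] (f : MultilinearMap ℝ (fun _ : Fin p => E) ℝ) :
    Continuous f := by
  let b := Module.finBasis ℝ E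
  have h : ∀ v : Fin p → E, f v = ∑ r : Fin p → Fin (Module.finrank ℝ E),
      (∏ j, b.repr (v j) (r j)) * f fun j => b (r j) := by
    intro v
    conv_lhs => rw [show v = fun j => ∑ i, b.repr (v j) i • b i from
      funext fun j => (b.sum_repr (v j)).symm]
    rw [MultilinearMap.map_sum]
    exact Finset.sum_congr rfl fun r _ => f.map_smul_univ _ _
  rw [show (f : (Fin p → E) → ℝ) = _ from funext h]
  have hb : ∀ i, Continuous fun x : E => b.repr x i := fun i =>
    (b.coord i).continuous_of_finiteDimensional
  refine continuous_finsetSum _ fun r _ => Continuous.mul ?_ continuous_const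
  exact continuous_finsetProd _ fun j _ => (hb (r j)).comp (continuous_apply j)

/-- A criterion for forms of finite order: being alternating, seeing only finitely many components
of the arguments, and having values of finite order on constant arguments. -/
theorem FiniteOrderFormAt.mk {φ : ModelForm n m p} {z : Model n m}
    {S : Finset (Fin m × MultiIndex n)}
    (h : ∀ᶠ z' in 𝓝 z, IsAlternating (φ z') ∧ SeesOnly S (φ z'))
    (hφ : ∀ v, FiniteOrderAt (fun z => φ z v) z) : FiniteOrderFormAt φ z := by
  let E := (Fin n → ℝ) × (S → ℝ)
  let b := Module.finBasis ℝ E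
  let I := Fin p → Fin (Module.finrank ℝ E)
  -- a form on the truncated space is determined by its values on the tuples of basis vectors
  let ev : (E [⋀^Fin p]→L[ℝ] ℝ) →ₗ[ℝ] (I → ℝ) :=
    { toFun := fun a r => a fun j => b (r j)
      map_add' := fun _ _ => rfl
      map_smul' := fun _ _ => rfl }
  have hev : LinearMap.ker ev = ⊥ := by
    refine LinearMap.ker_eq_bot.2 fun a a' haa => ?_
    refine ContinuousAlternatingMap.toAlternatingMap_injective ?_
    exact b.ext_alternating fun r _ => congrFun haa r
  obtain ⟨ρ, hρ⟩ := ev.exists_leftInverse_of_injective hev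
  let F : Model n m → I → ℝ := fun z r => φ z fun j => extendLin S (b (r j))
  have hF : FiniteOrderAt F z := FiniteOrderAt.pi fun r => hφ _
  obtain ⟨S₁, hS₁⟩ := hF.exists_of_superset
  classical
  obtain ⟨W, g, hW, hz, hg, e⟩ := hS₁ (S₁ ∪ S) Finset.subset_union_left
  let ρ' := (ContinuousAlternatingMap.compContinuousLinearMapₗ (N := ℝ) (ι := Fin p)
    (restrictRestrict (Finset.subset_union_right (s₁ := S₁) (s₂ := S)))) ∘ₗ ρ
  have hρ' : ContDiff ℝ ∞ ρ' := (LinearMap.toContinuousLinearMap ρ').contDiff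
  refine ⟨S₁ ∪ S, W, fun x => ρ' (g x), hW, hz, hρ'.comp_contDiffOn hg, ?_⟩
  filter_upwards [e, h] with z' hz' ⟨⟨a, ha⟩, hs⟩ v
  let a' : E [⋀^Fin p]→L[ℝ] ℝ :=
    { (a.compLinearMap (extendLin S)) with
      cont := continuous_multilinear_of_finiteDimensional
        (a.compLinearMap (extendLin S)).toMultilinearMap }
  have ha' : F z' = ev a' := by
    funext r
    change φ z' _ = a _
    rw [ha]
  have h2 : ρ (ev a') = a' := LinearMap.congr_fun hρ a'
  rw [← hz', ha']
  change _ = ρ (ev a') (fun j => restrictTo S (v j))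
  rw [h2]
  change _ = a fun j => extendLin S (restrictTo S (v j))
  rw [ha]
  exact hs _ _ fun j => (restrictTo_extendLin S _).symm

theorem finiteOrderFormAt_zero (z : Model n m) : FiniteOrderFormAt (0 : ModelForm n m p) z :=
  .mk (S := ∅) (.of_forall fun _ => ⟨isAlternating_zero, fun _ _ _ => rfl⟩)
    fun _ => finiteOrderAt_const 0 z

theorem FiniteOrderFormAt.add {φ ψ : ModelForm n m p} {z : Model n m}
    (hφ : FiniteOrderFormAt φ z) (hψ : FiniteOrderFormAt ψ z) : FiniteOrderFormAt (φ + ψ) z := by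
  classical
  obtain ⟨S, h⟩ := hφ.exists_seesOnly
  obtain ⟨S', h'⟩ := hψ.exists_seesOnly
  refine .mk (S := S ∪ S') ?_ fun v => (hφ.apply v).add (hψ.apply v)
  filter_upwards [h, h'] with z' a b
  refine ⟨a.1.add b.1, fun v w e => ?_⟩
  change φ z' v + ψ z' v = φ z' w + ψ z' w
  rw [a.2.mono Finset.subset_union_left v w e, b.2.mono Finset.subset_union_right v w e]

/-- The product of a function and a form. -/
def funSmul (f : Model n m → ℝ) (φ : ModelForm n m p) : ModelForm n m p := fun z => f z • φ z

theorem FiniteOrderFormAt.funSmul {f : Model n m → ℝ} {φ : ModelForm n m p} {z : Model n m}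
    (hf : FiniteOrderAt f z) (hφ : FiniteOrderFormAt φ z) :
    FiniteOrderFormAt (funSmul f φ) z := by
  obtain ⟨S, h⟩ := hφ.exists_seesOnly
  refine .mk (S := S) (h.mono fun z' a => ⟨a.1.smul _, fun v w e => ?_⟩)
    fun v => hf.mul (hφ.apply v)
  change f z' * φ z' v = f z' * φ z' w
  rw [a.2 v w e]

theorem FiniteOrderFormAt.const_smul {φ : ModelForm n m p} {z : Model n m}
    (hφ : FiniteOrderFormAt φ z) (c : ℝ) : FiniteOrderFormAt (c • φ) z :=
  .funSmul (f := fun _ => c) (finiteOrderAt_const c z) hφ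

theorem FiniteOrderFormAt.sum {κ : Type*} {s : Finset κ} {φ : κ → ModelForm n m p}
    {z : Model n m} (h : ∀ a ∈ s, FiniteOrderFormAt (φ a) z) :
    FiniteOrderFormAt (∑ a ∈ s, φ a) z := by
  classical
  induction s using Finset.induction_on with
  | empty => exact finiteOrderFormAt_zero z
  | insert a s ha ih =>
    rw [Finset.sum_insert ha]
    exact (h a (Finset.mem_insert_self a s)).add
      (ih fun b hb => h b (Finset.mem_insert_of_mem hb))

theorem FiniteOrderFormAt.interiorDy {φ : ModelForm n m (p + 1)} {z : Model n m}
    (hφ : FiniteOrderFormAt φ z) (i : Fin m) (Λ : MultiIndex n) :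
    FiniteOrderFormAt (interiorDy i Λ φ) z := by
  obtain ⟨S, h⟩ := hφ.exists_seesOnly
  have e : ∀ z', _root_.interiorDy i Λ φ z' = fun v => φ z' (Fin.cons (fibreVec (i, Λ)) v) :=
    fun z' => funext fun v => interiorDy_apply i Λ φ z' v
  refine .mk (S := S) (h.mono fun z' a => ?_) fun v => ?_
  · rw [e]
    refine ⟨a.1.cons _, fun v w e => a.2 _ _ fun j => ?_⟩
    refine Fin.cases rfl (fun j => ?_) j
    simpa using e j
  · simp only [interiorDy_apply]
    exact hφ.apply _

/-- Exterior products with a one-form whose values are of finite order. -/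
theorem FiniteOrderFormAt.wedgeOne {φ : ModelForm n m p} {z : Model n m}
    (hφ : FiniteOrderFormAt φ z) {a : Model n m → Model n m →ₗ[ℝ] ℝ}
    {S' : Finset (Fin m × MultiIndex n)}
    (ha : ∀ z v w, restrictTo S' v = restrictTo S' w → a z v = a z w)
    (ha' : ∀ v, FiniteOrderAt (fun z => a z v) z) :
    FiniteOrderFormAt (wedgeOne (fun z v => a z v) φ) z := by
  classical
  obtain ⟨S, h⟩ := hφ.exists_seesOnly
  refine .mk (S := S ∪ S') (h.mono fun z' b => ⟨b.1.wedgeCovector (a z'), fun v w e => ?_⟩)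
    fun v => FiniteOrderAt.sum fun j _ =>
      ((finiteOrderAt_const _ z).mul (ha' _)).mul (hφ.apply _)
  refine Finset.sum_congr rfl fun j _ => ?_
  beta_reduce
  rw [b.2.mono Finset.subset_union_left _ (fun l => w (j.succAbove l)) fun l => e _,
    ha z' (v j) (w j) (by
      rw [← restrictRestrict_apply (Finset.subset_union_right (s₁ := S)), e,
        restrictRestrict_apply])]

theorem finiteOrderAt_contactForm (i : Fin m) (Λ : MultiIndex n) (z v : Model n m) :
    FiniteOrderAt (fun z => contactForm i Λ z v) z :=
  (finiteOrderAt_const _ z).sub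
    (.sum fun _ _ => (finiteOrderAt_snd z _).mul (finiteOrderAt_const _ z))

theorem FiniteOrderFormAt.contact_wedge {φ : ModelForm n m p} {z : Model n m}
    (hφ : FiniteOrderFormAt φ z) (i : Fin m) (Λ : MultiIndex n) :
    FiniteOrderFormAt (_root_.wedgeOne (contactForm i Λ) φ) z := by
  refine FiniteOrderFormAt.wedgeOne (a := contactCovector i Λ) (S' := {(i, Λ)}) hφ
    (fun z v w e => ?_) (finiteOrderAt_contactForm i Λ z)
  have h1 : v.1 = w.1 := (Prod.ext_iff.1 e).1
  have h2 : v.2 (i, Λ) = w.2 (i, Λ) :=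
    congrFun (Prod.ext_iff.1 e).2 ⟨(i, Λ), Finset.mem_singleton_self _⟩
  change contactForm i Λ z v = contactForm i Λ z w
  simp only [contactForm, h1, h2]

/-- The pull-back of a form along a map. -/
def formPullback (T : Model n m → Model n m) (φ : ModelForm n m p) : ModelForm n m p :=
  fun z v => φ (T z) (fun j => mapDeriv T z (v j))

theorem FiniteOrderFormAt.pullback {φ : ModelForm n m p} {T : Model n m → Model n m}
    {z : Model n m} (hφ : FiniteOrderFormAt φ (T z)) (hT : ∀ᶠ z' in 𝓝 z, FiniteOrderMapAt T z') :
    FiniteOrderFormAt (formPullback T φ) z := by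
  obtain ⟨S, h⟩ := hφ.exists_seesOnly
  obtain ⟨S', h'⟩ := exists_mapDeriv_congr hT S
  have hT0 := hT.self_of_nhds
  refine .mk (S := S') ?_ fun v => hφ.apply_field (w := fun j z => mapDeriv T z (v j)) hT0
    fun j => hT0.mapDeriv_field (finiteOrderMapAt_const _ z)
  filter_upwards [hT0.continuousAt.eventually h, h', hT] with z' a b c
  let L : Model n m →ₗ[ℝ] Model n m :=
    { toFun := mapDeriv T z', map_add' := mapDeriv_add c, map_smul' := mapDeriv_smul T z' }
  exact ⟨a.1.comp_linear L, fun v w e => a.2 _ _ fun j => b _ _ (e j)⟩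

/-! ### The total derivatives of forms -/

theorem totalDeriv_apply (l : Fin n) (φ : ModelForm n m p) (z : Model n m)
    (v : Fin p → Model n m) : totalDeriv l φ z v =
      lineDeriv ℝ (fun z' => φ z' v) z (totalVec l z) + derivAction (shiftVec l) (φ z) v := rfl

theorem totalDeriv_congr_nhds {φ ψ : ModelForm n m p} {z : Model n m} (h : φ =ᶠ[𝓝 z] ψ)
    (l : Fin n) : totalDeriv l φ z = totalDeriv l ψ z := by
  funext v
  rw [totalDeriv_apply, totalDeriv_apply, h.self_of_nhds,
    lineDeriv_congr_nhds (f := fun z => φ z v) (g := fun z => ψ z v) (h.fun_comp fun a => a v)]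

theorem totalDeriv_congr {φ ψ : ModelForm n m p} {z : Model n m} (h : φ =ᶠ[𝓝 z] ψ)
    (l : Fin n) : totalDeriv l φ =ᶠ[𝓝 z] totalDeriv l ψ :=
  h.eventually_nhds.mono fun _ h' => totalDeriv_congr_nhds h' l

theorem totalDeriv_zero (l : Fin n) : totalDeriv l (0 : ModelForm n m p) = 0 := by
  funext z v
  simp [totalDeriv_apply, derivAction, lineDeriv_const_fun]

theorem FiniteOrderFormAt.totalDeriv {φ : ModelForm n m p} {z : Model n m}
    (hφ : FiniteOrderFormAt φ z) (l : Fin n) : FiniteOrderFormAt (totalDeriv l φ) z := by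
  classical
  obtain ⟨S, W, α, hW, hz, hα, e⟩ := id hφ
  obtain ⟨S', hS'⟩ : ∃ S' : Finset (Fin m × MultiIndex n), ∀ v w,
      restrictTo S' v = restrictTo S' w → restrictTo S (shiftVec l v) = restrictTo S (shiftVec l w) := by
    refine ⟨S.image fun a => (a.1, a.2.cons l), fun v w e => ?_⟩
    refine Prod.ext rfl (funext fun a => ?_)
    exact congrFun (congrArg Prod.snd e)
      ⟨(a.1.1, a.1.2.cons l), Finset.mem_image_of_mem _ a.2⟩
  refine .mk (S := S ∪ S') ?_ fun v => ?_
  · filter_upwards [(hW.preimage (continuous_restrictTo S)).mem_nhds hz, e.eventually_nhds]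
      with z' hz' e'
    have h1 : (fun v => lineDeriv ℝ (fun z => φ z v) z' (totalVec l z')) = fun v =>
        fderiv ℝ α (restrictTo S z') (restrictTo S (totalVec l z'))
          fun j => restrictTo S (v j) := by
      funext v
      have h2 : HasFDerivAt α (fderiv ℝ α (restrictTo S z')) (restrictTo S z') :=
        ((hα.contDiffAt (hW.mem_nhds hz')).differentiableAt (by simp)).hasFDerivAt
      have h3 : HasDerivAt (fun t : ℝ => α (restrictTo S (z' + t • totalVec l z')))
          (fderiv ℝ α (restrictTo S z') (restrictTo S (totalVec l z'))) 0 := by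
        have := HasFDerivAt.comp_hasDerivAt (0 : ℝ) (l := α)
          (f := fun t : ℝ => restrictTo S (z' + t • totalVec l z')) (by simpa using h2)
          ((hasCurveDeriv_line z' (totalVec l z') 0).restrictTo S)
        simpa [Function.comp_def] using this
      rw [lineDeriv_congr_nhds (g := fun z => α (restrictTo S z) fun j => restrictTo S (v j))
        (e'.mono fun z h => h v)]
      have := (h3.hasFDerivAt.continuousAlternatingMap_apply_const
        fun j => restrictTo S (v j)).hasDerivAt.deriv
      rw [lineDeriv, this]
      simp
    have hz'' : φ z' = fun v => α (restrictTo S z') fun j => restrictTo S (v j) :=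
      funext e'.self_of_nhds
    have h4 : IsAlternating (φ z') := hz'' ▸ isAlternating_restrictTo S _
    have h5 : SeesOnly S (φ z') := hz'' ▸ seesOnly_restrictTo S _
    have h6 : _root_.totalDeriv l φ z' =
        (fun v => lineDeriv ℝ (fun z => φ z v) z' (totalVec l z')) +
          derivAction (shiftLin l) (φ z') := rfl
    rw [h6, h1]
    refine ⟨(isAlternating_restrictTo S _).add (h4.derivAction _), fun v w ev => ?_⟩
    have e1 : ∀ j, restrictTo S (v j) = restrictTo S (w j) := fun j => by
      rw [← restrictRestrict_apply Finset.subset_union_left, ev, restrictRestrict_apply]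
    have e2 : ∀ j, restrictTo S' (v j) = restrictTo S' (w j) := fun j => by
      rw [← restrictRestrict_apply Finset.subset_union_right, ev, restrictRestrict_apply]
    simp only [Pi.add_apply, e1, derivAction]
    congr 1
    refine Finset.sum_congr rfl fun j _ => h5 _ _ fun i => ?_
    by_cases hi : i = j
    · subst hi
      simpa using! hS' _ _ (e2 i)
    · simpa [Function.update_of_ne hi] using e1 i
  · exact ((hφ.apply v).lineDeriv_field (finiteOrderMapAt_totalVec l z)).add
      (.sum fun j _ => hφ.apply _)

theorem totalDeriv_add {φ ψ : ModelForm n m p} {z : Model n m} (hφ : FiniteOrderFormAt φ z)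
    (hψ : FiniteOrderFormAt ψ z) (l : Fin n) :
    totalDeriv l (φ + ψ) z = totalDeriv l φ z + totalDeriv l ψ z := by
  funext v
  simp only [totalDeriv_apply, Pi.add_apply, derivAction,
    lineDeriv_add_fun (hφ.apply v) (hψ.apply v), Finset.sum_add_distrib]
  ring

/-- Leibniz rule for the product of a function and a form. -/
theorem totalDeriv_funSmul {f : Model n m → ℝ} {φ : ModelForm n m p} {z : Model n m}
    (hf : FiniteOrderAt f z) (hφ : FiniteOrderFormAt φ z) (l : Fin n) :
    totalDeriv l (funSmul f φ) z =
      lineDeriv ℝ f z (totalVec l z) • φ z + f z • totalDeriv l φ z := by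
  funext v
  have := lineDeriv_mul_fun hf (hφ.apply v) (totalVec l z)
  simp only [totalDeriv_apply, funSmul, Pi.smul_apply, smul_eq_mul, derivAction, Pi.add_apply,
    ← Finset.mul_sum, this]
  ring

theorem totalDeriv_const_smul {φ : ModelForm n m p} {z : Model n m}
    (hφ : FiniteOrderFormAt φ z) (c : ℝ) (l : Fin n) :
    totalDeriv l (c • φ) z = c • totalDeriv l φ z := by
  have := totalDeriv_funSmul (f := fun _ => c) (finiteOrderAt_const c z) hφ l
  rw [lineDeriv_const_fun, zero_smul, zero_add] at this
  exact this

theorem MultiIndex.cons_comm (Λ : MultiIndex n) (l l' : Fin n) :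
    (Λ.cons l).cons l' = (Λ.cons l').cons l := by
  simp only [MultiIndex.cons, add_assoc, add_comm (Pi.single l 1)]

theorem shiftVec_comm (l l' : Fin n) (v : Model n m) :
    shiftVec l (shiftVec l' v) = shiftVec l' (shiftVec l v) := by
  simp only [shiftVec, MultiIndex.cons_comm]

theorem shiftVec_totalVec_comm (l l' : Fin n) (z : Model n m) :
    shiftVec l (totalVec l' z) = shiftVec l' (totalVec l z) := by
  simp only [shiftVec, totalVec, MultiIndex.cons_comm]

theorem derivAction_comm (C C' : Model n m → Model n m) (h : ∀ v, C (C' v) = C' (C v))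
    (α : (Fin p → Model n m) → ℝ) :
    derivAction C (derivAction C' α) = derivAction C' (derivAction C α) := by
  funext v
  simp only [derivAction]
  rw [Finset.sum_comm]
  refine Finset.sum_congr rfl fun i _ => Finset.sum_congr rfl fun j _ => ?_
  by_cases hij : i = j
  · subst hij
    simp [h]
  · rw [Function.update_of_ne hij, Function.update_of_ne (Ne.symm hij), Function.update_comm hij]

/-- The total derivatives commute. -/
theorem totalDeriv_comm {φ : ModelForm n m p} {z : Model n m} (hφ : FiniteOrderFormAt φ z)
    (l l' : Fin n) : totalDeriv l (totalDeriv l' φ) z = totalDeriv l' (totalDeriv l φ) z := by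
  -- apart from the order of the second derivatives, the right-hand side is symmetric in `l`, `l'`
  have key : ∀ (l l' : Fin n) v, totalDeriv l (totalDeriv l' φ) z v =
      lineDeriv ℝ (fun z' => lineDeriv ℝ (fun z => φ z v) z' (totalVec l z)) z (totalVec l' z) +
        lineDeriv ℝ (fun z => φ z v) z (shiftVec l' (totalVec l z)) +
        (∑ j, lineDeriv ℝ (fun z => φ z (Function.update v j (shiftVec l' (v j)))) z
          (totalVec l z) +
        ∑ j, lineDeriv ℝ (fun z => φ z (Function.update v j (shiftVec l (v j)))) z
          (totalVec l' z)) +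
        derivAction (shiftVec l) (derivAction (shiftVec l') (φ z)) v := by
    intro l l' v
    have h1 : lineDeriv ℝ (fun z' => totalDeriv l' φ z' v) z (totalVec l z) =
        lineDeriv ℝ (fun z' => lineDeriv ℝ (fun z => φ z v) z' (totalVec l' z')) z (totalVec l z) +
          ∑ j, lineDeriv ℝ (fun z => φ z (Function.update v j (shiftVec l' (v j)))) z
            (totalVec l z) := by
      rw [← lineDeriv_sum_fun fun j _ => hφ.apply _, ← lineDeriv_add_fun
        ((hφ.apply v).lineDeriv_field (finiteOrderMapAt_totalVec l' z))
        (.sum fun j _ => hφ.apply _)]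
      rfl
    rw [totalDeriv_apply, h1,
      lineDeriv_lineDeriv_field (hφ.apply v) (finiteOrderMapAt_totalVec l' z), mapDeriv_totalVec]
    have h2 : derivAction (shiftVec l) (totalDeriv l' φ z) v =
        ∑ j, lineDeriv ℝ (fun z => φ z (Function.update v j (shiftVec l (v j)))) z
          (totalVec l' z) +
        derivAction (shiftVec l) (derivAction (shiftVec l') (φ z)) v := by
      simp only [derivAction, ← Finset.sum_add_distrib]
      rfl
    rw [h2]
    ring
  funext v
  rw [key l l', key l' l, shiftVec_totalVec_comm, derivAction_comm _ _ (shiftVec_comm l l')]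
  have h3 := lineDeriv_lineDeriv_field (hφ.apply v) (finiteOrderMapAt_const (totalVec l z) z)
    (totalVec l' z)
  rw [mapDeriv_const, lineDeriv_zero, add_zero] at h3
  rw [h3, add_comm (∑ j, _) (∑ j, _)]

/-- The total derivative and the contraction with a constant vector. -/
theorem totalDeriv_cons (l : Fin n) (φ : ModelForm n m (p + 1)) (u z : Model n m)
    (v : Fin p → Model n m) : totalDeriv l φ z (Fin.cons u v) =
      totalDeriv l (fun z w => φ z (Fin.cons u w)) z v + φ z (Fin.cons (shiftVec l u) v) := by
  rw [totalDeriv_apply, totalDeriv_apply, derivAction_cons]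
  ring

/-- Leibniz rule for the contact forms: `d_λ θ^i_Λ = θ^i_{λ+Λ}`. -/
theorem totalDeriv_contact_wedge {φ : ModelForm n m p} {z : Model n m}
    (hφ : FiniteOrderFormAt φ z) (i : Fin m) (Λ : MultiIndex n) (l : Fin n) :
    totalDeriv l (wedgeOne (contactForm i Λ) φ) z =
      wedgeOne (contactForm i (Λ.cons l)) φ z + wedgeOne (contactForm i Λ) (totalDeriv l φ) z := by
  have hθ : ∀ v, lineDeriv ℝ (fun z => contactForm i Λ z v) z (totalVec l z) +
      contactForm i Λ z (shiftVec l v) = contactForm i (Λ.cons l) z v := by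
    intro v
    have h1 : HasDerivAt (fun t : ℝ => contactForm i Λ (z + t • totalVec l z) v)
        (0 - ∑ l', (totalVec l z).2 (i, Λ.cons l') * v.1 l') 0 := by
      refine (hasDerivAt_const _ _).sub (HasDerivAt.fun_sum fun l' _ => ?_)
      exact ((hasCurveDeriv_line z (totalVec l z) 0).2 _).mul_const _
    rw [lineDeriv, h1.deriv]
    simp only [contactForm, totalVec, shiftVec]
    simp only [Pi.zero_apply, mul_zero, Finset.sum_const_zero]
    rw [zero_sub, sub_zero, neg_add_eq_sub]
    congr 1
    exact Finset.sum_congr rfl fun l' _ => by rw [MultiIndex.cons_comm]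
  funext v
  rw [totalDeriv_apply, wedgeOne_eq, derivAction_wedgeCovector, Pi.add_apply, Pi.add_apply]
  have h2 : lineDeriv ℝ (fun z' => wedgeOne (contactForm i Λ) φ z' v) z (totalVec l z) =
      wedgeCovector (fun v => lineDeriv ℝ (fun z => contactForm i Λ z v) z (totalVec l z)) (φ z) v +
      wedgeCovector (contactForm i Λ z)
        (fun v => lineDeriv ℝ (fun z => φ z v) z (totalVec l z)) v := by
    simp only [wedgeOne, wedgeCovector]
    rw [lineDeriv_sum_fun fun j _ => ((finiteOrderAt_const _ z).mul
      (finiteOrderAt_contactForm i Λ z _)).mul (hφ.apply _), ← Finset.sum_add_distrib]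
    refine Finset.sum_congr rfl fun j _ => ?_
    rw [lineDeriv_mul_fun ((finiteOrderAt_const _ z).mul
      (finiteOrderAt_contactForm i Λ z _)) (hφ.apply _), lineDeriv_mul_fun
      (finiteOrderAt_const _ z) (finiteOrderAt_contactForm i Λ z _), lineDeriv_const_fun]
    ring
  rw [h2, wedgeOne_eq, wedgeOne_eq]
  simp only [wedgeCovector, ← hθ, totalDeriv_apply]
  simp only [← Finset.sum_add_distrib]
  exact Finset.sum_congr rfl fun j _ => by ring

end FiniteOrderForms

/-! ### Iterated operators -/

section IterOp

variable {n : ℕ}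

theorem iterOp_eq_foldr {A : Type*} (D : Fin n → A → A) (Λ : MultiIndex n) (a : A) :
    iterOp D Λ a = (List.finRange n).foldr (fun l b => (D l)^[Λ l] b) a := rfl

/-- A relation preserved by the operators is preserved by their iterates. -/
theorem iterOp_rel {A B : Type*} {D : Fin n → A → A} {D' : Fin n → B → B} (R : A → B → Prop)
    (h : ∀ l a b, R a b → R (D l a) (D' l b)) (Λ : MultiIndex n) {a : A} {b : B} (hab : R a b) :
    R (iterOp D Λ a) (iterOp D' Λ b) := by
  have hit : ∀ l (k : ℕ) a b, R a b → R ((D l)^[k] a) ((D' l)^[k] b) := by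
    intro l k
    induction k with
    | zero => exact fun a b h => h
    | succ k ih => exact fun a b hab => ih _ _ (h l a b hab)
  rw [iterOp_eq_foldr, iterOp_eq_foldr]
  generalize List.finRange n = L
  induction L with
  | nil => exact hab
  | cons l L ih => exact hit _ _ _ _ ih

theorem iterOp_zero {A : Type*} (D : Fin n → A → A) (a : A) : iterOp D 0 a = a := by
  rw [iterOp_eq_foldr]
  generalize List.finRange n = L
  induction L with
  | nil => rfl
  | cons l L ih => exact ih

/-- If the operators commute up to the relation `r` on the elements with the property `P`, then
`D_{λ+Λ} = D_λ D_Λ = D_Λ D_λ` up to `r` on these elements. -/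
theorem iterOp_cons {A : Type*} {D : Fin n → A → A} {r : A → A → Prop} (hr : Equivalence r)
    {P : A → Prop} (hP : ∀ l a, P a → P (D l a))
    (hD : ∀ l a b, P a → P b → r a b → r (D l a) (D l b))
    (hcomm : ∀ l l' a, P a → r (D l (D l' a)) (D l' (D l a))) (Λ : MultiIndex n) (l : Fin n)
    {a : A} (ha : P a) : r (iterOp D (Λ.cons l) a) (D l (iterOp D Λ a)) ∧
      r (iterOp D Λ (D l a)) (D l (iterOp D Λ a)) := by
  have hPit : ∀ l (k : ℕ) a, P a → P ((D l)^[k] a) := by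
    intro l k
    induction k with
    | zero => exact fun a h => h
    | succ k ih => exact fun a h => ih _ (hP l a h)
  have hrit : ∀ l (k : ℕ) a b, P a → P b → r a b → r ((D l)^[k] a) ((D l)^[k] b) := by
    intro l k
    induction k with
    | zero => exact fun a b _ _ h => h
    | succ k ih => exact fun a b ha hb h => ih _ _ (hP l a ha) (hP l b hb) (hD l a b ha hb h)
  have hcit : ∀ l' (k : ℕ) a, P a → r ((D l')^[k] (D l a)) (D l ((D l')^[k] a)) := by
    intro l' k
    induction k with
    | zero => exact fun a _ => hr.refl _
    | succ k ih =>
      intro a ha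
      exact hr.trans (hrit l' k _ _ (hP _ _ (hP _ _ ha)) (hP _ _ (hP _ _ ha)) (hcomm l' l a ha))
        (ih _ (hP _ _ ha))
  have hPf : ∀ (L : List (Fin n)) (Λ : MultiIndex n) a, P a →
      P (L.foldr (fun l b => (D l)^[Λ l] b) a) := by
    intro L Λ a ha
    induction L with
    | nil => exact ha
    | cons l L ih => exact hPit _ _ _ ih
  constructor
  · rw [iterOp_eq_foldr, iterOp_eq_foldr]
    -- the lists without `l` do not see the difference of `λ + Λ` and `Λ`
    have h0 : ∀ L : List (Fin n), l ∉ L → L.foldr (fun l' b => (D l')^[Λ.cons l l'] b) a =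
        L.foldr (fun l b => (D l)^[Λ l] b) a := by
      intro L hL
      induction L with
      | nil => rfl
      | cons l' L ih =>
        have hne : l' ≠ l := fun e => hL (e ▸ List.mem_cons_self)
        rw [List.foldr_cons, List.foldr_cons, ih fun h => hL (List.mem_cons_of_mem _ h)]
        simp only [MultiIndex.cons, Pi.add_apply, Pi.single_eq_of_ne hne, add_zero]
    have h1 : ∀ L : List (Fin n), L.Nodup → l ∈ L →
        r (L.foldr (fun l' b => (D l')^[Λ.cons l l'] b) a)
          (D l (L.foldr (fun l b => (D l)^[Λ l] b) a)) := by
      intro L hL hl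
      induction L with
      | nil => simp at hl
      | cons l' L ih =>
        obtain ⟨hn, hL'⟩ := List.nodup_cons.1 hL
        by_cases e : l' = l
        · subst e
          rw [List.foldr_cons, List.foldr_cons, h0 L hn]
          simp only [MultiIndex.cons, Pi.add_apply, Pi.single_eq_same, Function.iterate_succ']
          exact hr.refl _
        · have hl' : l ∈ L := (List.mem_cons.1 hl).resolve_left fun h => e h.symm
          simp only [List.foldr_cons, MultiIndex.cons, Pi.add_apply, Pi.single_eq_of_ne e, add_zero]
          exact hr.trans (hrit _ _ _ _ (hPf L (Λ.cons l) a ha) (hP _ _ (hPf L Λ a ha)) (ih hL' hl'))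
            (hcit _ _ _ (hPf L Λ a ha))
    exact h1 _ (List.nodup_finRange n) (List.mem_finRange l)
  · rw [iterOp_eq_foldr, iterOp_eq_foldr]
    generalize List.finRange n = L
    induction L with
    | nil => exact hr.refl _
    | cons l' L ih =>
      exact hr.trans (hrit _ _ _ _ (hPf L Λ _ (hP _ _ ha)) (hP _ _ (hPf L Λ a ha)) ih)
        (hcit _ _ _ (hPf L Λ a ha))

theorem MultiIndex.len_cons (Λ : MultiIndex n) (l : Fin n) : (Λ.cons l).len = Λ.len + 1 := by
  simp [MultiIndex.len, MultiIndex.cons, Finset.sum_add_distrib]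

theorem MultiIndex.len_zero : (0 : MultiIndex n).len = 0 := by simp [MultiIndex.len]

theorem MultiIndex.sub_cons {Λ : MultiIndex n} {l : Fin n} (h : Λ l ≠ 0) :
    (Λ - Pi.single l 1).cons l = Λ := by
  funext l'
  by_cases e : l' = l
  · subst e
    simp [MultiIndex.cons, Nat.sub_add_cancel (Nat.one_le_iff_ne_zero.2 h)]
  · simp [MultiIndex.cons, e]

theorem MultiIndex.cons_sub (Λ : MultiIndex n) (l : Fin n) : Λ.cons l - Pi.single l 1 = Λ := by
  funext l'
  simp [MultiIndex.cons]

theorem MultiIndex.cons_injective (l : Fin n) :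
    Function.Injective fun Λ : MultiIndex n => Λ.cons l := fun Λ Λ' h => by
  rw [← Λ.cons_sub l, ← Λ'.cons_sub l]
  exact congrArg (· - Pi.single l 1) h

theorem MultiIndex.cons_apply_ne_zero (Λ : MultiIndex n) (l : Fin n) : Λ.cons l l ≠ 0 := by
  simp [MultiIndex.cons]

theorem MultiIndex.induction {P : MultiIndex n → Prop} (h0 : P 0)
    (h : ∀ Λ l, P Λ → P (Λ.cons l)) (Λ : MultiIndex n) : P Λ := by
  obtain ⟨k, hk⟩ : ∃ k, Λ.len = k := ⟨_, rfl⟩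
  induction k generalizing Λ with
  | zero =>
    have : Λ = 0 := by
      funext l
      exact Finset.sum_eq_zero_iff.1 hk l (Finset.mem_univ l)
    exact this ▸ h0
  | succ k ih =>
    obtain ⟨l, hl⟩ : ∃ l, Λ l ≠ 0 := by
      by_contra hcon
      push Not at hcon
      simp [MultiIndex.len, hcon] at hk
    rw [← MultiIndex.sub_cons hl] at hk ⊢
    rw [MultiIndex.len_cons] at hk
    exact h _ _ (ih _ (by omega))

end IterOp

section EulerSums

variable {n m p : ℕ}

theorem iterOp_totalDeriv_congr {φ ψ : ModelForm n m p} {z : Model n m} (h : φ =ᶠ[𝓝 z] ψ)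
    (Λ : MultiIndex n) : iterOp totalDeriv Λ φ =ᶠ[𝓝 z] iterOp totalDeriv Λ ψ :=
  iterOp_rel (fun φ ψ : ModelForm n m p => φ =ᶠ[𝓝 z] ψ)
    (fun l _ _ h => totalDeriv_congr h l) Λ h

theorem FiniteOrderFormAt.iterOp {φ : ModelForm n m p} {z : Model n m}
    (hφ : FiniteOrderFormAt φ z) (Λ : MultiIndex n) :
    FiniteOrderFormAt (iterOp _root_.totalDeriv Λ φ) z :=
  iterOp_rel (D' := fun _ (a : Unit) => a) (b := ())
    (fun (φ : ModelForm n m p) _ => FiniteOrderFormAt φ z) (fun l _ _ h => h.totalDeriv l) Λ hφ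

theorem iterOp_totalDeriv_zero (Λ : MultiIndex n) :
    iterOp totalDeriv Λ (0 : ModelForm n m p) = 0 :=
  iterOp_rel (D' := fun _ (a : Unit) => a) (b := ()) (fun (φ : ModelForm n m p) _ => φ = 0)
    (fun l φ _ h => by subst h; exact totalDeriv_zero l) Λ rfl

theorem iterOp_totalDeriv_add {φ ψ : ModelForm n m p} {z : Model n m}
    (hφ : FiniteOrderFormAt φ z) (hψ : FiniteOrderFormAt ψ z) (Λ : MultiIndex n) :
    iterOp totalDeriv Λ (φ + ψ) =ᶠ[𝓝 z] iterOp totalDeriv Λ φ + iterOp totalDeriv Λ ψ := by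
  have := iterOp_rel (D := totalDeriv) (D' := fun l (q : ModelForm n m p × ModelForm n m p) =>
    (totalDeriv l q.1, totalDeriv l q.2)) (fun χ q => FiniteOrderFormAt q.1 z ∧
      FiniteOrderFormAt q.2 z ∧ χ =ᶠ[𝓝 z] q.1 + q.2) (fun l χ q h => ⟨h.1.totalDeriv l,
        h.2.1.totalDeriv l, (totalDeriv_congr h.2.2 l).trans
          ((h.1.eventually.and h.2.1.eventually).mono fun z' h' => totalDeriv_add h'.1 h'.2 l)⟩)
    Λ (a := φ + ψ) (b := (φ, ψ)) ⟨hφ, hψ, EventuallyEq.rfl⟩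
  have e := iterOp_rel (D := fun l (q : ModelForm n m p × ModelForm n m p) =>
    (totalDeriv l q.1, totalDeriv l q.2)) (D' := totalDeriv)
    (fun q χ => q.1 = χ) (fun l q χ h => by subst h; rfl) Λ (a := (φ, ψ)) (b := φ) rfl
  have e' := iterOp_rel (D := fun l (q : ModelForm n m p × ModelForm n m p) =>
    (totalDeriv l q.1, totalDeriv l q.2)) (D' := totalDeriv)
    (fun q χ => q.2 = χ) (fun l q χ h => by subst h; rfl) Λ (a := (φ, ψ)) (b := ψ) rfl
  rw [← e, ← e']
  exact this.2.2

theorem iterOp_totalDeriv_const_smul {φ : ModelForm n m p} {z : Model n m}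
    (hφ : FiniteOrderFormAt φ z) (c : ℝ) (Λ : MultiIndex n) :
    iterOp totalDeriv Λ (c • φ) =ᶠ[𝓝 z] c • iterOp totalDeriv Λ φ :=
  (iterOp_rel (D := totalDeriv) (D' := totalDeriv) (fun χ φ : ModelForm n m p =>
    FiniteOrderFormAt φ z ∧ χ =ᶠ[𝓝 z] c • φ) (fun l _ _ h => ⟨h.1.totalDeriv l,
      (totalDeriv_congr h.2 l).trans (h.1.eventually.mono fun _ h' =>
        totalDeriv_const_smul h' c l)⟩) Λ ⟨hφ, EventuallyEq.rfl⟩).2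

theorem iterOp_totalDeriv_cons {φ : ModelForm n m p} {z : Model n m}
    (hφ : FiniteOrderFormAt φ z) (Λ : MultiIndex n) (l : Fin n) :
    iterOp totalDeriv (Λ.cons l) φ =ᶠ[𝓝 z] totalDeriv l (iterOp totalDeriv Λ φ) ∧
      iterOp totalDeriv Λ (totalDeriv l φ) =ᶠ[𝓝 z] totalDeriv l (iterOp totalDeriv Λ φ) :=
  iterOp_cons (r := fun φ ψ : ModelForm n m p => φ =ᶠ[𝓝 z] ψ)
    ⟨fun _ => EventuallyEq.rfl, EventuallyEq.symm, EventuallyEq.trans⟩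
    (P := fun φ => FiniteOrderFormAt φ z) (fun l _ h => h.totalDeriv l)
    (fun l _ _ _ _ h => totalDeriv_congr h l)
    (fun l l' _ h => h.eventually.mono fun _ h' => totalDeriv_comm h' l l') Λ l hφ

theorem iterOp_totalDeriv_cons' {φ : ModelForm n m p} {z : Model n m}
    (hφ : FiniteOrderFormAt φ z) (Λ : MultiIndex n) (l : Fin n) :
    iterOp totalDeriv (Λ.cons l) φ =ᶠ[𝓝 z] iterOp totalDeriv Λ (totalDeriv l φ) :=
  (iterOp_totalDeriv_cons hφ Λ l).1.trans (iterOp_totalDeriv_cons hφ Λ l).2.symm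

/-! ### Euler sums -/

/-- The alternating sum `∑ (-1)^|Λ| d_Λ b_Λ`. -/
def eulerSum (b : MultiIndex n → ModelForm n m p) : ModelForm n m p := fun z v =>
  ∑ᶠ Λ : MultiIndex n, (-1) ^ Λ.len * iterOp totalDeriv Λ (b Λ) z v

/-- A family of forms of finite order, only finitely many of which are nonzero near `z`. -/
structure IsFinFamilyAt (b : MultiIndex n → ModelForm n m p) (z : Model n m) : Prop where
  fin : ∃ L : Finset (MultiIndex n), ∀ᶠ z' in 𝓝 z, ∀ Λ ∉ L, b Λ z' = 0
  form : ∀ Λ, FiniteOrderFormAt (b Λ) z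

theorem eulerSum_congr {b b' : MultiIndex n → ModelForm n m p} {z : Model n m}
    (h : ∀ᶠ z' in 𝓝 z, ∀ Λ, b Λ z' = b' Λ z') : eulerSum b =ᶠ[𝓝 z] eulerSum b' := by
  refine h.eventually_nhds.mono fun z' h' => funext fun v => finsum_congr fun Λ => ?_
  rw [(iterOp_totalDeriv_congr (h'.mono fun _ e => e Λ) Λ).self_of_nhds]

theorem eulerSum_eq_sum {b : MultiIndex n → ModelForm n m p} {z : Model n m}
    {L : Finset (MultiIndex n)} (hL : ∀ᶠ z' in 𝓝 z, ∀ Λ ∉ L, b Λ z' = 0) :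
    eulerSum b =ᶠ[𝓝 z] ∑ Λ ∈ L, (-1 : ℝ) ^ Λ.len • iterOp totalDeriv Λ (b Λ) := by
  refine hL.eventually_nhds.mono fun z' h' => funext fun v => ?_
  rw [eulerSum, finsum_eq_sum_of_support_subset (s := L)]
  · simp [Finset.sum_apply]
  · intro Λ hΛ
    by_contra hcon
    refine hΛ ?_
    have e : b Λ =ᶠ[𝓝 z'] 0 := h'.mono fun _ e => e Λ hcon
    have e' := (iterOp_totalDeriv_congr e Λ).self_of_nhds
    rw [iterOp_totalDeriv_zero] at e'
    beta_reduce
    rw [e']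
    simp

theorem EventuallyEq.smul_form {φ ψ : ModelForm n m p} {z : Model n m} (h : φ =ᶠ[𝓝 z] ψ) (c : ℝ) :
    c • φ =ᶠ[𝓝 z] c • ψ := h.mono fun z' e => by rw [Pi.smul_apply, Pi.smul_apply, e]

theorem IsFinFamilyAt.eulerSum {b : MultiIndex n → ModelForm n m p} {z : Model n m}
    (hb : IsFinFamilyAt b z) : FiniteOrderFormAt (eulerSum b) z := by
  obtain ⟨L, hL⟩ := hb.fin
  exact (FiniteOrderFormAt.sum fun Λ _ => ((hb.form Λ).iterOp Λ).const_smul _).congr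
    (eulerSum_eq_sum hL)

theorem IsFinFamilyAt.add {b b' : MultiIndex n → ModelForm n m p} {z : Model n m}
    (hb : IsFinFamilyAt b z) (hb' : IsFinFamilyAt b' z) :
    IsFinFamilyAt (fun Λ => b Λ + b' Λ) z := by
  classical
  obtain ⟨L, hL⟩ := hb.fin
  obtain ⟨L', hL'⟩ := hb'.fin
  refine ⟨⟨L ∪ L', (hL.and hL').mono fun z' h Λ hΛ => ?_⟩, fun Λ => (hb.form Λ).add (hb'.form Λ)⟩
  rw [Pi.add_apply, h.1 Λ fun h => hΛ (Finset.mem_union_left _ h),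
    h.2 Λ fun h => hΛ (Finset.mem_union_right _ h), add_zero]

theorem eulerSum_add {b b' : MultiIndex n → ModelForm n m p} {z : Model n m}
    (hb : IsFinFamilyAt b z) (hb' : IsFinFamilyAt b' z) :
    eulerSum (fun Λ => b Λ + b' Λ) =ᶠ[𝓝 z] eulerSum b + eulerSum b' := by
  classical
  obtain ⟨L, hL⟩ := hb.fin
  obtain ⟨L', hL'⟩ := hb'.fin
  have h1 : ∀ᶠ z' in 𝓝 z, ∀ Λ ∉ L ∪ L', b Λ z' = 0 :=
    hL.mono fun z' h Λ hΛ => h Λ fun h => hΛ (Finset.mem_union_left _ h)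
  have h2 : ∀ᶠ z' in 𝓝 z, ∀ Λ ∉ L ∪ L', b' Λ z' = 0 :=
    hL'.mono fun z' h Λ hΛ => h Λ fun h => hΛ (Finset.mem_union_right _ h)
  have h3 : ∀ᶠ z' in 𝓝 z, ∀ Λ ∉ L ∪ L', (b Λ + b' Λ) z' = 0 := (h1.and h2).mono
    fun z' h Λ hΛ => by rw [Pi.add_apply, h.1 Λ hΛ, h.2 Λ hΛ, add_zero]
  refine (eulerSum_eq_sum h3).trans (EventuallyEq.trans ?_
    ((eulerSum_eq_sum h1).add (eulerSum_eq_sum h2)).symm)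
  rw [← Finset.sum_add_distrib]
  refine eventuallyEq_sum fun Λ _ => ?_
  rw [← smul_add]
  exact EventuallyEq.smul_form (iterOp_totalDeriv_add (hb.form Λ) (hb'.form Λ) Λ) _

theorem IsFinFamilyAt.const_smul {b : MultiIndex n → ModelForm n m p} {z : Model n m}
    (hb : IsFinFamilyAt b z) (c : ℝ) : IsFinFamilyAt (fun Λ => c • b Λ) z := by
  obtain ⟨L, hL⟩ := hb.fin
  refine ⟨⟨L, hL.mono fun z' h Λ hΛ => ?_⟩, fun Λ => (hb.form Λ).const_smul c⟩
  rw [Pi.smul_apply, h Λ hΛ, smul_zero]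

theorem eulerSum_const_smul {b : MultiIndex n → ModelForm n m p} {z : Model n m}
    (hb : IsFinFamilyAt b z) (c : ℝ) : eulerSum (fun Λ => c • b Λ) =ᶠ[𝓝 z] c • eulerSum b := by
  obtain ⟨L, hL⟩ := hb.fin
  have h1 : ∀ᶠ z' in 𝓝 z, ∀ Λ ∉ L, (c • b Λ) z' = 0 :=
    hL.mono fun z' h Λ hΛ => by rw [Pi.smul_apply, h Λ hΛ, smul_zero]
  refine (eulerSum_eq_sum h1).trans (EventuallyEq.trans ?_
    (EventuallyEq.smul_form (eulerSum_eq_sum hL) c).symm)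
  rw [Finset.smul_sum]
  refine eventuallyEq_sum fun Λ _ => ?_
  rw [smul_comm]
  exact EventuallyEq.smul_form (iterOp_totalDeriv_const_smul (hb.form Λ) c Λ) _

theorem eulerSum_zero : eulerSum (fun _ => (0 : ModelForm n m p)) = 0 := by
  funext z v
  simp [eulerSum, iterOp_totalDeriv_zero]

theorem IsFinFamilyAt.sum {κ : Type*} {s : Finset κ} {b : κ → MultiIndex n → ModelForm n m p}
    {z : Model n m} (hb : ∀ a ∈ s, IsFinFamilyAt (b a) z) :
    IsFinFamilyAt (fun Λ => ∑ a ∈ s, b a Λ) z := by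
  classical
  induction s using Finset.induction_on with
  | empty => exact ⟨⟨∅, .of_forall fun _ _ _ => rfl⟩, fun _ => finiteOrderFormAt_zero z⟩
  | insert a s ha ih =>
    simp only [Finset.sum_insert ha]
    exact (hb a (Finset.mem_insert_self a s)).add
      (ih fun b hb' => hb b (Finset.mem_insert_of_mem hb'))

theorem eulerSum_sum {κ : Type*} {s : Finset κ} {b : κ → MultiIndex n → ModelForm n m p}
    {z : Model n m} (hb : ∀ a ∈ s, IsFinFamilyAt (b a) z) :
    eulerSum (fun Λ => ∑ a ∈ s, b a Λ) =ᶠ[𝓝 z] ∑ a ∈ s, eulerSum (b a) := by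
  classical
  induction s using Finset.induction_on with
  | empty => simp only [Finset.sum_empty, eulerSum_zero]; rfl
  | insert a s ha ih =>
    simp only [Finset.sum_insert ha]
    have hb' := fun c hc => hb c (Finset.mem_insert_of_mem (a := c) (b := a) (s := s) hc)
    exact (eulerSum_add (hb a (Finset.mem_insert_self a s)) (.sum hb')).trans
      (EventuallyEq.rfl.add (ih hb'))

/-- The family `b` with its indices raised by `λ`. -/
def shiftFamily (l : Fin n) (b : MultiIndex n → ModelForm n m p) :
    MultiIndex n → ModelForm n m p := fun Λ => if Λ l = 0 then 0 else b (Λ - Pi.single l 1)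

theorem IsFinFamilyAt.totalDeriv {b : MultiIndex n → ModelForm n m p} {z : Model n m}
    (hb : IsFinFamilyAt b z) (l : Fin n) : IsFinFamilyAt (fun Λ => totalDeriv l (b Λ)) z := by
  obtain ⟨L, hL⟩ := hb.fin
  refine ⟨⟨L, hL.eventually_nhds.mono fun z' h Λ hΛ => ?_⟩, fun Λ => (hb.form Λ).totalDeriv l⟩
  rw [totalDeriv_congr_nhds (ψ := 0) (h.mono fun _ e => e Λ hΛ), totalDeriv_zero]; rfl

theorem shiftFamily_eq_zero {b : MultiIndex n → ModelForm n m p} {z : Model n m}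
    {L : Finset (MultiIndex n)} (hL : ∀ᶠ z' in 𝓝 z, ∀ Λ ∉ L, b Λ z' = 0) (l : Fin n) :
    ∀ᶠ z' in 𝓝 z, ∀ Λ ∉ L.map ⟨_, MultiIndex.cons_injective l⟩, shiftFamily l b Λ z' = 0 := by
  refine hL.mono fun z' h Λ hΛ => ?_
  unfold shiftFamily
  split_ifs with h0
  · rfl
  · refine h _ fun hmem => hΛ (Finset.mem_map.2 ⟨_, hmem, MultiIndex.sub_cons h0⟩)

theorem IsFinFamilyAt.shiftFamily {b : MultiIndex n → ModelForm n m p} {z : Model n m}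
    (hb : IsFinFamilyAt b z) (l : Fin n) : IsFinFamilyAt (shiftFamily l b) z := by
  obtain ⟨L, hL⟩ := hb.fin
  refine ⟨⟨_, shiftFamily_eq_zero hL l⟩, fun Λ => ?_⟩
  unfold _root_.shiftFamily
  split_ifs
  · exact finiteOrderFormAt_zero z
  · exact hb.form _

/-- Integration by parts for Euler sums: the terms `d_Λ d_λ b_Λ` and `d_{λ+Λ} b_Λ` have opposite
signs. -/
theorem eulerSum_totalDeriv_add_shiftFamily {b : MultiIndex n → ModelForm n m p} {z : Model n m}
    (hb : IsFinFamilyAt b z) (l : Fin n) :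
    eulerSum (fun Λ => totalDeriv l (b Λ) + shiftFamily l b Λ) =ᶠ[𝓝 z] 0 := by
  obtain ⟨L, hL⟩ := hb.fin
  have h1 : ∀ᶠ z' in 𝓝 z, ∀ Λ ∉ L, totalDeriv l (b Λ) z' = 0 :=
    hL.eventually_nhds.mono fun z' h Λ hΛ => by
      rw [totalDeriv_congr_nhds (ψ := 0) (h.mono fun _ e => e Λ hΛ), totalDeriv_zero]; rfl
  refine (eulerSum_add (hb.totalDeriv l) (hb.shiftFamily l)).trans
    (((eulerSum_eq_sum h1).add (eulerSum_eq_sum (shiftFamily_eq_zero hL l))).trans ?_)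
  rw [Finset.sum_map, ← Finset.sum_add_distrib]
  refine (eventuallyEq_sum (g := fun _ => 0) fun Λ _ => ?_).trans (by simp)
  have e : shiftFamily l b (Λ.cons l) = b Λ := by
    rw [shiftFamily, if_neg (Λ.cons_apply_ne_zero l), MultiIndex.cons_sub]
  simp only [Function.Embedding.coeFn_mk, e, MultiIndex.len_cons, pow_succ, mul_neg_one, neg_smul]
  refine (iterOp_totalDeriv_cons' (hb.form Λ) Λ l).mono fun z' h => ?_
  simp [h]

/-! ### The interior Euler operator -/

/-- The form `∑ (-1)^|Λ| d_Λ (∂_i^Λ ⌋ φ)`. -/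
def eulerOp (i : Fin m) (φ : ModelForm n m (p + 1)) : ModelForm n m p :=
  eulerSum fun Λ => interiorDy i Λ φ

theorem interiorDy_eq (i : Fin m) (Λ : MultiIndex n) (φ : ModelForm n m (p + 1))
    (z : Model n m) : interiorDy i Λ φ z = fun v => φ z (Fin.cons (fibreVec (i, Λ)) v) :=
  funext fun v => interiorDy_apply i Λ φ z v

theorem FiniteOrderFormAt.exists_interiorDy_eq_zero {φ : ModelForm n m (p + 1)} {z : Model n m}
    (hφ : FiniteOrderFormAt φ z) : ∃ S : Finset (Fin m × MultiIndex n),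
      ∀ᶠ z' in 𝓝 z, IsAlternating (φ z') ∧ SeesOnly S (φ z') ∧
        ∀ a ∉ S, _root_.interiorDy a.1 a.2 φ z' = 0 := by
  obtain ⟨S, hS⟩ := hφ.exists_seesOnly
  refine ⟨S, hS.mono fun z' h => ⟨h.1, h.2, fun a ha => ?_⟩⟩
  rw [interiorDy_eq]
  exact funext fun v => h.2.cons_fibreVec_eq_zero h.1 ha v

theorem FiniteOrderFormAt.isFinFamilyAt_interiorDy {φ : ModelForm n m (p + 1)} {z : Model n m}
    (hφ : FiniteOrderFormAt φ z) (i : Fin m) :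
    IsFinFamilyAt (fun Λ => _root_.interiorDy i Λ φ) z := by
  classical
  obtain ⟨S, hS⟩ := hφ.exists_interiorDy_eq_zero
  exact ⟨⟨S.image Prod.snd, hS.mono fun z' h Λ hΛ =>
    h.2.2 (i, Λ) fun hmem => hΛ (Finset.mem_image_of_mem Prod.snd hmem)⟩,
    fun Λ => hφ.interiorDy i Λ⟩

theorem FiniteOrderFormAt.eulerOp {φ : ModelForm n m (p + 1)} {z : Model n m}
    (hφ : FiniteOrderFormAt φ z) (i : Fin m) : FiniteOrderFormAt (eulerOp i φ) z :=
  (hφ.isFinFamilyAt_interiorDy i).eulerSum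

theorem eulerOp_congr {φ ψ : ModelForm n m (p + 1)} {z : Model n m} (h : φ =ᶠ[𝓝 z] ψ)
    (i : Fin m) : eulerOp i φ =ᶠ[𝓝 z] eulerOp i ψ :=
  eulerSum_congr (h.mono fun z' e Λ => by rw [interiorDy_eq, interiorDy_eq, e])

theorem eulerOp_add {φ ψ : ModelForm n m (p + 1)} {z : Model n m}
    (hφ : FiniteOrderFormAt φ z) (hψ : FiniteOrderFormAt ψ z) (i : Fin m) :
    eulerOp i (φ + ψ) =ᶠ[𝓝 z] eulerOp i φ + eulerOp i ψ :=
  eulerSum_add (hφ.isFinFamilyAt_interiorDy i) (hψ.isFinFamilyAt_interiorDy i)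

theorem eulerOp_const_smul {φ : ModelForm n m (p + 1)} {z : Model n m}
    (hφ : FiniteOrderFormAt φ z) (c : ℝ) (i : Fin m) :
    eulerOp i (c • φ) =ᶠ[𝓝 z] c • eulerOp i φ :=
  eulerSum_const_smul (hφ.isFinFamilyAt_interiorDy i) c

theorem eulerOp_zero (i : Fin m) : eulerOp i (0 : ModelForm n m (p + 1)) = 0 := eulerSum_zero

theorem eulerOp_sum {κ : Type*} {s : Finset κ} {φ : κ → ModelForm n m (p + 1)} {z : Model n m}
    (h : ∀ a ∈ s, FiniteOrderFormAt (φ a) z) (i : Fin m) :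
    eulerOp i (∑ a ∈ s, φ a) =ᶠ[𝓝 z] ∑ a ∈ s, eulerOp i (φ a) := by
  classical
  induction s using Finset.induction_on with
  | empty => simp only [Finset.sum_empty, eulerOp_zero]; rfl
  | insert a s ha ih =>
    simp only [Finset.sum_insert ha]
    have h' := fun c hc => h c (Finset.mem_insert_of_mem (a := c) (b := a) (s := s) hc)
    exact (eulerOp_add (h a (Finset.mem_insert_self a s)) (.sum h') i).trans
      (EventuallyEq.rfl.add (ih h'))

theorem shiftVec_fibreVec (l : Fin n) (i : Fin m) (Λ : MultiIndex n) :
    shiftVec l (fibreVec (i, Λ) : Model n m) =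
      if Λ l = 0 then 0 else fibreVec (i, Λ - Pi.single l 1) := by
  refine Prod.ext ?_ (funext fun ⟨j, M⟩ => ?_)
  · split_ifs <;> rfl
  · have h1 : (shiftVec l (fibreVec (i, Λ) : Model n m)).2 (j, M) =
        if j = i ∧ M.cons l = Λ then 1 else 0 := by
      simp [shiftVec, fibreVec, Pi.single_apply, Prod.ext_iff]
    rw [h1]
    by_cases h0 : Λ l = 0
    · have : M.cons l ≠ Λ := fun e => M.cons_apply_ne_zero l (e ▸ h0)
      simp [h0, this]
    · have : M.cons l = Λ ↔ M = Λ - Pi.single l 1 :=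
        ⟨fun e => by rw [← e, MultiIndex.cons_sub], fun e => by rw [e, MultiIndex.sub_cons h0]⟩
      simp [h0, this, fibreVec, Pi.single_apply, Prod.ext_iff]

/-- The interior Euler operator annihilates total derivatives. -/
theorem eulerOp_totalDeriv {φ : ModelForm n m (p + 1)} {z : Model n m}
    (hφ : FiniteOrderFormAt φ z) (i : Fin m) (l : Fin n) :
    eulerOp i (totalDeriv l φ) =ᶠ[𝓝 z] 0 := by
  refine EventuallyEq.trans (eulerSum_congr ?_)
    (eulerSum_totalDeriv_add_shiftFamily (hφ.isFinFamilyAt_interiorDy i) l)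
  refine hφ.eventually.mono fun z' h Λ => funext fun v => ?_
  obtain ⟨a, ha⟩ := h.isAlternating
  rw [interiorDy_apply, totalDeriv_cons, shiftVec_fibreVec, Pi.add_apply, Pi.add_apply]
  congr 1
  unfold shiftFamily
  split_ifs
  · rw [← ha]
    exact a.map_coord_zero 0 rfl
  · exact (interiorDy_apply i _ φ z' v).symm

/-- Integration by parts: the derivatives of a contact form can be moved to the other factor. -/
theorem eulerOp_contact_wedge {ψ : ModelForm n m p} {z : Model n m}
    (hψ : FiniteOrderFormAt ψ z) (i j : Fin m) (M : MultiIndex n) :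
    eulerOp j (wedgeOne (contactForm i M) ψ) =ᶠ[𝓝 z]
      eulerOp j (wedgeOne (contactForm i 0) ((-1 : ℝ) ^ M.len • iterOp totalDeriv M ψ)) := by
  induction M using MultiIndex.induction generalizing ψ with
  | h0 => simp only [iterOp_zero, MultiIndex.len_zero, pow_zero, one_smul]; rfl
  | h M l ih =>
    -- `θ_{λ+M} ∧ ψ = d_λ (θ_M ∧ ψ) - θ_M ∧ d_λ ψ`, and the first term is annihilated
    have h1 : wedgeOne (contactForm i (M.cons l)) ψ =ᶠ[𝓝 z]
        totalDeriv l (wedgeOne (contactForm i M) ψ) +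
          (-1 : ℝ) • wedgeOne (contactForm i M) (totalDeriv l ψ) := by
      refine hψ.eventually.mono fun z' h => ?_
      rw [Pi.add_apply, totalDeriv_contact_wedge h, Pi.smul_apply, neg_one_smul]
      abel
    have h2 := (hψ.contact_wedge i M).totalDeriv l
    have h3 := (hψ.totalDeriv l).contact_wedge i M
    have hw : ∀ {χ χ' : ModelForm n m p}, χ =ᶠ[𝓝 z] χ' →
        wedgeOne (contactForm i 0) χ =ᶠ[𝓝 z] wedgeOne (contactForm i 0) χ' :=
      fun e => e.mono fun z' h => by rw [wedgeOne_eq, wedgeOne_eq, h]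
    refine (eulerOp_congr h1 j).trans ((eulerOp_add h2 (h3.const_smul _) j).trans ?_)
    have h4 : eulerOp j ((-1 : ℝ) • wedgeOne (contactForm i M) (totalDeriv l ψ)) =ᶠ[𝓝 z]
        (-1 : ℝ) • eulerOp j (wedgeOne (contactForm i 0)
          ((-1 : ℝ) ^ M.len • iterOp totalDeriv M (totalDeriv l ψ))) :=
      (eulerOp_const_smul h3 _ j).trans (EventuallyEq.smul_form (ih (hψ.totalDeriv l)) _)
    have h5 : (-1 : ℝ) • eulerOp j (wedgeOne (contactForm i 0)
          ((-1 : ℝ) ^ M.len • iterOp totalDeriv M (totalDeriv l ψ))) =ᶠ[𝓝 z]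
        eulerOp j (wedgeOne (contactForm i 0)
          ((-1 : ℝ) ^ (M.cons l).len • iterOp totalDeriv (M.cons l) ψ)) := by
      refine (eulerOp_const_smul ((((hψ.totalDeriv l).iterOp M).const_smul _).contact_wedge i 0)
        _ j).symm.trans (eulerOp_congr ?_ j)
      refine (iterOp_totalDeriv_cons' hψ M l).mono fun z' h => ?_
      funext v
      simp only [Pi.smul_apply, wedgeOne_eq, wedgeCovector, h, MultiIndex.len_cons, pow_succ,
        smul_eq_mul, Finset.mul_sum]
      exact Finset.sum_congr rfl fun _ _ => by ring
    refine ((eulerOp_totalDeriv (hψ.contact_wedge i M) j l).add (h4.trans h5)).trans ?_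
    rw [zero_add]

theorem wedgeOne_congr {a : Model n m → Model n m → ℝ} {φ ψ : ModelForm n m p} {z : Model n m}
    (h : φ =ᶠ[𝓝 z] ψ) : wedgeOne a φ =ᶠ[𝓝 z] wedgeOne a ψ :=
  h.mono fun z' e => by rw [wedgeOne_eq, wedgeOne_eq, e]

theorem wedgeOne_smul (a : Model n m → Model n m → ℝ) (c : ℝ) (φ : ModelForm n m p) :
    wedgeOne a (c • φ) = c • wedgeOne a φ := by
  funext z v
  simp only [wedgeOne, Pi.smul_apply, smul_eq_mul, Finset.mul_sum]
  exact Finset.sum_congr rfl fun _ _ => by ring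

theorem wedgeOne_sum {κ : Type*} (s : Finset κ) (a : Model n m → Model n m → ℝ)
    (φ : κ → ModelForm n m p) : wedgeOne a (∑ b ∈ s, φ b) = ∑ b ∈ s, wedgeOne a (φ b) := by
  funext z v
  simp only [wedgeOne, Finset.sum_apply, Finset.mul_sum]
  rw [Finset.sum_comm]

theorem wedgeOne_zero (a : Model n m → Model n m → ℝ) :
    wedgeOne a (0 : ModelForm n m p) = 0 := by
  funext z v; simp [wedgeOne]

theorem tauBar_eq_sum_of_subset {φ : ModelForm n m (p + 1)} {z : Model n m}
    {S : Finset (Fin m × MultiIndex n)}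
    (hS : ∀ᶠ z' in 𝓝 z, ∀ a ∉ S, interiorDy a.1 a.2 φ z' = 0) : tauBar φ =ᶠ[𝓝 z]
      ∑ a ∈ S, wedgeOne (contactForm a.1 0)
        ((-1 : ℝ) ^ a.2.len • iterOp totalDeriv a.2 (interiorDy a.1 a.2 φ)) := by
  refine hS.eventually_nhds.mono fun z' h' => funext fun v => ?_
  rw [tauBar, finsum_eq_sum_of_support_subset (s := S)]
  · simp [Finset.sum_apply, wedgeOne_smul]
  · intro a ha
    by_contra hcon
    refine ha ?_
    have e : interiorDy a.1 a.2 φ =ᶠ[𝓝 z'] 0 := h'.mono fun _ e => e a hcon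
    have e' := (wedgeOne_congr (a := contactForm a.1 0)
      (iterOp_totalDeriv_congr e a.2)).self_of_nhds
    rw [iterOp_totalDeriv_zero, wedgeOne_zero] at e'
    beta_reduce
    rw [e']
    simp

theorem tauBar_eq_sum_eulerOp {φ : ModelForm n m (p + 1)} {z : Model n m}
    (hφ : FiniteOrderFormAt φ z) :
    tauBar φ =ᶠ[𝓝 z] ∑ i, wedgeOne (contactForm i 0) (eulerOp i φ) := by
  classical
  obtain ⟨S, hS⟩ := hφ.exists_interiorDy_eq_zero
  have h1 : ∀ᶠ z' in 𝓝 z, ∀ a ∉ (Finset.univ : Finset (Fin m)) ×ˢ S.image Prod.snd,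
      interiorDy a.1 a.2 φ z' = 0 := hS.mono fun z' h a ha => h.2.2 a fun hmem =>
    ha (Finset.mem_product.2 ⟨Finset.mem_univ _, Finset.mem_image_of_mem Prod.snd hmem⟩)
  refine (tauBar_eq_sum_of_subset h1).trans ?_
  rw [Finset.sum_product]
  refine eventuallyEq_sum fun i _ => ?_
  have h2 : ∀ᶠ z' in 𝓝 z, ∀ Λ ∉ S.image Prod.snd, interiorDy i Λ φ z' = 0 :=
    hS.mono fun z' h Λ hΛ => h.2.2 (i, Λ) fun hmem => hΛ (Finset.mem_image_of_mem Prod.snd hmem)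
  refine EventuallyEq.trans ?_ (wedgeOne_congr (eulerSum_eq_sum h2)).symm
  rw [wedgeOne_sum]

theorem FiniteOrderFormAt.tauBar {φ : ModelForm n m (p + 1)} {z : Model n m}
    (hφ : FiniteOrderFormAt φ z) : FiniteOrderFormAt (tauBar φ) z :=
  (FiniteOrderFormAt.sum fun i _ => (hφ.eulerOp i).contact_wedge i 0).congr
    (tauBar_eq_sum_eulerOp hφ)

theorem tauBar_congr {φ ψ : ModelForm n m (p + 1)} {z : Model n m} (h : φ =ᶠ[𝓝 z] ψ) :
    tauBar φ =ᶠ[𝓝 z] tauBar ψ := by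
  refine h.eventually_nhds.mono fun z' h' => funext fun v => finsum_congr fun a => ?_
  have e : interiorDy a.1 a.2 φ =ᶠ[𝓝 z'] interiorDy a.1 a.2 ψ :=
    Eventually.mono h' fun z' e => by rw [interiorDy_eq, interiorDy_eq, e]
  rw [(wedgeOne_congr (iterOp_totalDeriv_congr e a.2)).self_of_nhds]

theorem wedgeOne_add (a : Model n m → Model n m → ℝ) (φ ψ : ModelForm n m p) :
    wedgeOne a (φ + ψ) = wedgeOne a φ + wedgeOne a ψ := by
  funext z v
  simp only [wedgeOne, Pi.add_apply, ← Finset.sum_add_distrib]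
  exact Finset.sum_congr rfl fun _ _ => by ring

theorem tauBar_add {φ ψ : ModelForm n m (p + 1)} {z : Model n m} (hφ : FiniteOrderFormAt φ z)
    (hψ : FiniteOrderFormAt ψ z) : tauBar (φ + ψ) =ᶠ[𝓝 z] tauBar φ + tauBar ψ := by
  refine (tauBar_eq_sum_eulerOp (hφ.add hψ)).trans (EventuallyEq.trans ?_
    ((tauBar_eq_sum_eulerOp hφ).add (tauBar_eq_sum_eulerOp hψ)).symm)
  rw [← Finset.sum_add_distrib]
  refine eventuallyEq_sum fun i _ => ?_
  rw [← wedgeOne_add]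
  exact wedgeOne_congr (eulerOp_add hφ hψ i)

theorem tauBar_const_smul {φ : ModelForm n m (p + 1)} {z : Model n m}
    (hφ : FiniteOrderFormAt φ z) (c : ℝ) : tauBar (c • φ) =ᶠ[𝓝 z] c • tauBar φ := by
  refine (tauBar_eq_sum_eulerOp (hφ.const_smul c)).trans (EventuallyEq.trans ?_
    (EventuallyEq.smul_form (tauBar_eq_sum_eulerOp hφ) c).symm)
  rw [Finset.smul_sum]
  refine eventuallyEq_sum fun i _ => ?_
  rw [← wedgeOne_smul]
  exact wedgeOne_congr (eulerOp_const_smul hφ c i)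

/-! ### Contact degree -/

/-- Near `z`, the form `φ` has the contact degree `c`. -/
def HasContactDegreeAt (c : ℝ) (φ : ModelForm n m p) (z : Model n m) : Prop :=
  ∀ᶠ z' in 𝓝 z, derivAction (vertPart z') (φ z') = c • φ z'

theorem HasContactDegreeAt.congr {c : ℝ} {φ ψ : ModelForm n m p} {z : Model n m}
    (hφ : HasContactDegreeAt c φ z) (h : ψ =ᶠ[𝓝 z] φ) : HasContactDegreeAt c ψ z := by
  filter_upwards [hφ, h] with z' a b
  rw [b, a]

theorem HasContactDegreeAt.sum {κ : Type*} {s : Finset κ} {c : ℝ} {φ : κ → ModelForm n m p}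
    {z : Model n m} (h : ∀ a ∈ s, HasContactDegreeAt c (φ a) z) :
    HasContactDegreeAt c (∑ a ∈ s, φ a) z := by
  refine ((Finset.eventually_all s).2 h).mono fun z' h' => ?_
  have e : derivAction (vertPart z') ((∑ a ∈ s, φ a) z') =
      ∑ a ∈ s, derivAction (vertPart z') (φ a z') := by
    funext v
    simp only [derivAction, Finset.sum_apply]
    exact Finset.sum_comm
  rw [e, Finset.sum_congr rfl h', Finset.sum_apply, Finset.smul_sum]

theorem HasContactDegreeAt.funSmul {c : ℝ} {φ : ModelForm n m p} {z : Model n m}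
    (h : HasContactDegreeAt c φ z) (f : Model n m → ℝ) :
    HasContactDegreeAt c (funSmul f φ) z := by
  refine h.mono fun z' h' => ?_
  have e : derivAction (vertPart z') (_root_.funSmul f φ z') =
      f z' • derivAction (vertPart z') (φ z') := by
    funext v
    simp only [derivAction, _root_.funSmul, Pi.smul_apply, smul_eq_mul, Finset.mul_sum]
  rw [e, h', smul_comm]; rfl

theorem HasContactDegreeAt.const_smul {c : ℝ} {φ : ModelForm n m p} {z : Model n m}
    (h : HasContactDegreeAt c φ z) (r : ℝ) : HasContactDegreeAt c (r • φ) z :=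
  h.funSmul fun _ => r

theorem vertPart_fibreVec (z : Model n m) (a : Fin m × MultiIndex n) :
    vertPart z (fibreVec a) = fibreVec a := by
  rw [vertPart_apply, horizPart_of_fst_eq_zero rfl, sub_zero]

theorem HasContactDegreeAt.interiorDy {c : ℝ} {φ : ModelForm n m (p + 1)} {z : Model n m}
    (h : HasContactDegreeAt c φ z) (i : Fin m) (Λ : MultiIndex n) :
    HasContactDegreeAt (c - 1) (interiorDy i Λ φ) z := by
  refine h.mono fun z' h' => funext fun v => ?_
  have e := derivAction_cons (vertPart z') (φ z') (fibreVec (i, Λ)) v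
  rw [h', vertPart_fibreVec] at e
  rw [interiorDy_eq]
  simp only [Pi.smul_apply, smul_eq_mul] at e ⊢
  linarith

theorem HasContactDegreeAt.contact_wedge {c : ℝ} {φ : ModelForm n m p} {z : Model n m}
    (h : HasContactDegreeAt c φ z) (i : Fin m) (Λ : MultiIndex n) :
    HasContactDegreeAt (c + 1) (wedgeOne (contactForm i Λ) φ) z := by
  refine h.mono fun z' h' => funext fun v => ?_
  have e : (fun v => contactForm i Λ z' (vertPart z' v)) = contactForm i Λ z' := by
    funext v
    have h1 := vertPart_snd z' (vertPart z' v) (i, Λ)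
    rw [vertPart_vertPart, vertPart_snd] at h1
    exact h1.symm
  rw [wedgeOne_eq, derivAction_wedgeCovector, e, h']
  rw [Pi.add_apply, Pi.smul_apply, smul_eq_mul, add_mul, one_mul, add_comm]
  congr 1
  simp only [wedgeCovector, Pi.smul_apply, smul_eq_mul, Finset.mul_sum]
  exact Finset.sum_congr rfl fun _ _ => by ring

theorem derivAction_derivAction (C C' : Model n m → Model n m) (α : (Fin p → Model n m) → ℝ)
    (v : Fin p → Model n m) :
    derivAction C (derivAction C' α) v + ∑ j, α (Function.update v j (C (C' (v j)))) =
      derivAction C' (derivAction C α) v + ∑ j, α (Function.update v j (C' (C (v j)))) := by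
  have key : ∀ C C' : Model n m → Model n m, derivAction C (derivAction C' α) v =
      ∑ j, α (Function.update v j (C' (C (v j)))) + ∑ i, ∑ j, if i = j then 0 else
        α (Function.update (Function.update v i (C (v i))) j (C' (v j))) := by
    intro C C'
    rw [← Finset.sum_add_distrib]
    refine Finset.sum_congr rfl fun i _ => ?_
    have hd : α (Function.update v i (C' (C (v i)))) =
      ∑ j, if i = j then α (Function.update v j (C' (C (v j)))) else 0 := by simp
    rw [hd, ← Finset.sum_add_distrib]
    refine Finset.sum_congr rfl fun j _ => ?_
    split_ifs with h
    · subst h; simp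
    · rw [Function.update_of_ne (Ne.symm h), zero_add]
  have hoff : (∑ i, ∑ j, if i = j then 0 else
        α (Function.update (Function.update v i (C' (v i))) j (C (v j)))) =
      ∑ i, ∑ j, if i = j then 0 else
        α (Function.update (Function.update v i (C (v i))) j (C' (v j))) := by
    rw [Finset.sum_comm]
    refine Finset.sum_congr rfl fun i _ => Finset.sum_congr rfl fun j _ => ?_
    by_cases h : i = j
    · simp [h]
    · rw [if_neg h, if_neg (Ne.symm h), Function.update_comm h]
  rw [key C C', key C' C, hoff]
  ring

/-- The total derivatives preserve the contact degree. -/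
theorem HasContactDegreeAt.totalDeriv {c : ℝ} {φ : ModelForm n m p} {z : Model n m}
    (h : HasContactDegreeAt c φ z) (hφ : FiniteOrderFormAt φ z) (l : Fin n) :
    HasContactDegreeAt c (totalDeriv l φ) z := by
  refine (h.eventually_nhds.and hφ.eventually).mono fun z' ⟨h', hφ'⟩ => funext fun v => ?_
  have h1 : _root_.totalDeriv l (fun z => derivAction (vertPart z) (φ z)) z' =
      c • _root_.totalDeriv l φ z' := by
    rw [← totalDeriv_const_smul hφ']
    exact totalDeriv_congr_nhds h' l
  have hV : ∀ v, FiniteOrderMapAt (fun z => vertPart z v) z' := fun v =>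
    (finiteOrderMapAt_const v z').sub
      (.sum fun l _ => .smul (finiteOrderAt_const _ z') (finiteOrderMapAt_totalVec l z'))
  have hw : ∀ (v : Fin p → Model n m) (j i : Fin p),
      FiniteOrderMapAt (fun z => Function.update v j (vertPart z (v j)) i) z' := by
    intro v j i
    by_cases e : i = j
    · subst e; simpa using hV (v i)
    · simpa [Function.update_of_ne e] using finiteOrderMapAt_const _ z'
  -- the vertical projection is not constant along `d_λ`, since its kernel is spanned by the `d_λ'`
  have hVd : ∀ v u, mapDeriv (fun z => vertPart z v) z' u = -∑ l, v.1 l • shiftVec l u := by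
    intro v u
    refine Prod.ext (funext fun l' => ?_) (funext fun a => ?_)
    · have : (fun z : Model n m => (vertPart z v).1 l') = fun _ => 0 := by
        funext z; rw [vertPart_fst]; rfl
      simp [mapDeriv, this, lineDeriv_const_fun, shiftVec, Prod.fst_sum]
    · have : (fun z : Model n m => (vertPart z v).2 a) = fun z => contactForm a.1 a.2 z v := by
        funext z; rw [vertPart_snd]
      simp only [mapDeriv, this]
      have h1 : HasDerivAt (fun t : ℝ => contactForm a.1 a.2 (z' + t • u) v)
          (0 - ∑ l', u.2 (a.1, a.2.cons l') * v.1 l') 0 :=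
        (hasDerivAt_const _ _).sub (HasDerivAt.fun_sum fun l' _ =>
          ((hasCurveDeriv_line z' u 0).2 _).mul_const _)
      rw [lineDeriv, h1.deriv]
      simp [shiftVec, Prod.snd_sum, Finset.sum_apply, mul_comm]
  -- the derivative of `z ↦ φ z (…, vertPart z (v j), …)` along `d_λ`
  have h2 : ∀ j, lineDeriv ℝ (fun z => φ z (Function.update v j (vertPart z (v j)))) z'
        (totalVec l z') =
      lineDeriv ℝ (fun z => φ z (Function.update v j (vertPart z' (v j)))) z' (totalVec l z') +
        φ z' (Function.update v j (-∑ l', (v j).1 l' • shiftVec l' (totalVec l z'))) := by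
    intro j
    have := FiniteOrderFormAt.lineDeriv_apply_field (T := fun z => z)
      (w := fun i z => Function.update v j (vertPart z (v j)) i) hφ' (finiteOrderMapAt_id z')
      (hw v j) (totalVec l z')
    have hid : mapDeriv (fun z : Model n m => z) z' (totalVec l z') = totalVec l z' :=
      Prod.ext (funext fun _ => lineDeriv_fst _ _ _) (funext fun _ => lineDeriv_snd _ _ _)
    rw [hid] at this
    refine this.trans (congrArg₂ (· + ·) rfl ?_)
    obtain ⟨a, ha⟩ := hφ'.isAlternating
    rw [Finset.sum_eq_single j]
    · simp only [Function.update_self, hVd]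
      congr 1
      funext i
      by_cases e : i = j
      · subst e; simp
      · simp [Function.update_of_ne e]
    · intro i _ hi
      rw [← ha]
      refine a.map_coord_zero i ?_
      simp [Function.update_of_ne hi, mapDeriv_const]
    · simp
  have h3 := congrFun h1 v
  rw [totalDeriv_apply] at h3
  have h4 : lineDeriv ℝ (fun z => derivAction (vertPart z) (φ z) v) z' (totalVec l z') =
      ∑ j, lineDeriv ℝ (fun z => φ z (Function.update v j (vertPart z (v j)))) z'
        (totalVec l z') := by
    refine lineDeriv_sum_fun (fun j _ => ?_) _
    exact FiniteOrderFormAt.apply_field (T := fun z => z)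
      (w := fun i z => Function.update v j (vertPart z (v j)) i) hφ' (finiteOrderMapAt_id z')
      (hw v j)
  rw [h4, Finset.sum_congr rfl fun j _ => h2 j, Finset.sum_add_distrib] at h3
  have h5 : derivAction (vertPart z') (_root_.totalDeriv l φ z') v =
      ∑ j, lineDeriv ℝ (fun z => φ z (Function.update v j (vertPart z' (v j)))) z'
        (totalVec l z') + derivAction (vertPart z') (derivAction (shiftVec l) (φ z')) v := by
    simp only [derivAction, ← Finset.sum_add_distrib]
    rfl
  have h6 := derivAction_derivAction (vertPart z') (shiftVec l) (φ z') v
  -- the commutator of the vertical projection with `shiftVec l` cancels the extra term of `h2`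
  have h7 : ∀ j, φ z' (Function.update v j (shiftVec l (vertPart z' (v j)))) =
      φ z' (Function.update v j (vertPart z' (shiftVec l (v j)))) +
        φ z' (Function.update v j (-∑ l', (v j).1 l' • shiftVec l' (totalVec l z'))) := by
    intro j
    obtain ⟨a, ha⟩ := hφ'.isAlternating
    rw [← ha, ← AlternatingMap.map_update_add]
    congr 2
    have e1 : vertPart z' (shiftVec l (v j)) = shiftVec l (v j) := by
      rw [vertPart_apply, horizPart_of_fst_eq_zero rfl, sub_zero]
    rw [e1, vertPart_apply]
    change shiftLin l (v j - horizPart z' (v j)) = _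
    rw [map_sub, horizPart, map_sum, sub_eq_add_neg]
    congr 2
    refine Finset.sum_congr rfl fun l' _ => ?_
    rw [map_smul]
    change _ • shiftVec l (totalVec l' z') = _
    rw [shiftVec_totalVec_comm]
  rw [Finset.sum_congr rfl fun j _ => h7 j, Finset.sum_add_distrib] at h6
  rw [h5, ← h3]
  linarith

theorem HasContactDegreeAt.iterOp {c : ℝ} {φ : ModelForm n m p} {z : Model n m}
    (h : HasContactDegreeAt c φ z) (hφ : FiniteOrderFormAt φ z) (Λ : MultiIndex n) :
    HasContactDegreeAt c (iterOp _root_.totalDeriv Λ φ) z :=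
  (iterOp_rel (D' := fun _ (a : Unit) => a) (b := ()) (fun (φ : ModelForm n m p) _ =>
    FiniteOrderFormAt φ z ∧ HasContactDegreeAt c φ z)
    (fun l _ _ h => ⟨h.1.totalDeriv l, h.2.totalDeriv h.1 l⟩) Λ ⟨hφ, h⟩).2

theorem HasContactDegreeAt.eulerOp {c : ℝ} {φ : ModelForm n m (p + 1)} {z : Model n m}
    (h : HasContactDegreeAt c φ z) (hφ : FiniteOrderFormAt φ z) (i : Fin m) :
    HasContactDegreeAt (c - 1) (eulerOp i φ) z := by
  obtain ⟨L, hL⟩ := (hφ.isFinFamilyAt_interiorDy i).fin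
  exact (HasContactDegreeAt.sum fun Λ _ =>
    ((h.interiorDy i Λ).iterOp (hφ.interiorDy i Λ) Λ).const_smul _).congr (eulerSum_eq_sum hL)

theorem HasContactDegreeAt.tauBar {c : ℝ} {φ : ModelForm n m (p + 1)} {z : Model n m}
    (h : HasContactDegreeAt c φ z) (hφ : FiniteOrderFormAt φ z) :
    HasContactDegreeAt c (tauBar φ) z := by
  refine (HasContactDegreeAt.sum fun i _ => ?_).congr (tauBar_eq_sum_eulerOp hφ)
  simpa using (h.eulerOp hφ i).contact_wedge i 0

/-- On forms of contact degree `c`, the operator `τ̄` squares to `c τ̄`. -/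
theorem tauBar_tauBar {c : ℝ} {φ : ModelForm n m (p + 1)} {z : Model n m}
    (h : HasContactDegreeAt c φ z) (hφ : FiniteOrderFormAt φ z) :
    tauBar (tauBar φ) =ᶠ[𝓝 z] c • tauBar φ := by
  obtain ⟨S, hS⟩ := hφ.exists_interiorDy_eq_zero
  have h1 : c • φ =ᶠ[𝓝 z]
      ∑ a ∈ S, wedgeOne (contactForm a.1 a.2) (interiorDy a.1 a.2 φ) := by
    filter_upwards [h, hS] with z' a b
    rw [Pi.smul_apply, ← a]
    funext v
    rw [← sum_contactForm_wedge b.2.1 b.1 z' v, Finset.sum_apply, Finset.sum_apply]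
    exact Finset.sum_congr rfl fun d _ => by rw [wedgeOne_eq, interiorDy_eq]
  -- both sides are the sum over `i, Λ` of `E_j (θ^i ∧ (-1)^|Λ| d_Λ (∂_i^Λ ⌋ φ))`
  have h2 : ∀ j, eulerOp j (tauBar φ) =ᶠ[𝓝 z] c • eulerOp j φ := by
    intro j
    have hf : ∀ a : Fin m × MultiIndex n, FiniteOrderFormAt
        ((-1 : ℝ) ^ a.2.len • iterOp totalDeriv a.2 (interiorDy a.1 a.2 φ)) z := fun a =>
      ((hφ.interiorDy a.1 a.2).iterOp a.2).const_smul _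
    refine (eulerOp_congr (tauBar_eq_sum_of_subset (hS.mono fun z' h => h.2.2)) j).trans
      ((eulerOp_sum (fun a _ => (hf a).contact_wedge a.1 0) j).trans ?_)
    refine EventuallyEq.trans (EventuallyEq.symm ?_) (eulerOp_const_smul hφ c j)
    refine (eulerOp_congr h1 j).trans ((eulerOp_sum (fun a _ =>
      (hφ.interiorDy a.1 a.2).contact_wedge a.1 a.2) j).trans (eventuallyEq_sum fun a _ => ?_))
    exact eulerOp_contact_wedge (hφ.interiorDy a.1 a.2) a.1 j a.2
  refine (tauBar_eq_sum_eulerOp hφ.tauBar).trans (EventuallyEq.trans ?_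
    (EventuallyEq.smul_form (tauBar_eq_sum_eulerOp hφ) c).symm)
  rw [Finset.smul_sum]
  refine eventuallyEq_sum fun i _ => ?_
  rw [← wedgeOne_smul]
  exact wedgeOne_congr (h2 i)

end EulerSums

/-! ### Invariance of the Euler operator under changes of jet coordinates -/

section Invariance

variable {n m p : ℕ}

/-- The vector field `∑ B^λ(x) d_λ` on the model. -/
def totalField (b : Fin n → (Fin n → ℝ) → ℝ) (z : Model n m) : Model n m :=
  ∑ l, b l z.1 • totalVec l z

/-- Near `z₀`, the map `T` behaves like a change of jet coordinates: the total derivatives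
`d'_μ` in the new coordinates are the images of the fields `B_μ^λ(x) d_λ`, vertical vectors are
mapped to vertical vectors, and the new fibre coordinates of order zero only depend on `x` and on
the old fibre coordinates of order zero. -/
structure IsJetTransitionAt (T : Model n m → Model n m)
    (B : Fin n → Fin n → (Fin n → ℝ) → ℝ) (z₀ : Model n m) : Prop where
  finiteOrder : ∀ᶠ z in 𝓝 z₀, FiniteOrderMapAt T z
  coeff : ∀ μ l, FiniteOrderAt (fun z : Model n m => B μ l z.1) z₀
  totalVec_eq : ∀ᶠ z in 𝓝 z₀, ∀ μ, mapDeriv T z (totalField (B μ) z) = totalVec μ (T z)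
  vertical : ∀ᶠ z in 𝓝 z₀, ∀ v, v.1 = 0 → (mapDeriv T z v).1 = 0
  orderZero : ∀ᶠ z in 𝓝 z₀, ∀ v, v.1 = 0 → ∀ j, (mapDeriv T z v).2 (j, 0) =
    ∑ i, (mapDeriv T z (fibreVec (i, 0))).2 (j, 0) * v.2 (i, 0)

variable {T : Model n m → Model n m} {B : Fin n → Fin n → (Fin n → ℝ) → ℝ} {z₀ : Model n m}

theorem finiteOrderMapAt_totalField {b : Fin n → (Fin n → ℝ) → ℝ} {z : Model n m}
    (hb : ∀ l, FiniteOrderAt (fun z : Model n m => b l z.1) z) :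
    FiniteOrderMapAt (totalField b) z :=
  .sum fun l _ => .smul (hb l) (finiteOrderMapAt_totalVec l z)

theorem lineDeriv_of_fst_eq_zero (f : (Fin n → ℝ) → ℝ) (z : Model n m) {v : Model n m}
    (hv : v.1 = 0) : lineDeriv ℝ (fun z : Model n m => f z.1) z v = 0 := by
  simp [lineDeriv, hv]

theorem lineDeriv_fst_eq_sum {f : (Fin n → ℝ) → ℝ} {z : Model n m}
    (hf : FiniteOrderAt (fun z : Model n m => f z.1) z) (v : Model n m) :
    lineDeriv ℝ (fun z : Model n m => f z.1) z v =
      ∑ l, v.1 l * lineDeriv ℝ (fun z : Model n m => f z.1) z (totalVec l z) := by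
  have h : v = vertPart z v + ∑ l, v.1 l • totalVec l z := by
    rw [vertPart_apply, horizPart]; abel
  conv_lhs => rw [h]
  rw [hf.lineDeriv_add_vec, lineDeriv_of_fst_eq_zero f z (vertPart_fst z v), zero_add,
    hf.lineDeriv_sum_vec]
  exact Finset.sum_congr rfl fun l _ => lineDeriv_smul

theorem mapDeriv_totalField {b : Fin n → (Fin n → ℝ) → ℝ} {z : Model n m}
    (hb : ∀ l, FiniteOrderAt (fun z : Model n m => b l z.1) z) (v : Model n m) :
    mapDeriv (totalField b) z v =
      ∑ l, (lineDeriv ℝ (fun z : Model n m => b l z.1) z v • totalVec l z +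
        b l z.1 • shiftVec l v) := by
  refine Prod.ext (funext fun l' => ?_) (funext fun a => ?_)
  · have e : (fun z : Model n m => (totalField b z).1 l') =
        fun z => ∑ l, b l z.1 * (totalVec l z).1 l' := by
      funext z; simp [totalField, Prod.fst_sum]
    simp only [mapDeriv, e]
    rw [lineDeriv_sum_fun fun l _ => (hb l).mul ((finiteOrderMapAt_totalVec l z).1 l')]
    simp only [Prod.fst_sum, Finset.sum_apply, Prod.fst_add, Pi.add_apply, Prod.smul_fst,
      Pi.smul_apply, smul_eq_mul]
    refine Finset.sum_congr rfl fun l _ => ?_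
    rw [lineDeriv_mul_fun (hb l) ((finiteOrderMapAt_totalVec l z).1 l')]
    have := congrFun (congrArg Prod.fst (mapDeriv_totalVec l z v)) l'
    exact congrArg₂ (· + ·) rfl (congrArg _ this)
  · have e : (fun z : Model n m => (totalField b z).2 a) =
        fun z => ∑ l, b l z.1 * (totalVec l z).2 a := by
      funext z; simp [totalField, Prod.snd_sum]
    simp only [mapDeriv, e]
    rw [lineDeriv_sum_fun fun l _ => (hb l).mul ((finiteOrderMapAt_totalVec l z).2 a)]
    simp only [Prod.snd_sum, Finset.sum_apply, Prod.snd_add, Pi.add_apply, Prod.smul_snd,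
      Pi.smul_apply, smul_eq_mul]
    refine Finset.sum_congr rfl fun l _ => ?_
    rw [lineDeriv_mul_fun (hb l) ((finiteOrderMapAt_totalVec l z).2 a)]
    have := congrFun (congrArg Prod.snd (mapDeriv_totalVec l z v)) a
    exact congrArg₂ (· + ·) rfl (congrArg _ this)

/-- Contraction of `a ∧ α = 0` with the vector `u`. -/
theorem sum_update_of_wedgeCovector_eq_zero {α : (Fin p → Model n m) → ℝ} (hα : IsAlternating α)
    {a : Model n m → ℝ} (h : wedgeCovector a α = 0) (u : Model n m) (v : Fin p → Model n m) :
    ∑ j, a (v j) * α (Function.update v j u) = a u * α v := by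
  cases p with
  | zero =>
    have := congrFun h fun _ => u
    simp only [wedgeCovector] at this
    rw [Finset.univ_eq_empty, Finset.sum_empty]
    have hv : v = fun _ => u := Subsingleton.elim _ _
    rw [hv]
    simpa using this.symm
  | succ p =>
    have := congrFun h (Fin.cons u v)
    rw [wedgeCovector_cons_left, wedgeCovector_cons hα] at this
    rw [Pi.zero_apply] at this
    linarith

/-- On forms which are horizontal of the maximal degree, the Lie derivative along
`∑ B^λ(x) d_λ` is `φ ↦ ∑ d_λ (B^λ φ)`. -/
theorem lieDeriv_totalField {b : Fin n → (Fin n → ℝ) → ℝ} {φ : ModelForm n m p} {z : Model n m}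
    (hb : ∀ l, FiniteOrderAt (fun z : Model n m => b l z.1) z) (hφ : FiniteOrderFormAt φ z)
    (hor : ∀ ν, wedgeCovector (dxCovector ν) (φ z) = 0) (v : Fin p → Model n m) :
    lineDeriv ℝ (fun z => φ z v) z (totalField b z) +
        derivAction (mapDeriv (totalField b) z) (φ z) v =
      ∑ l, totalDeriv l (funSmul (fun z => b l z.1) φ) z v := by
  obtain ⟨a, ha⟩ := hφ.isAlternating
  have h1 : lineDeriv ℝ (fun z => φ z v) z (totalField b z) =
      ∑ l, b l z.1 * lineDeriv ℝ (fun z => φ z v) z (totalVec l z) := by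
    rw [totalField, (hφ.apply v).lineDeriv_sum_vec]
    exact Finset.sum_congr rfl fun l _ => lineDeriv_smul
  have h2 : derivAction (mapDeriv (totalField b) z) (φ z) v =
      ∑ l, (lineDeriv ℝ (fun z : Model n m => b l z.1) z (totalVec l z) * φ z v +
        b l z.1 * derivAction (shiftVec l) (φ z) v) := by
    have h3 : ∀ j, φ z (Function.update v j (mapDeriv (totalField b) z (v j))) =
        ∑ l, (lineDeriv ℝ (fun z : Model n m => b l z.1) z (v j) *
          φ z (Function.update v j (totalVec l z)) +
          b l z.1 * φ z (Function.update v j (shiftVec l (v j)))) := by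
      intro j
      rw [mapDeriv_totalField hb, ← ha, AlternatingMap.map_update_sum]
      refine Finset.sum_congr rfl fun l _ => ?_
      rw [AlternatingMap.map_update_add, AlternatingMap.map_update_smul,
        AlternatingMap.map_update_smul]
      rfl
    simp only [derivAction, h3]
    rw [Finset.sum_comm]
    refine Finset.sum_congr rfl fun l _ => ?_
    rw [Finset.sum_add_distrib, ← Finset.mul_sum]
    congr 1
    -- `∑_j dB^l (v_j) φ (…, d_l, …) = d_l (B^l) φ (v)`, by contracting `dx^ν ∧ φ = 0` with `d_l`
    have h4 : ∀ j, lineDeriv ℝ (fun z : Model n m => b l z.1) z (v j) *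
        φ z (Function.update v j (totalVec l z)) =
        ∑ ν, lineDeriv ℝ (fun z : Model n m => b l z.1) z (totalVec ν z) *
          (dxCovector ν (v j) * φ z (Function.update v j (totalVec l z))) := by
      intro j
      rw [lineDeriv_fst_eq_sum (hb l) (v j), Finset.sum_mul]
      refine Finset.sum_congr rfl fun ν _ => ?_
      change (v j).1 ν * _ * _ = _ * ((v j).1 ν * _)
      ring
    simp only [h4]
    rw [Finset.sum_comm]
    simp only [← Finset.mul_sum,
      sum_update_of_wedgeCovector_eq_zero hφ.isAlternating (hor _) (totalVec l z) v]
    rw [Finset.sum_eq_single l]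
    · change _ * ((totalVec l z).1 l * _) = _
      simp [totalVec]
    · intro ν _ hν
      change _ * ((totalVec l z).1 ν * _) = _
      simp [totalVec, hν]
    · simp
  rw [h1, h2, ← Finset.sum_add_distrib]
  refine Finset.sum_congr rfl fun l _ => ?_
  rw [totalDeriv_funSmul (hb l) hφ]
  simp only [Pi.add_apply, Pi.smul_apply, smul_eq_mul, totalDeriv_apply]
  ring

/-- Naturality of the Lie derivative: the field `w` is related by `T` to `d_μ`. -/
theorem lieDeriv_formPullback {φ : ModelForm n m p} {w : Model n m → Model n m} {z : Model n m}
    {μ : Fin n} (hφ : FiniteOrderFormAt φ (T z)) (hT : FiniteOrderMapAt T z)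
    (hw : FiniteOrderMapAt w z)
    (h : (fun z' => mapDeriv T z' (w z')) =ᶠ[𝓝 z] fun z' => totalVec μ (T z'))
    (v : Fin p → Model n m) :
    lineDeriv ℝ (fun z => formPullback T φ z v) z (w z) +
        derivAction (mapDeriv w z) (formPullback T φ z) v =
      formPullback T (totalDeriv μ φ) z v := by
  obtain ⟨a, ha⟩ := hφ.isAlternating
  have h1 := FiniteOrderFormAt.lineDeriv_apply_field (w := fun j z => mapDeriv T z (v j)) hφ hT
    (fun j => hT.mapDeriv_field (finiteOrderMapAt_const _ z)) (w z)
  have h2 : derivAction (mapDeriv w z) (formPullback T φ z) v =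
      ∑ j, φ (T z) (Function.update (fun i => mapDeriv T z (v i)) j
        (mapDeriv T z (mapDeriv w z (v j)))) := by
    refine Finset.sum_congr rfl fun j _ => ?_
    change φ (T z) _ = _
    refine congrArg (φ (T z)) (funext fun i => ?_)
    by_cases e : i = j
    · subst e; simp
    · simp [Function.update_of_ne e]
  have h3 : ∀ j, mapDeriv (fun z => mapDeriv T z (v j)) z (w z) +
      mapDeriv T z (mapDeriv w z (v j)) = shiftVec μ (mapDeriv T z (v j)) := by
    intro j
    rw [← mapDeriv_mapDeriv_field hT hw (v j), mapDeriv_congr_nhds h,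
      mapDeriv_comp_map (finiteOrderMapAt_totalVec μ (T z)) hT, mapDeriv_totalVec]
  change lineDeriv ℝ (fun z => φ (T z) fun j => mapDeriv T z (v j)) z (w z) + _ = _
  rw [h1, h2, add_assoc, ← Finset.sum_add_distrib]
  have h0 : mapDeriv T z (w z) = totalVec μ (T z) := h.self_of_nhds
  rw [h0]
  change _ = totalDeriv μ φ (T z) fun j => mapDeriv T z (v j)
  rw [totalDeriv_apply]
  congr 1
  refine Finset.sum_congr rfl fun j _ => ?_
  rw [← ha, ← AlternatingMap.map_update_add, h3]

theorem formPullback_congr {φ ψ : ModelForm n m p} (hT : FiniteOrderMapAt T z₀)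
    (h : φ =ᶠ[𝓝 (T z₀)] ψ) : formPullback T φ =ᶠ[𝓝 z₀] formPullback T ψ :=
  (hT.continuousAt.eventually h).mono fun _ e => funext fun _ => congrFun e _

theorem funSmul_congr {f : Model n m → ℝ} {φ ψ : ModelForm n m p}
    (h : φ =ᶠ[𝓝 z₀] ψ) : funSmul f φ =ᶠ[𝓝 z₀] funSmul f ψ :=
  h.mono fun z e => by rw [funSmul, funSmul, e]

namespace IsJetTransitionAt

theorem eventually (h : IsJetTransitionAt T B z₀) : ∀ᶠ z in 𝓝 z₀, IsJetTransitionAt T B z := by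
  filter_upwards [h.finiteOrder.eventually_nhds,
    eventually_all.2 fun μ => eventually_all.2 fun l => (h.coeff μ l).eventually,
    h.totalVec_eq.eventually_nhds, h.vertical.eventually_nhds, h.orderZero.eventually_nhds]
    with z h1 h2 h3 h4 h5 using ⟨h1, h2, h3, h4, h5⟩

/-- The old total derivatives are combinations of the fields `B_μ^λ d_λ`. -/
theorem exists_totalVec_eq (h : IsJetTransitionAt T B z₀) (l : Fin n) :
    ∃ c : Fin n → ℝ, totalVec l z₀ = ∑ μ, c μ • totalField (B μ) z₀ := by
  have hT := h.finiteOrder.self_of_nhds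
  let b : Matrix (Fin n) (Fin n) ℝ := fun μ l => B μ l z₀.1
  let A : Matrix (Fin n) (Fin n) ℝ := fun l ν => (mapDeriv T z₀ (totalVec l z₀)).1 ν
  have h1 : b * A = 1 := by
    ext μ ν
    have := congrFun (congrArg Prod.fst (h.totalVec_eq.self_of_nhds μ)) ν
    rw [totalField, mapDeriv_sum hT] at this
    simp only [mapDeriv_smul, Prod.fst_sum, Finset.sum_apply, Prod.smul_fst, Pi.smul_apply,
      smul_eq_mul] at this
    rw [Matrix.mul_apply, Matrix.one_apply]
    refine this.trans ?_
    simp [totalVec, Pi.single_apply, eq_comm]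
  have h2 : A * b = 1 := mul_eq_one_comm.1 h1
  refine ⟨A l, ?_⟩
  simp only [totalField, Finset.smul_sum, smul_smul]
  rw [Finset.sum_comm]
  simp only [← Finset.sum_smul]
  have h3 : ∀ κ, ∑ μ, A l μ * B μ κ z₀.1 = if l = κ then 1 else 0 := fun κ => by
    have := congrFun (congrFun h2 l) κ
    rwa [Matrix.mul_apply, Matrix.one_apply] at this
  simp [h3]

theorem vertPart_mapDeriv (h : IsJetTransitionAt T B z₀) (v : Model n m) :
    vertPart (T z₀) (mapDeriv T z₀ v) = mapDeriv T z₀ (vertPart z₀ v) := by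
  have hT := h.finiteOrder.self_of_nhds
  have h1 : ∀ l, vertPart (T z₀) (mapDeriv T z₀ (totalVec l z₀)) = 0 := by
    intro l
    obtain ⟨c, hc⟩ := h.exists_totalVec_eq l
    rw [hc, mapDeriv_sum hT, map_sum]
    refine Finset.sum_eq_zero fun μ _ => ?_
    rw [mapDeriv_smul, h.totalVec_eq.self_of_nhds μ, map_smul, vertPart_totalVec, smul_zero]
  have h2 : v = vertPart z₀ v + ∑ l, v.1 l • totalVec l z₀ := by
    rw [vertPart_apply, horizPart]; abel
  conv_lhs => rw [h2]
  rw [mapDeriv_add hT, map_add, mapDeriv_sum hT, map_sum]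
  rw [Finset.sum_eq_zero fun l _ => by rw [mapDeriv_smul, map_smul, h1, smul_zero], add_zero,
    vertPart_apply, horizPart_of_fst_eq_zero (h.vertical.self_of_nhds _ (vertPart_fst z₀ v)),
    sub_zero]

theorem hasContactDegreeAt (h : IsJetTransitionAt T B z₀) {c : ℝ} {φ : ModelForm n m p}
    (hφ : HasContactDegreeAt c φ (T z₀)) : HasContactDegreeAt c (formPullback T φ) z₀ := by
  filter_upwards [h.eventually, h.finiteOrder.self_of_nhds.continuousAt.eventually hφ]
    with z hz hφz
  funext v
  have := congrFun hφz fun j => mapDeriv T z (v j)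
  refine Eq.trans ?_ this
  refine Finset.sum_congr rfl fun j _ => ?_
  change φ (T z) _ = _
  refine congrArg (φ (T z)) (funext fun i => ?_)
  by_cases e : i = j
  · subst e; simp [hz.vertPart_mapDeriv]
  · simp [Function.update_of_ne e]

/-- The total derivatives in the new coordinates, read in the old ones. -/
theorem formPullback_totalDeriv (h : IsJetTransitionAt T B z₀) {k : ℕ} (hp : p = k + n)
    {φ : ModelForm n m p} (hφ : FiniteOrderFormAt φ (T z₀)) (hk : HasContactDegreeAt k φ (T z₀))
    (μ : Fin n) : formPullback T (totalDeriv μ φ) =ᶠ[𝓝 z₀]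
      ∑ l, totalDeriv l (funSmul (fun z => B μ l z.1) (formPullback T φ)) := by
  have hT := h.finiteOrder.self_of_nhds
  have hφT := hφ.pullback h.finiteOrder
  filter_upwards [h.eventually, h.totalVec_eq.eventually_nhds, hφT.eventually,
    hT.continuousAt.eventually hφ.eventually, h.hasContactDegreeAt hk] with z hz hW hφz hφz' hkz
  funext v
  rw [← lieDeriv_formPullback hφz' hz.finiteOrder.self_of_nhds
    (finiteOrderMapAt_totalField (hz.coeff μ)) (hW.mono fun z' e => e μ) v,
    lieDeriv_totalField (hz.coeff μ) hφz
      (fun ν => wedgeCovector_dx_eq_zero hφz.isAlternating hp hkz ν) v]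
  simp [Finset.sum_apply]

end IsJetTransitionAt

theorem isFinFamilyAt_funSmul {f : Model n m → ℝ} {φ : ModelForm n m p}
    (hf : FiniteOrderAt f z₀) (hφ : FiniteOrderFormAt φ z₀) (i : Fin m) :
    IsFinFamilyAt (fun Λ => funSmul (fun z => lineDeriv ℝ f z (fibreVec (i, Λ))) φ) z₀ := by
  classical
  obtain ⟨S, hS⟩ := hf.exists_lineDeriv_congr
  refine ⟨⟨S.image Prod.snd, hS.mono fun z h Λ hΛ => ?_⟩,
    fun Λ => .funSmul (hf.lineDeriv_const _) hφ⟩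
  have : restrictTo S (fibreVec (i, Λ) : Model n m) = restrictTo S 0 := by
    refine Prod.ext rfl (funext fun a => ?_)
    have : a.1 ≠ (i, Λ) := fun e => hΛ (Finset.mem_image.2 ⟨a, a.2, by rw [e]⟩)
    simp [restrictTo, fibreVec, this]
  rw [funSmul, h _ _ this, lineDeriv_zero, zero_smul]

/-- Integration by parts for the linearisation of the function `d_w f`, `w = ∑ B^λ d_λ`. -/
theorem eulerSum_linearisation {f : Model n m → ℝ} {b : Fin n → (Fin n → ℝ) → ℝ}
    {φ : ModelForm n m p} (hf : FiniteOrderAt f z₀)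
    (hb : ∀ l, FiniteOrderAt (fun z : Model n m => b l z.1) z₀) (hφ : FiniteOrderFormAt φ z₀)
    (i : Fin m) :
    eulerSum (fun Λ => funSmul (fun z => lineDeriv ℝ
        (fun z => lineDeriv ℝ f z (totalField b z)) z (fibreVec (i, Λ))) φ) =ᶠ[𝓝 z₀]
      (-1 : ℝ) • eulerSum (fun Λ => funSmul (fun z => lineDeriv ℝ f z (fibreVec (i, Λ)))
        (∑ l, totalDeriv l (funSmul (fun z => b l z.1) φ))) := by
  let β : Fin n → MultiIndex n → ModelForm n m p := fun l Λ =>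
    funSmul (fun z => lineDeriv ℝ f z (fibreVec (i, Λ))) (funSmul (fun z => b l z.1) φ)
  have hbφ : ∀ l, FiniteOrderFormAt (funSmul (fun z => b l z.1) φ) z₀ := fun l =>
    .funSmul (hb l) hφ
  have hβ : ∀ l, IsFinFamilyAt (β l) z₀ := fun l => isFinFamilyAt_funSmul hf (hbφ l) i
  have hD : FiniteOrderFormAt (∑ l, totalDeriv l (funSmul (fun z => b l z.1) φ)) z₀ :=
    .sum fun l _ => (hbφ l).totalDeriv l
  have hγ := isFinFamilyAt_funSmul hf hD i
  -- with `β_l^Λ = ∂_i^Λ f · B^l φ`, commuting `∂_i^Λ` with `∑ B^l d_l` gives the sum of the terms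
  -- `d_l β_l^Λ` and `β_l^{Λ-l}`, which drops out of the Euler sum, and `-∂_i^Λ f · d_l (B^l φ)`
  have key : ∀ᶠ z in 𝓝 z₀, ∀ Λ, funSmul (fun z => lineDeriv ℝ
        (fun z => lineDeriv ℝ f z (totalField b z)) z (fibreVec (i, Λ))) φ z =
      ((∑ l, (totalDeriv l (β l Λ) + shiftFamily l (β l) Λ)) +
        (-1 : ℝ) • funSmul (fun z => lineDeriv ℝ f z (fibreVec (i, Λ)))
        (∑ l, totalDeriv l (funSmul (fun z => b l z.1) φ))) z := by
    filter_upwards [hf.eventually, eventually_all.2 fun l => (hb l).eventually,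
      hφ.eventually] with z hfz hbz hφz Λ
    have hfz' := hfz.lineDeriv_const (fibreVec (i, Λ))
    have h1 : lineDeriv ℝ (fun z => lineDeriv ℝ f z (totalField b z)) z (fibreVec (i, Λ)) =
        ∑ l, b l z.1 * (lineDeriv ℝ (fun z => lineDeriv ℝ f z (fibreVec (i, Λ))) z (totalVec l z) +
          lineDeriv ℝ f z (shiftVec l (fibreVec (i, Λ)))) := by
      rw [lineDeriv_lineDeriv_field hfz (finiteOrderMapAt_totalField hbz),
        mapDeriv_totalField hbz, totalField, hfz'.lineDeriv_sum_vec, hfz.lineDeriv_sum_vec,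
        ← Finset.sum_add_distrib]
      refine Finset.sum_congr rfl fun l _ => ?_
      rw [lineDeriv_of_fst_eq_zero (b l) z rfl, zero_smul, zero_add, lineDeriv_smul,
        lineDeriv_smul, smul_eq_mul, smul_eq_mul]
      ring
    have h2 : ∀ l, shiftFamily l (β l) Λ z =
        (lineDeriv ℝ f z (shiftVec l (fibreVec (i, Λ))) * b l z.1) • φ z := by
      intro l
      rw [shiftFamily, shiftVec_fibreVec]
      split_ifs
      · rw [lineDeriv_zero, zero_mul, zero_smul]; rfl
      · simp only [β, funSmul, smul_smul]
    have h3 : ∀ l, totalDeriv l (β l Λ) z =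
        (lineDeriv ℝ (fun z => lineDeriv ℝ f z (fibreVec (i, Λ))) z (totalVec l z) * b l z.1) •
          φ z +
        lineDeriv ℝ f z (fibreVec (i, Λ)) • totalDeriv l (funSmul (fun z => b l z.1) φ) z := by
      intro l
      rw [totalDeriv_funSmul hfz' (.funSmul (hbz l) hφz)]
      simp only [funSmul, smul_smul]
    rw [Pi.add_apply, Finset.sum_apply, Pi.smul_apply]
    simp only [Pi.add_apply, h2, h3, funSmul, h1, Finset.sum_apply]
    funext v
    simp only [Pi.add_apply, Pi.smul_apply, Finset.sum_apply, smul_eq_mul, Finset.sum_mul,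
      Finset.sum_add_distrib, Finset.mul_sum, add_mul, mul_add]
    simp only [neg_mul, one_mul, Finset.sum_neg_distrib]
    have h4 : ∀ l, b l z.1 * lineDeriv ℝ f z (shiftVec l (fibreVec (i, Λ))) * φ z v =
      lineDeriv ℝ f z (shiftVec l (fibreVec (i, Λ))) * b l z.1 * φ z v := fun l => by ring
    have h5 : ∀ l, b l z.1 * lineDeriv ℝ (fun z => lineDeriv ℝ f z (fibreVec (i, Λ))) z
        (totalVec l z) * φ z v = lineDeriv ℝ (fun z => lineDeriv ℝ f z (fibreVec (i, Λ))) z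
        (totalVec l z) * b l z.1 * φ z v := fun l => by ring
    simp only [h4, h5]
    ring
  have hsum : IsFinFamilyAt (fun Λ => ∑ l, (totalDeriv l (β l Λ) + shiftFamily l (β l) Λ)) z₀ :=
    .sum fun l _ => ((hβ l).totalDeriv l).add ((hβ l).shiftFamily l)
  refine (eulerSum_congr key).trans ((eulerSum_add hsum (hγ.const_smul _)).trans ?_)
  refine (EventuallyEq.add (eulerSum_sum fun l _ => ((hβ l).totalDeriv l).add
    ((hβ l).shiftFamily l)) (eulerSum_const_smul hγ _)).trans ?_
  refine ((eventuallyEq_sum (g := fun _ => 0) fun l _ =>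
    eulerSum_totalDeriv_add_shiftFamily (hβ l) l).add EventuallyEq.rfl).trans ?_
  rw [Finset.sum_const_zero, zero_add]

namespace IsJetTransitionAt

theorem formPullback_smul (c : ℝ) (φ : ModelForm n m p) :
    formPullback T (c • φ) = c • formPullback T φ := rfl

/-- The adjoint of the linearisation of the new coordinate `y^j_M`, applied to a form of maximal
horizontal degree: by induction on `M`, since the new coordinate of index `μ + M` is the derivative
of the one of index `M` along `B_μ^λ d_λ`. -/
theorem eulerSum_coordinate (h : IsJetTransitionAt T B z₀) {k : ℕ} (hp : p = k + n)
    {φ : ModelForm n m p} (hφ : FiniteOrderFormAt φ (T z₀)) (hk : HasContactDegreeAt k φ (T z₀))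
    (i j : Fin m) (M : MultiIndex n) :
    eulerSum (fun Λ => funSmul (fun z => (mapDeriv T z (fibreVec (i, Λ))).2 (j, M))
        (formPullback T φ)) =ᶠ[𝓝 z₀]
      funSmul (fun z => (mapDeriv T z (fibreVec (i, 0))).2 (j, 0))
        (formPullback T ((-1 : ℝ) ^ M.len • iterOp totalDeriv M φ)) := by
  have hT := h.finiteOrder.self_of_nhds
  induction M using MultiIndex.induction generalizing φ with
  | h0 =>
    -- only `Λ = 0` contributes, as the new coordinates of order zero depend on no others
    have hz : ∀ᶠ z in 𝓝 z₀, ∀ Λ ∉ ({0} : Finset (MultiIndex n)),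
        funSmul (fun z => (mapDeriv T z (fibreVec (i, Λ))).2 (j, 0)) (formPullback T φ) z = 0 := by
      refine h.orderZero.mono fun z hz Λ hΛ => ?_
      rw [funSmul, hz _ rfl j, Finset.sum_eq_zero fun i' _ => ?_, zero_smul]
      have : (i', (0 : MultiIndex n)) ≠ (i, Λ) := fun e =>
        hΛ (Finset.mem_singleton.2 (Prod.ext_iff.1 e).2.symm)
      simp [fibreVec, this]
    refine (eulerSum_eq_sum hz).trans ?_
    simp only [Finset.sum_singleton, MultiIndex.len_zero, pow_zero, one_smul, iterOp_zero]
    rfl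
  | h M μ ih =>
    have hf := hT.2 (j, M)
    have hφT := hφ.pullback h.finiteOrder
    have h1 : ∀ᶠ z in 𝓝 z₀, ∀ Λ,
        funSmul (fun z => (mapDeriv T z (fibreVec (i, Λ))).2 (j, M.cons μ)) (formPullback T φ) z =
        funSmul (fun z => lineDeriv ℝ (fun z => lineDeriv ℝ (fun z => (T z).2 (j, M)) z
          (totalField (B μ) z)) z (fibreVec (i, Λ))) (formPullback T φ) z := by
      refine h.totalVec_eq.eventually_nhds.mono fun z hz Λ => ?_
      have e : (fun z => (T z).2 (j, M.cons μ)) =ᶠ[𝓝 z]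
          fun z => lineDeriv ℝ (fun z => (T z).2 (j, M)) z (totalField (B μ) z) :=
        hz.mono fun z' hz' => (congrFun (congrArg Prod.snd (hz' μ)) (j, M)).symm
      simp only [funSmul, mapDeriv]
      rw [lineDeriv_congr_nhds e]
    refine (eulerSum_congr h1).trans
      ((eulerSum_linearisation hf (h.coeff μ) hφT i).trans ?_)
    have h2 := h.formPullback_totalDeriv hp hφ hk μ
    have h3 := ih (hφ.totalDeriv μ) (hk.totalDeriv hφ μ)
    have h4 : eulerSum (fun Λ => funSmul (fun z => lineDeriv ℝ (fun z => (T z).2 (j, M)) z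
          (fibreVec (i, Λ))) (∑ l, totalDeriv l (funSmul (fun z => B μ l z.1) (formPullback T φ))))
        =ᶠ[𝓝 z₀] eulerSum (fun Λ => funSmul (fun z => (mapDeriv T z (fibreVec (i, Λ))).2 (j, M))
          (formPullback T (totalDeriv μ φ))) :=
      eulerSum_congr (h2.mono fun z hz Λ => by rw [funSmul, funSmul, hz]; rfl)
    refine (EventuallyEq.smul_form (h4.trans h3) _).trans ?_
    have h5 := formPullback_congr hT (iterOp_totalDeriv_cons' hφ M μ)
    refine h5.mono fun z hz => ?_
    simp only [formPullback_smul, Pi.smul_apply, funSmul, MultiIndex.len_cons, hz, pow_succ,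
      smul_smul]
    congr 1
    ring

/-- The interior Euler operators in two coordinate systems differ by the Jacobian `∂y'^j/∂y^i` of
the fibre coordinates: the components `∂y'^j_M/∂y^i_Λ` of positive order are integrated by parts. -/
theorem eulerOp_formPullback (h : IsJetTransitionAt T B z₀) {k : ℕ} (hp : p = k + n)
    {φ : ModelForm n m (p + 1)} (hφ : FiniteOrderFormAt φ (T z₀))
    (hk : HasContactDegreeAt (k + 1) φ (T z₀)) (i : Fin m) :
    eulerOp i (formPullback T φ) =ᶠ[𝓝 z₀]
      ∑ j, funSmul (fun z => (mapDeriv T z (fibreVec (i, 0))).2 (j, 0))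
        (formPullback T (eulerOp j φ)) := by
  classical
  have hT := h.finiteOrder.self_of_nhds
  obtain ⟨S, hS⟩ := hφ.exists_interiorDy_eq_zero
  let L := S.image Prod.snd
  have hSL : S ⊆ Finset.univ ×ˢ L := fun a ha =>
    Finset.mem_product.2 ⟨Finset.mem_univ _, Finset.mem_image_of_mem _ ha⟩
  have hI : ∀ a : Fin m × MultiIndex n, FiniteOrderFormAt (interiorDy a.1 a.2 φ) (T z₀) :=
    fun a => hφ.interiorDy a.1 a.2
  have hIk : ∀ a : Fin m × MultiIndex n, HasContactDegreeAt k (interiorDy a.1 a.2 φ) (T z₀) :=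
    fun a => by simpa using hk.interiorDy a.1 a.2
  have h1 : ∀ᶠ z in 𝓝 z₀, ∀ Λ, interiorDy i Λ (formPullback T φ) z =
      (∑ a ∈ Finset.univ ×ˢ L, funSmul (fun z => (mapDeriv T z (fibreVec (i, Λ))).2 a)
        (formPullback T (interiorDy a.1 a.2 φ))) z := by
    filter_upwards [hT.continuousAt.eventually hS, h.vertical] with z hz hv Λ
    funext v
    rw [interiorDy_apply, Finset.sum_apply, Finset.sum_apply]
    have e : (fun l => mapDeriv T z ((Fin.cons (fibreVec (i, Λ)) v : Fin (p + 1) → Model n m) l)) =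
        Fin.cons (mapDeriv T z (fibreVec (i, Λ))) fun l => mapDeriv T z (v l) := by
      funext l
      refine Fin.cases rfl (fun l => ?_) l
      simp
    rw [formPullback, e, (hz.2.1.mono hSL).cons_eq_sum hz.1 _ (hv _ rfl)]
    refine Finset.sum_congr rfl fun a _ => ?_
    simp only [funSmul, Pi.smul_apply, smul_eq_mul, formPullback, interiorDy_apply]
  refine (eulerSum_congr h1).trans ((eulerSum_sum fun a _ =>
    isFinFamilyAt_funSmul (hT.2 a) ((hI a).pullback h.finiteOrder) i).trans ?_)
  refine (eventuallyEq_sum fun a _ =>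
    h.eulerSum_coordinate hp (hI a) (hIk a) i a.1 a.2).trans ?_
  rw [Finset.sum_product]
  refine eventuallyEq_sum fun j _ => ?_
  have h2 : ∀ᶠ z in 𝓝 (T z₀), ∀ Λ ∉ L, interiorDy j Λ φ z = 0 :=
    hS.mono fun z hz Λ hΛ => hz.2.2 (j, Λ) fun hmem => hΛ (Finset.mem_image_of_mem Prod.snd hmem)
  refine EventuallyEq.trans ?_ (funSmul_congr (formPullback_congr hT (eulerSum_eq_sum h2))).symm
  refine Eventually.of_forall fun z => ?_
  funext v
  simp only [Finset.sum_apply, funSmul, Pi.smul_apply, formPullback, smul_eq_mul, Finset.mul_sum]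

/-- The operator `τ̄` does not depend on the coordinates. -/
theorem tauBar_formPullback (h : IsJetTransitionAt T B z₀) {k : ℕ} (hp : p = k + n)
    {φ : ModelForm n m (p + 1)} (hφ : FiniteOrderFormAt φ (T z₀))
    (hk : HasContactDegreeAt (k + 1) φ (T z₀)) :
    tauBar (formPullback T φ) =ᶠ[𝓝 z₀] formPullback T (tauBar φ) := by
  have hT := h.finiteOrder.self_of_nhds
  refine (tauBar_eq_sum_eulerOp (hφ.pullback h.finiteOrder)).trans (EventuallyEq.trans ?_
    (formPullback_congr hT (tauBar_eq_sum_eulerOp hφ)).symm)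
  refine (eventuallyEq_sum fun i _ => wedgeOne_congr
    (h.eulerOp_formPullback hp hφ hk i)).trans ?_
  filter_upwards [h.eventually] with z hz
  have hθ : ∀ j v, contactForm j 0 (T z) (mapDeriv T z v) =
      ∑ i, (mapDeriv T z (fibreVec (i, 0))).2 (j, 0) * contactForm i 0 z v := by
    intro j v
    have e1 := vertPart_snd (T z) (mapDeriv T z v) (j, 0)
    rw [← e1, hz.vertPart_mapDeriv, hz.orderZero.self_of_nhds _ (vertPart_fst z v) j]
    simp only [vertPart_snd]
  funext v
  simp only [Finset.sum_apply, formPullback, wedgeOne, funSmul, Pi.smul_apply, smul_eq_mul, hθ,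
    Finset.mul_sum, Finset.sum_mul]
  rw [Finset.sum_comm]
  refine Eq.trans (Finset.sum_congr rfl fun l _ => Finset.sum_comm) ?_
  rw [Finset.sum_comm]
  refine Finset.sum_congr rfl fun j _ => Finset.sum_congr rfl fun l _ =>
    Finset.sum_congr rfl fun i _ => ?_
  ring

end IsJetTransitionAt

end Invariance

/-! ### Jets of functions of several variables -/

section Partial

variable {n m : ℕ}

/-- The partial derivative `∂_λ f` of a function of `n` real variables. -/
def partialD (l : Fin n) (f : (Fin n → ℝ) → ℝ) (x : Fin n → ℝ) : ℝ :=
  fderiv ℝ f x (Pi.single l 1)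

theorem partialD_congr {l : Fin n} {f g : (Fin n → ℝ) → ℝ} {x : Fin n → ℝ} (h : f =ᶠ[𝓝 x] g) :
    partialD l f =ᶠ[𝓝 x] partialD l g :=
  h.eventuallyEq_nhds.mono fun y hy => by rw [partialD, partialD, hy.fderiv_eq]

theorem ContDiffAt.partialD {f : (Fin n → ℝ) → ℝ} {x : Fin n → ℝ} (hf : ContDiffAt ℝ ∞ f x)
    (l : Fin n) : ContDiffAt ℝ ∞ (partialD l f) x :=
  (hf.fderiv_right (m := ∞) (by simp)).clm_apply contDiffAt_const

theorem partialD_comm {f : (Fin n → ℝ) → ℝ} {x : Fin n → ℝ} (hf : ContDiffAt ℝ ∞ f x)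
    (l l' : Fin n) : partialD l (partialD l' f) x = partialD l' (partialD l f) x := by
  have h1 : DifferentiableAt ℝ (fderiv ℝ f) x :=
    (hf.fderiv_right (m := ∞) (by simp)).differentiableAt (by simp)
  have key : ∀ l l', partialD l (partialD l' f) x =
      fderiv ℝ (fderiv ℝ f) x (Pi.single l 1) (Pi.single l' 1) := by
    intro l l'
    have := (h1.hasFDerivAt.clm_apply (hasFDerivAt_const (Pi.single l' 1 : Fin n → ℝ) x)).fderiv
    have h2 : partialD l' f = fun y => fderiv ℝ f y (Pi.single l' 1) := rfl
    rw [_root_.partialD, h2, this]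
    simp
  have hsymm := hf.isSymmSndFDerivAt (by simpa using WithTop.coe_le_coe.2 (le_top (a := (2 : ℕ∞))))
  rw [key, key, hsymm.eq]

/-- The smooth functions near `x`. -/
def SmoothNear (x : Fin n → ℝ) (f : (Fin n → ℝ) → ℝ) : Prop := ∀ᶠ y in 𝓝 x, ContDiffAt ℝ ∞ f y

theorem SmoothNear.iterOp {f : (Fin n → ℝ) → ℝ} {x : Fin n → ℝ} (hf : SmoothNear x f)
    (Λ : MultiIndex n) : SmoothNear x (iterOp _root_.partialD Λ f) :=
  iterOp_rel (D' := fun _ (b : Unit) => b) (fun f _ => SmoothNear x f)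
    (fun l _ _ h => h.mono fun _ hy => hy.partialD l) Λ (b := ()) hf

theorem iterOp_partialD_cons {f : (Fin n → ℝ) → ℝ} {x : Fin n → ℝ} (hf : SmoothNear x f)
    (Λ : MultiIndex n) (l : Fin n) :
    iterOp partialD (Λ.cons l) f =ᶠ[𝓝 x] partialD l (iterOp partialD Λ f) :=
  (iterOp_cons (r := fun f g => f =ᶠ[𝓝 x] g)
    ⟨fun _ => EventuallyEq.rfl, fun h => h.symm, fun h h' => h.trans h'⟩
    (P := SmoothNear x) (fun l _ h => h.mono fun _ hy => hy.partialD l)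
    (fun _ _ _ _ _ h => partialD_congr h)
    (fun l l' _ h => h.mono fun _ hy => partialD_comm hy l l') Λ l hf).1

theorem iterOp_partialD_congr {f g : (Fin n → ℝ) → ℝ} {x : Fin n → ℝ} (h : f =ᶠ[𝓝 x] g)
    (Λ : MultiIndex n) : iterOp partialD Λ f =ᶠ[𝓝 x] iterOp partialD Λ g :=
  iterOp_rel (D := partialD) (D' := partialD) (fun f g => f =ᶠ[𝓝 x] g)
    (fun _ _ _ h => partialD_congr h) Λ h

/-- The infinite jet prolongation of `m` functions of `n` variables. -/
def jetMap (f : Fin m → (Fin n → ℝ) → ℝ) (x : Fin n → ℝ) : Model n m :=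
  (x, fun a => iterOp partialD a.2 (f a.1) x)

/-- The velocity of a prolonged curve is a combination of the total derivatives. -/
theorem hasCurveDeriv_jetMap {f : Fin m → (Fin n → ℝ) → ℝ} {γ : ℝ → Fin n → ℝ} {w : Fin n → ℝ}
    {t : ℝ} (hf : ∀ i, SmoothNear (γ t) (f i)) (hγ : HasDerivAt γ w t) :
    HasCurveDeriv (fun s => jetMap f (γ s)) (∑ l, w l • totalVec l (jetMap f (γ t))) t := by
  constructor
  · intro l
    have e : (∑ l, w l • totalVec l (jetMap f (γ t))).1 l = w l := by
      simp [Prod.fst_sum, totalVec, Pi.single_apply]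
    rw [e]
    exact hasDerivAt_pi.1 hγ l
  · intro a
    have h1 : SmoothNear (γ t) (iterOp partialD a.2 (f a.1)) := (hf a.1).iterOp a.2
    have h2 := (h1.self_of_nhds.differentiableAt (by simp)).hasFDerivAt.comp_hasDerivAt t hγ
    have e : (∑ l, w l • totalVec l (jetMap f (γ t))).2 a =
        fderiv ℝ (iterOp partialD a.2 (f a.1)) (γ t) w := by
      have hw : w = ∑ l, w l • (Pi.single l 1 : Fin n → ℝ) := by
        funext l; simp [Pi.single_apply]
      conv_rhs => rw [hw]
      simp only [map_sum, map_smul, Prod.snd_sum, Finset.sum_apply, Prod.smul_snd, Pi.smul_apply]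
      refine Finset.sum_congr rfl fun l _ => congrArg _ ?_
      exact (iterOp_partialD_cons (hf a.1) a.2 l).self_of_nhds
    rw [e]
    exact h2

/-- Near a point of the model, a property only involves finitely many coordinates. -/
theorem exists_order_of_eventually {z : Model n m} {P : Model n m → Prop}
    (h : ∀ᶠ z' in 𝓝 z, P z') : ∃ r : ℕ, ∀ z' : Model n m, z'.1 = z.1 →
      (∀ a : Fin m × MultiIndex n, a.2.len ≤ r → z'.2 a = z.2 a) → P z' := by
  by_contra hc
  push Not at hc
  choose y hy1 hy2 hy3 using hc
  have ht : Tendsto y atTop (𝓝 z) := by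
    refine Prod.tendsto_iff _ _ |>.2 ⟨?_, tendsto_pi_nhds.2 fun a => ?_⟩
    · exact tendsto_const_nhds.congr fun r => (hy1 r).symm
    · refine tendsto_const_nhds.congr' ?_
      filter_upwards [eventually_ge_atTop a.2.len] with r hr using (hy2 r a hr).symm
  obtain ⟨r, hr⟩ := (ht.eventually h).exists
  exact hy3 r hr

/-- A property which is weakened by one step at every application of an operator. -/
theorem iterOp_count {A : Type*} {D : Fin n → A → A} (P : ℕ → A → Prop)
    (h : ∀ l k a, P k a → P (k + 1) (D l a)) (Λ : MultiIndex n) {a : A} (ha : P 0 a) :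
    P Λ.len (iterOp D Λ a) := by
  have hit : ∀ l (j k : ℕ) a, P k a → P (k + j) ((D l)^[j] a) := by
    intro l j
    induction j with
    | zero => exact fun k a h => h
    | succ j ih =>
      intro k a hk
      have := ih _ _ (h l k a hk)
      rwa [add_assoc, add_comm 1 j] at this
  rw [iterOp_eq_foldr, MultiIndex.len, Fin.sum_univ_def]
  generalize List.finRange n = L
  induction L with
  | nil => exact ha
  | cons l L ih =>
    rw [List.map_cons, List.sum_cons, add_comm]
    exact hit _ _ _ _ ih

end Partial

/-! ### Polynomials with prescribed jets -/

section Polynomial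

variable {n : ℕ}

/-- The monomial `(x - x₀)^Λ / Λ!`. -/
def dividedMonomial (x₀ : Fin n → ℝ) (Λ : MultiIndex n) (x : Fin n → ℝ) : ℝ :=
  ∏ l, (x l - x₀ l) ^ Λ l / (Λ l).factorial

theorem contDiff_dividedMonomial (x₀ : Fin n → ℝ) (Λ : MultiIndex n) :
    ContDiff ℝ ∞ (dividedMonomial x₀ Λ) := by
  unfold dividedMonomial
  fun_prop

theorem partialD_dividedMonomial (x₀ : Fin n → ℝ) (Λ : MultiIndex n) (l : Fin n)
    (x : Fin n → ℝ) : partialD l (dividedMonomial x₀ Λ) x =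
      if Λ l = 0 then 0 else dividedMonomial x₀ (Λ - Pi.single l 1) x := by
  have hd := (contDiff_dividedMonomial x₀ Λ).differentiable (by simp) x
  rw [partialD, ← hd.lineDeriv_eq_fderiv, lineDeriv]
  have e : ∀ t : ℝ, dividedMonomial x₀ Λ (x + t • Pi.single l 1) =
      ((x l - x₀ l + t) ^ Λ l / (Λ l).factorial) *
        ∏ l' ∈ Finset.univ.erase l, (x l' - x₀ l') ^ Λ l' / (Λ l').factorial := by
    intro t
    rw [dividedMonomial, ← Finset.mul_prod_erase _ _ (Finset.mem_univ l)]
    congr 1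
    · simp only [Pi.add_apply, Pi.smul_apply, Pi.single_eq_same, smul_eq_mul, mul_one]
      congr 2
      ring
    · refine Finset.prod_congr rfl fun l' hl' => ?_
      simp [Finset.ne_of_mem_erase hl']
  simp only [e]
  have h1 : HasDerivAt (fun t : ℝ => (x l - x₀ l + t) ^ Λ l / (Λ l).factorial)
      ((Λ l : ℝ) * (x l - x₀ l + 0) ^ (Λ l - 1) * 1 / (Λ l).factorial) 0 :=
    (((hasDerivAt_id (0 : ℝ)).const_add (x l - x₀ l)).fun_pow (Λ l)).div_const _
  rw [(h1.mul_const _).deriv]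
  split_ifs with h0
  · simp [h0]
  · obtain ⟨k, hk⟩ := Nat.exists_eq_succ_of_ne_zero h0
    rw [dividedMonomial, ← Finset.mul_prod_erase _ _ (Finset.mem_univ l)]
    congr 1
    · simp only [hk, Pi.sub_apply, Pi.single_eq_same, Nat.succ_eq_add_one, Nat.add_sub_cancel,
        Nat.factorial_succ, Nat.cast_mul, add_zero, mul_one]
      field_simp
    · refine Finset.prod_congr rfl fun l' hl' => ?_
      simp [Finset.ne_of_mem_erase hl']

theorem dividedMonomial_self (x₀ : Fin n → ℝ) (Λ : MultiIndex n) :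
    dividedMonomial x₀ Λ x₀ = if Λ = 0 then 1 else 0 := by
  split_ifs with h
  · simp [dividedMonomial, h]
  · obtain ⟨l, hl⟩ := Function.ne_iff.1 h
    exact Finset.prod_eq_zero (Finset.mem_univ l) (by simp [zero_pow hl])

/-- The polynomial with the derivatives `a Λ` at `x₀`, for a finitely supported family `a`. -/
def jetPolynomial (x₀ : Fin n → ℝ) (a : MultiIndex n → ℝ) (x : Fin n → ℝ) : ℝ :=
  ∑ᶠ Λ, a Λ * dividedMonomial x₀ Λ x

theorem jetPolynomial_eq_sum {x₀ : Fin n → ℝ} {a : MultiIndex n → ℝ} {s : Finset (MultiIndex n)}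
    (h : ∀ Λ ∉ s, a Λ = 0) :
    jetPolynomial x₀ a = fun x => ∑ Λ ∈ s, a Λ * dividedMonomial x₀ Λ x := by
  funext x
  refine finsum_eq_sum_of_support_subset _ fun Λ hΛ => ?_
  by_contra hc
  exact hΛ (by simp [h Λ hc])

theorem contDiff_jetPolynomial (x₀ : Fin n → ℝ) {a : MultiIndex n → ℝ}
    (ha : a.support.Finite) : ContDiff ℝ ∞ (jetPolynomial x₀ a) := by
  rw [jetPolynomial_eq_sum (s := ha.toFinset) fun Λ hΛ => by simpa using hΛ]
  exact ContDiff.sum fun Λ _ => contDiff_const.mul (contDiff_dividedMonomial x₀ Λ)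

theorem jetPolynomial_self (x₀ : Fin n → ℝ) (a : MultiIndex n → ℝ) :
    jetPolynomial x₀ a x₀ = a 0 := by
  rw [jetPolynomial, finsum_eq_single _ 0]
  · simp [dividedMonomial_self]
  · intro Λ hΛ
    simp [dividedMonomial_self, hΛ]

theorem finite_support_cons {a : MultiIndex n → ℝ} (ha : a.support.Finite) (l : Fin n) :
    (Function.support fun Λ : MultiIndex n => a (Λ.cons l)).Finite :=
  ha.preimage (MultiIndex.cons_injective l).injOn

theorem partialD_jetPolynomial (x₀ : Fin n → ℝ) {a : MultiIndex n → ℝ} (ha : a.support.Finite)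
    (l : Fin n) :
    partialD l (jetPolynomial x₀ a) = jetPolynomial x₀ fun Λ => a (Λ.cons l) := by
  funext x
  have h0 : ∀ Λ ∉ ha.toFinset, a Λ = 0 := fun Λ hΛ => by simpa using hΛ
  rw [jetPolynomial_eq_sum h0, partialD, fderiv_fun_sum fun Λ _ =>
    ((contDiff_dividedMonomial x₀ Λ).differentiable (by simp) x).const_mul _]
  have h1 : ∀ Λ, fderiv ℝ (fun x => a Λ * dividedMonomial x₀ Λ x) x (Pi.single l 1) =
      a Λ * if Λ l = 0 then 0 else dividedMonomial x₀ (Λ - Pi.single l 1) x := by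
    intro Λ
    rw [← partialD_dividedMonomial, fderiv_const_mul
      ((contDiff_dividedMonomial x₀ Λ).differentiable (by simp) x)]
    rfl
  rw [sum_apply]
  simp only [h1]
  classical
  rw [jetPolynomial_eq_sum (s := (finite_support_cons ha l).toFinset) fun Λ hΛ => by simpa using hΛ]
  symm
  refine Finset.sum_of_injOn (fun Λ => Λ.cons l) (MultiIndex.cons_injective l).injOn ?_ ?_ ?_
  · intro Λ hΛ
    simpa using hΛ
  · intro Λ hΛ hn
    rw [if_pos, mul_zero]
    by_contra hl
    refine hn ⟨Λ - Pi.single l 1, ?_, MultiIndex.sub_cons hl⟩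
    simpa [MultiIndex.sub_cons hl] using hΛ
  · intro Λ _
    rw [if_neg (Λ.cons_apply_ne_zero l), MultiIndex.cons_sub]

theorem iterOp_shift (Λ : MultiIndex n) (a : MultiIndex n → ℝ) :
    iterOp (fun l (a : MultiIndex n → ℝ) M => a (M.cons l)) Λ a = fun M => a (M + Λ) := by
  induction Λ using MultiIndex.induction with
  | h0 => rw [iterOp_zero]; rfl
  | h Λ l ih =>
    rw [(iterOp_cons (r := Eq) ⟨fun _ => rfl, Eq.symm, Eq.trans⟩ (P := fun _ => True)
      (fun _ _ _ => trivial) (fun _ _ _ _ _ h => by rw [h])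
      (fun l l' a _ => funext fun M => congrArg a (MultiIndex.cons_comm M l l')) Λ l
      (a := a) trivial).1, ih]
    funext M
    refine congrArg a ?_
    simp only [MultiIndex.cons]
    abel

theorem iterOp_partialD_jetPolynomial (x₀ : Fin n → ℝ) {a : MultiIndex n → ℝ}
    (ha : a.support.Finite) (Λ : MultiIndex n) :
    iterOp partialD Λ (jetPolynomial x₀ a) x₀ = a Λ := by
  have h := iterOp_rel (D := partialD) (D' := fun l (a : MultiIndex n → ℝ) M => a (M.cons l))
    (fun f b => b.support.Finite ∧ f = jetPolynomial x₀ b)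
    (fun l f b h => ⟨finite_support_cons h.1 l, by rw [h.2, partialD_jetPolynomial x₀ h.1]⟩)
    Λ (a := jetPolynomial x₀ a) (b := a) ⟨ha, rfl⟩
  rw [h.2, jetPolynomial_self, iterOp_shift]
  simp

end Polynomial

/-! ### Changes of bundle coordinates -/

section Charts

variable {n m : ℕ} {X Y : Type u}
  [TopologicalSpace X] [ChartedSpace (EuclideanSpace ℝ (Fin n)) X]
  [TopologicalSpace Y] [ChartedSpace (EuclideanSpace ℝ (Fin (n + m))) Y] {π : Y → X}

namespace BundleChart

variable (c c' : BundleChart n m π)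

theorem symm_mem_source {w : (Fin n → ℝ) × (Fin m → ℝ)} (hw : w ∈ c.total.target) :
    c.total.symm w ∈ c.total.source := c.total.map_target hw

theorem base_symm_eq {w : (Fin n → ℝ) × (Fin m → ℝ)} (hw : w ∈ c.total.target) :
    w.1 ∈ c.base.target ∧ c.base.symm w.1 = π (c.total.symm w) := by
  have h1 := c.symm_mem_source hw
  have h2 := c.fst_total _ h1
  rw [c.total.right_inv hw] at h2
  have h3 := c.mapsTo _ h1
  rw [h2]
  exact ⟨c.base.map_source h3, c.base.left_inv h3⟩

/-- The change of the base coordinates. -/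
def changeBase (x : Fin n → ℝ) : Fin n → ℝ := c'.base (c.base.symm x)

/-- The change of the fibre coordinates. -/
def changeFibre (w : (Fin n → ℝ) × (Fin m → ℝ)) : Fin m → ℝ := (c'.total (c.total.symm w)).2

/-- The image in the chart `c` of the intersection of two chart domains. -/
def overlap : Set ((Fin n → ℝ) × (Fin m → ℝ)) :=
  c.total.target ∩ c.total.symm ⁻¹' c'.total.source

theorem isOpen_overlap : IsOpen (c.overlap c') :=
  c.total.symm.continuousOn.isOpen_inter_preimage c.total.open_target c'.total.open_source

theorem contDiffOn_changeFibre : ContDiffOn ℝ ∞ (c.changeFibre c') (c.overlap c') := by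
  have h : ContMDiffOn 𝓘(ℝ, (Fin n → ℝ) × (Fin m → ℝ)) 𝓘(ℝ, (Fin n → ℝ) × (Fin m → ℝ)) ∞
      (c'.total ∘ c.total.symm) (c.overlap c') :=
    c'.contMDiffOn_total.comp (c.contMDiffOn_total_symm.mono inter_subset_left) fun _ h => h.2
  exact (contMDiffOn_iff_contDiffOn.1 h).snd

/-- The image in `c.base` of the intersection of the base chart domains. -/
def baseOverlap : Set (Fin n → ℝ) := c.base.target ∩ c.base.symm ⁻¹' c'.base.source

theorem isOpen_baseOverlap : IsOpen (c.baseOverlap c') :=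
  c.base.symm.continuousOn.isOpen_inter_preimage c.base.open_target c'.base.open_source

theorem contDiffOn_changeBase : ContDiffOn ℝ ∞ (c.changeBase c') (c.baseOverlap c') := by
  have h : ContMDiffOn 𝓘(ℝ, Fin n → ℝ) 𝓘(ℝ, Fin n → ℝ) ∞
      (c'.base ∘ c.base.symm) (c.baseOverlap c') :=
    c'.contMDiffOn_base.comp (c.contMDiffOn_base_symm.mono inter_subset_left) fun _ h => h.2
  exact contMDiffOn_iff_contDiffOn.1 h

theorem fst_mem_baseOverlap {w : (Fin n → ℝ) × (Fin m → ℝ)} (hw : w ∈ c.overlap c') :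
    w.1 ∈ c.baseOverlap c' := by
  obtain ⟨h1, h2⟩ := c.base_symm_eq hw.1
  exact ⟨h1, by rw [mem_preimage, h2]; exact c'.mapsTo _ hw.2⟩

theorem changeBase_mem {x : Fin n → ℝ} (hx : x ∈ c.baseOverlap c') :
    c.changeBase c' x ∈ c'.baseOverlap c ∧ c'.changeBase c (c.changeBase c' x) = x := by
  have h := c'.base.left_inv hx.2
  refine ⟨⟨c'.base.map_source hx.2, ?_⟩, ?_⟩
  · rw [mem_preimage, changeBase, h]
    exact c.base.map_target hx.1
  · rw [changeBase, changeBase, h, c.base.right_inv hx.1]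

/-- The coefficients of the new coordinate fields `∂'_μ` on the base in the old ones, that is the
derivatives of the old base coordinates along the new ones. -/
def fieldCoeff (μ l : Fin n) (x : Fin n → ℝ) : ℝ :=
  partialD μ (fun x' => c'.changeBase c x' l) (c.changeBase c' x)

theorem contDiffOn_fieldCoeff (μ l : Fin n) :
    ContDiffOn ℝ ∞ (c.fieldCoeff c' μ l) (c.baseOverlap c') := by
  have h1 : ContDiffOn ℝ ∞ (fun x' => c'.changeBase c x' l) (c'.baseOverlap c) :=
    contDiffOn_pi.1 (c'.contDiffOn_changeBase c) l
  have h2 : ContDiffOn ℝ ∞ (partialD μ fun x' => c'.changeBase c x' l) (c'.baseOverlap c) :=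
    (h1.fderiv_of_isOpen (c'.isOpen_baseOverlap c) (by simp)).clm_apply contDiffOn_const
  exact h2.comp (c.contDiffOn_changeBase c') fun x hx => (c.changeBase_mem c' hx).1

end BundleChart

/-- The derivation `∑ B_μ^λ d_λ` of the functions on the model. -/
def fieldDeriv (B : Fin n → Fin n → (Fin n → ℝ) → ℝ) (μ : Fin n) (f : Model n m → ℝ)
    (z : Model n m) : ℝ := lineDeriv ℝ f z (totalField (B μ) z)

/-- The coordinates `(x^λ, y^i)` of order zero. -/
def orderZero (z : Model n m) : (Fin n → ℝ) × (Fin m → ℝ) := (z.1, fun i => z.2 (i, 0))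

theorem continuous_orderZero : Continuous (orderZero (n := n) (m := m)) := by
  unfold orderZero; fun_prop

namespace BundleChart

variable (c c' : BundleChart n m π)

/-- The new fibre coordinate `y^j_Λ` as a function of the old coordinates. -/
def changeJet (a : Fin m × MultiIndex n) : Model n m → ℝ :=
  iterOp (fieldDeriv (c.fieldCoeff c')) a.2 fun z => c.changeFibre c' (orderZero z) a.1

/-- The change of jet coordinates. -/
def change (z : Model n m) : Model n m := (c.changeBase c' z.1, fun a => c.changeJet c' a z)

theorem isOpen_preimage_overlap : IsOpen (orderZero ⁻¹' c.overlap c') :=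
  (c.isOpen_overlap c').preimage continuous_orderZero

variable {c c'} {z : Model n m} (hz : orderZero z ∈ c.overlap c')

include hz

theorem finiteOrderAt_fieldCoeff (μ l : Fin n) :
    FiniteOrderAt (fun z : Model n m => c.fieldCoeff c' μ l z.1) z :=
  .of_fst (c.isOpen_baseOverlap c') (c.fst_mem_baseOverlap c' hz) (c.contDiffOn_fieldCoeff c' μ l)

theorem finiteOrderAt_changeJet_zero (j : Fin m) :
    FiniteOrderAt (fun z => c.changeFibre c' (orderZero z) j) z := by
  have h1 : FiniteOrderAt (orderZero (n := n) (m := m)) z :=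
    (FiniteOrderAt.pi (finiteOrderAt_fst z)).prodMk
      (FiniteOrderAt.pi fun i => finiteOrderAt_snd z (i, 0))
  exact h1.comp (g := fun w => c.changeFibre c' w j) (c.isOpen_overlap c')
    (contDiffOn_pi.1 (c.contDiffOn_changeFibre c') j) hz

omit hz in
theorem finiteOrderAt_fieldDeriv (hz : orderZero z ∈ c.overlap c') {f : Model n m → ℝ}
    (hf : FiniteOrderAt f z) (μ : Fin n) : FiniteOrderAt (fieldDeriv (c.fieldCoeff c') μ f) z :=
  hf.lineDeriv_field (finiteOrderMapAt_totalField (finiteOrderAt_fieldCoeff hz μ))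

theorem finiteOrderAt_changeJet (a : Fin m × MultiIndex n) :
    FiniteOrderAt (c.changeJet c' a) z :=
  iterOp_rel (D' := fun _ (b : Unit) => b)
    (fun f _ => ∀ z, orderZero z ∈ c.overlap c' → FiniteOrderAt f z)
    (fun l _ _ h z hz => finiteOrderAt_fieldDeriv hz (h z hz) l) a.2 (b := ())
    (fun _ hz => finiteOrderAt_changeJet_zero hz a.1) z hz

theorem finiteOrderMapAt_change : FiniteOrderMapAt (c.change c') z :=
  ⟨fun l => .of_fst (g := fun x => c.changeBase c' x l) (c.isOpen_baseOverlap c')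
    (c.fst_mem_baseOverlap c' hz) (contDiffOn_pi.1 (c.contDiffOn_changeBase c') l),
    finiteOrderAt_changeJet hz⟩

omit hz

theorem totalField_congr {b : Fin n → (Fin n → ℝ) → ℝ} {z z' : Model n m} {r : ℕ}
    (h1 : z'.1 = z.1) (h2 : ∀ a : Fin m × MultiIndex n, a.2.len ≤ r + 1 → z'.2 a = z.2 a) :
    (totalField b z').1 = (totalField b z).1 ∧
      ∀ a : Fin m × MultiIndex n, a.2.len ≤ r → (totalField b z').2 a = (totalField b z).2 a := by
  constructor
  · simp [totalField, Prod.fst_sum, h1, totalVec]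
  · intro a ha
    simp only [totalField, Prod.snd_sum, Finset.sum_apply, h1, Prod.smul_snd, Pi.smul_apply,
      totalVec]
    refine Finset.sum_congr rfl fun l _ => ?_
    rw [h2 _ (by rw [MultiIndex.len_cons]; omega)]

/-- The new coordinates of order `r` only depend on the old ones of order at most `r`. -/
theorem changeJet_congr (a : Fin m × MultiIndex n) {z z' : Model n m}
    (hz : orderZero z ∈ c.overlap c') (h1 : z'.1 = z.1)
    (h2 : ∀ b : Fin m × MultiIndex n, b.2.len ≤ a.2.len → z'.2 b = z.2 b) :
    c.changeJet c' a z' = c.changeJet c' a z := by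
  refine iterOp_count (D := fieldDeriv (c.fieldCoeff c'))
    (fun r (f : Model n m → ℝ) => ∀ z z' : Model n m, orderZero z ∈ c.overlap c' → z'.1 = z.1 →
    (∀ b : Fin m × MultiIndex n, b.2.len ≤ r → z'.2 b = z.2 b) → f z' = f z) ?_ a.2 ?_ z z' hz h1 h2
  · intro μ r f hf z z' hz h1 h2
    obtain ⟨h3, h4⟩ := totalField_congr (b := c.fieldCoeff c' μ) h1 h2
    refine Filter.EventuallyEq.deriv_eq ?_
    have hc : ContinuousAt (fun t : ℝ => orderZero (z + t • totalField (c.fieldCoeff c' μ) z)) 0 :=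
      continuous_orderZero.continuousAt.comp (hasCurveDeriv_line _ _ 0).continuousAt
    have := hc.preimage_mem_nhds ((c.isOpen_overlap c').mem_nhds (by simpa using hz))
    filter_upwards [this] with t ht
    refine hf _ _ ht ?_ fun b hb => ?_
    · simp [h1, h3]
    · simp [h2 b (by omega), h4 b hb]
  · intro z z' _ h1 h2
    have : orderZero z' = orderZero z :=
      Prod.ext h1 (funext fun i => h2 (i, 0) (by simp [MultiIndex.len_zero]))
    simp only [this]

end BundleChart

/-! ### Local sections in coordinates -/

namespace LocalSection

variable (s : LocalSection n m π) (c c' : BundleChart n m π)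

/-- The components of a section in a bundle chart. -/
def repr (i : Fin m) (x : Fin n → ℝ) : ℝ := (c.total (s.toFun (c.base.symm x))).2 i

theorem proj_val : π (s.toFun s.pt) = s.pt := by
  obtain ⟨U, -, hp, -, h⟩ := s.isSection
  exact h _ hp

variable {s c c'} (hs : s.toFun s.pt ∈ c.total.source)

include hs

theorem pt_mem_source : s.pt ∈ c.base.source := s.proj_val ▸ c.mapsTo _ hs

theorem fst_total_val : (c.total (s.toFun s.pt)).1 = c.base s.pt := by
  rw [c.fst_total _ hs, s.proj_val]

theorem eventually_pt : ∀ᶠ p in 𝓝 s.pt, p ∈ c.base.source ∧ s.toFun p ∈ c.total.source ∧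
    π (s.toFun p) = p ∧ ContMDiffAt (𝓡 n) (𝓡 (n + m)) ∞ s.toFun p := by
  obtain ⟨U, hU, hp, h1, h2⟩ := s.isSection
  have hc := (h1.contMDiffAt (hU.mem_nhds hp)).continuousAt
  filter_upwards [hU.mem_nhds hp, c.base.open_source.mem_nhds (pt_mem_source hs),
    hc.preimage_mem_nhds (c.total.open_source.mem_nhds hs)] with p a b d
  exact ⟨b, d, h2 p a, h1.contMDiffAt (hU.mem_nhds a)⟩

theorem tendsto_base_symm : Tendsto c.base.symm (𝓝 (c.base s.pt)) (𝓝 s.pt) := by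
  have h1 := pt_mem_source hs
  have := c.base.symm.continuousAt (c.base.map_source h1)
  rwa [ContinuousAt, c.base.left_inv h1] at this

theorem base_mem_target : ∀ᶠ x in 𝓝 (c.base s.pt), x ∈ c.base.target :=
  c.base.open_target.mem_nhds (c.base.map_source (pt_mem_source hs))

theorem smoothNear_repr (i : Fin m) : SmoothNear (c.base s.pt) (s.repr c i) := by
  filter_upwards [(tendsto_base_symm hs).eventually (eventually_pt hs), base_mem_target hs]
    with x ⟨h1, h2, h3, h4⟩ hx
  have h5 : ContMDiffAt 𝓘(ℝ, Fin n → ℝ) 𝓘(ℝ, (Fin n → ℝ) × (Fin m → ℝ)) ∞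
      (fun x => c.total (s.toFun (c.base.symm x))) x :=
    (c.contMDiffOn_total.contMDiffAt (c.total.open_source.mem_nhds h2)).comp x
      (h4.comp x (c.contMDiffOn_base_symm.contMDiffAt (c.base.open_target.mem_nhds hx)))
  exact contDiffAt_pi.1 (contMDiffAt_iff_contDiffAt.1 h5).snd i

theorem orderZero_jetMap_pt : orderZero (jetMap (s.repr c) (c.base s.pt)) =
    c.total (s.toFun s.pt) := by
  refine Prod.ext (fst_total_val hs).symm (funext fun i => ?_)
  simp only [orderZero, jetMap, iterOp_zero, repr]
  rw [c.base.left_inv (pt_mem_source hs)]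

theorem val_mem_overlap (hs' : s.toFun s.pt ∈ c'.total.source) :
    orderZero (jetMap (s.repr c) (c.base s.pt)) ∈ c.overlap c' := by
  rw [orderZero_jetMap_pt hs]
  exact ⟨c.total.map_source hs, by rwa [mem_preimage, c.total.left_inv hs]⟩

/-- The components of a section in two charts. -/
theorem eventually_repr (hs' : s.toFun s.pt ∈ c'.total.source) :
    ∀ᶠ x in 𝓝 (c'.base s.pt), x ∈ c'.baseOverlap c ∧
      orderZero (jetMap (s.repr c) (c'.changeBase c x)) ∈ c.overlap c' ∧
      c.changeBase c' (c'.changeBase c x) = x ∧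
      (∀ i, SmoothNear (c'.changeBase c x) (s.repr c i)) ∧ ∀ i, s.repr c' i x =
        c.changeFibre c' (orderZero (jetMap (s.repr c) (c'.changeBase c x))) i := by
  have hχ : Tendsto (c'.changeBase c) (𝓝 (c'.base s.pt)) (𝓝 (c.base s.pt)) :=
    (c.base.continuousAt (pt_mem_source hs)).tendsto.comp (tendsto_base_symm hs')
  have hsm : ∀ᶠ x in 𝓝 (c.base s.pt), ∀ i, SmoothNear x (s.repr c i) :=
    eventually_all.2 fun i => (smoothNear_repr hs i).eventually_nhds
  filter_upwards [(tendsto_base_symm hs').eventually (eventually_pt hs),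
    (tendsto_base_symm hs').eventually (eventually_pt hs'), base_mem_target hs',
    hχ.eventually hsm] with x ⟨h1, h2, h3, _⟩ ⟨h4, h5, _, _⟩ hx h6
  have e1 : c.base.symm (c'.changeBase c x) = c'.base.symm x := c.base.left_inv h1
  have e2 : orderZero (jetMap (s.repr c) (c'.changeBase c x)) =
      c.total (s.toFun (c'.base.symm x)) := by
    refine Prod.ext ?_ (funext fun i => ?_)
    · rw [c.fst_total _ h2, h3]; rfl
    · simp only [orderZero, jetMap, iterOp_zero, repr, e1]
  refine ⟨⟨hx, h1⟩, ?_, ?_, h6, fun i => ?_⟩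
  · rw [e2]
    exact ⟨c.total.map_source h2, by rwa [mem_preimage, c.total.left_inv h2]⟩
  · exact (c'.changeBase_mem c ⟨hx, h1⟩).2
  · rw [e2, BundleChart.changeFibre, c.total.left_inv h2]; rfl

/-- If a function on the base is, in the new coordinates, the composition of the prolonged section
with a function of finite order, so are its derivatives. -/
theorem partialD_eq_fieldDeriv (hs' : s.toFun s.pt ∈ c'.total.source) {f : (Fin n → ℝ) → ℝ}
    {F : Model n m → ℝ} (hF : ∀ z, orderZero z ∈ c.overlap c' → FiniteOrderAt F z)
    (h : ∀ᶠ x in 𝓝 (c'.base s.pt), f x = F (jetMap (s.repr c) (c'.changeBase c x))) (μ : Fin n)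
    (hf : SmoothNear (c'.base s.pt) f) :
    ∀ᶠ x in 𝓝 (c'.base s.pt), partialD μ f x =
      fieldDeriv (c.fieldCoeff c') μ F (jetMap (s.repr c) (c'.changeBase c x)) := by
  filter_upwards [h.eventually_nhds, hf, eventually_repr hs hs'] with x hx hfx ⟨h1, h2, h3, h4, _⟩
  rw [partialD, ← (hfx.differentiableAt (by simp)).lineDeriv_eq_fderiv]
  have hb := (c'.contDiffOn_changeBase c).contDiffAt ((c'.isOpen_baseOverlap c).mem_nhds h1)
  have hline : HasDerivAt (fun t : ℝ => x + t • (Pi.single μ 1 : Fin n → ℝ)) (Pi.single μ 1) 0 := by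
    simpa using ((hasDerivAt_id (0 : ℝ)).smul_const (Pi.single μ 1 : Fin n → ℝ)).const_add x
  have hγ : HasDerivAt (fun t : ℝ => c'.changeBase c (x + t • (Pi.single μ 1 : Fin n → ℝ)))
      (fderiv ℝ (c'.changeBase c) x (Pi.single μ 1)) 0 := by
    have := (hb.differentiableAt (by simp)).hasFDerivAt
    exact HasFDerivAt.comp_hasDerivAt (0 : ℝ) (l := c'.changeBase c)
      (f := fun t : ℝ => x + t • (Pi.single μ 1 : Fin n → ℝ)) (by simpa using this) hline
  have hj := hasCurveDeriv_jetMap (f := s.repr c)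
    (γ := fun t : ℝ => c'.changeBase c (x + t • (Pi.single μ 1 : Fin n → ℝ))) (t := 0)
    (by simpa using h4) hγ
  have hd := FiniteOrderAt.hasDerivAt_curve (f := F) (t := 0)
    (γ := fun t : ℝ => jetMap (s.repr c) (c'.changeBase c (x + t • (Pi.single μ 1 : Fin n → ℝ))))
    (hF _ (by simpa using h2)) hj
  have he : (fun t : ℝ => f (x + t • (Pi.single μ 1 : Fin n → ℝ))) =ᶠ[𝓝 0] fun t : ℝ =>
      F (jetMap (s.repr c) (c'.changeBase c (x + t • (Pi.single μ 1 : Fin n → ℝ)))) :=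
    hline.continuousAt.eventually (p := fun y => f y = F (jetMap (s.repr c) (c'.changeBase c y)))
      (by simpa using hx)
  rw [lineDeriv, he.deriv_eq, hd.deriv, fieldDeriv]
  simp only [zero_smul, add_zero]
  congr 1
  rw [totalField]
  refine Finset.sum_congr rfl fun l _ => ?_
  congr 1
  change _ = c.fieldCoeff c' μ l (c'.changeBase c x)
  rw [BundleChart.fieldCoeff, h3, partialD]
  have := (hasFDerivAt_pi'.1 (hb.differentiableAt (by simp)).hasFDerivAt l).fderiv
  rw [this]; rfl

theorem eventually_iterOp_repr (hs' : s.toFun s.pt ∈ c'.total.source)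
    (a : Fin m × MultiIndex n) : ∀ᶠ x in 𝓝 (c'.base s.pt),
      iterOp partialD a.2 (s.repr c' a.1) x =
        c.changeJet c' a (jetMap (s.repr c) (c'.changeBase c x)) :=
  (iterOp_rel (D := partialD) (D' := fieldDeriv (c.fieldCoeff c')) (fun f F =>
    SmoothNear (c'.base s.pt) f ∧ (∀ z, orderZero z ∈ c.overlap c' → FiniteOrderAt F z) ∧
      ∀ᶠ x in 𝓝 (c'.base s.pt), f x = F (jetMap (s.repr c) (c'.changeBase c x)))
    (fun μ _ _ h => ⟨h.1.mono fun _ hy => hy.partialD μ, fun _ hz =>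
        BundleChart.finiteOrderAt_fieldDeriv hz (h.2.1 _ hz) μ,
      partialD_eq_fieldDeriv hs hs' h.2.1 h.2.2 μ h.1⟩) a.2
    ⟨smoothNear_repr hs' a.1, fun _ hz => BundleChart.finiteOrderAt_changeJet_zero hz a.1,
      (eventually_repr hs hs').mono fun _ h => h.2.2.2.2 a.1⟩).2.2

/-- The jet coordinates of a section in two charts. -/
theorem jetMap_repr (hs' : s.toFun s.pt ∈ c'.total.source) :
    jetMap (s.repr c') (c'.base s.pt) = c.change c' (jetMap (s.repr c) (c.base s.pt)) := by
  have e : c'.changeBase c (c'.base s.pt) = c.base s.pt := by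
    rw [BundleChart.changeBase, c'.base.left_inv (pt_mem_source hs')]
  refine Prod.ext ?_ (funext fun a => ?_)
  · change c'.base s.pt = c'.base (c.base.symm (c.base s.pt))
    rw [c.base.left_inv (pt_mem_source hs)]
  · have := (eventually_iterOp_repr hs hs' a).self_of_nhds
    rwa [e] at this

theorem partialDeriv_eq (hs' : s.toFun s.pt ∈ c'.total.source) (i : Fin m) (Λ : MultiIndex n) :
    s.partialDeriv c' i Λ = c.changeJet c' (i, Λ) (jetMap (s.repr c) (c.base s.pt)) :=
  congrFun (congrArg Prod.snd (jetMap_repr hs hs')) (i, Λ)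

/-- Equality of jets can be tested in one chart. -/
theorem jetSetoid_of_chart {t : LocalSection n m π} {r : ℕ} (hv : s.toFun s.pt = t.toFun t.pt)
    (h : ∀ i (Λ : MultiIndex n), Λ.len ≤ r → s.partialDeriv c i Λ = t.partialDeriv c i Λ) :
    (jetSetoid (n := n) (m := m) π r).r s t := by
  have hpt : s.pt = t.pt := by rw [← s.proj_val, ← t.proj_val, hv]
  refine ⟨hpt, hv, fun c' hs' i Λ hΛ => ?_⟩
  have ht : t.toFun t.pt ∈ c.total.source := hv ▸ hs
  rw [partialDeriv_eq hs hs', partialDeriv_eq ht (hv ▸ hs')]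
  refine BundleChart.changeJet_congr (i, Λ) (val_mem_overlap ht (hv ▸ hs')) ?_ fun b hb => ?_
  · exact congrArg c.base hpt
  · exact h b.1 b.2 (hb.trans hΛ)

end LocalSection

end Charts

/-! ### The coordinates of the infinite order jet space -/

section JetSpace

variable {n m : ℕ} {X Y : Type u}
  [TopologicalSpace X] [ChartedSpace (EuclideanSpace ℝ (Fin n)) X]
  [TopologicalSpace Y] [ChartedSpace (EuclideanSpace ℝ (Fin (n + m))) Y] {π : Y → X}

namespace InfJet

/-- The projection `J^∞ Y → Y`. -/
def val (q : InfJet n m π) : Y := (q.1 0).val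

theorem val_proj {r : ℕ} (j : Jet n m π (r + 1)) : (Jet.proj r j).val = j.val := by
  induction j using Quotient.inductionOn with
  | h s => rfl

theorem val_eq (q : InfJet n m π) (r : ℕ) : (q.1 r).val = val q := by
  induction r with
  | zero => rfl
  | succ r ih => rw [← ih, ← q.2 r, val_proj]

/-- A point of `J^∞ Y` is represented up to any order by a local section. -/
theorem exists_section (q : InfJet n m π) (r : ℕ) : ∃ s : LocalSection n m π,
    (Quotient.mk _ s : Jet n m π r) = q.1 r ∧ s.toFun s.pt = val q ∧ s.pt = π (val q) := by
  obtain ⟨s, hs⟩ := Quotient.exists_rep (q.1 r)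
  have hv : s.toFun s.pt = val q := by rw [← val_eq q r, ← hs]; rfl
  exact ⟨s, hs, hv, by rw [← hv, s.proj_val]⟩

theorem fibreCoord_proj {r : ℕ} (j : Jet n m π (r + 1)) (c : BundleChart n m π) (i : Fin m)
    (Λ : MultiIndex n) (h : Λ.len ≤ r) : (Jet.proj r j).fibreCoord c i ⟨Λ, h⟩ =
      j.fibreCoord c i ⟨Λ, h.trans r.le_succ⟩ := by
  induction j using Quotient.inductionOn with
  | h s => rfl

theorem fibreCoord_eq (q : InfJet n m π) (c : BundleChart n m π) (i : Fin m) (Λ : MultiIndex n)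
    (r : ℕ) (h : Λ.len ≤ r) : (q.1 r).fibreCoord c i ⟨Λ, h⟩ = (c.coord q).2 (i, Λ) := by
  induction r, h using Nat.le_induction with
  | base => rfl
  | succ r h ih => rw [← ih, ← q.2 r, fibreCoord_proj]

end InfJet

open InfJet

variable {c c' : BundleChart n m π} {q : InfJet n m π}

theorem val_mem_source (hq : q ∈ c.dom) : val q ∈ c.total.source := hq

theorem exists_section_coord (q : InfJet n m π) (r : ℕ) : ∃ s : LocalSection n m π,
    (Quotient.mk _ s : Jet n m π r) = q.1 r ∧ s.toFun s.pt = val q ∧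
    ∀ c : BundleChart n m π, q ∈ c.dom → (jetMap (s.repr c) (c.base s.pt)).1 = (c.coord q).1 ∧
      ∀ a : Fin m × MultiIndex n, a.2.len ≤ r →
        (jetMap (s.repr c) (c.base s.pt)).2 a = (c.coord q).2 a := by
  obtain ⟨s, hs, hv, hpt⟩ := exists_section q r
  refine ⟨s, hs, hv, fun c hq => ⟨?_, fun a ha => ?_⟩⟩
  · change c.base s.pt = c.base (π (val q))
    rw [hpt]
  · rw [← fibreCoord_eq q c a.1 a.2 r ha, ← hs]
    have : s.toFun s.pt ∈ c.total.source := by rw [hv]; exact hq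
    exact (if_pos this).symm

theorem orderZero_coord (hq : q ∈ c.dom) : orderZero (c.coord q) = c.total (val q) := by
  obtain ⟨s, hs, hv, h⟩ := exists_section_coord q 0
  obtain ⟨h1, h2⟩ := h c hq
  have hm : s.toFun s.pt ∈ c.total.source := by rw [hv]; exact hq
  rw [← hv, ← LocalSection.orderZero_jetMap_pt hm]
  exact Prod.ext h1.symm (funext fun i => (h2 (i, 0) (by simp [MultiIndex.len_zero])).symm)

theorem orderZero_coord_mem_target (hq : q ∈ c.dom) : orderZero (c.coord q) ∈ c.total.target := by
  rw [orderZero_coord hq]; exact c.total.map_source hq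

theorem orderZero_coord_mem (hq : q ∈ c.dom) (hq' : q ∈ c'.dom) :
    orderZero (c.coord q) ∈ c.overlap c' := by
  rw [orderZero_coord hq]
  exact ⟨c.total.map_source hq, by
    rw [mem_preimage, c.total.left_inv (val_mem_source hq)]; exact hq'⟩

theorem coord_eq_change (hq : q ∈ c.dom) (hq' : q ∈ c'.dom) :
    c'.coord q = c.change c' (c.coord q) := by
  refine Prod.ext ?_ (funext fun a => ?_)
  · change c'.base (π (val q)) = c'.base (c.base.symm (c.base (π (val q))))
    rw [c.base.left_inv (c.mapsTo _ (val_mem_source hq))]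
  · obtain ⟨s, hs, hv, h⟩ := exists_section_coord q a.2.len
    have hm : s.toFun s.pt ∈ c.total.source := by rw [hv]; exact hq
    have hm' : s.toFun s.pt ∈ c'.total.source := by rw [hv]; exact hq'
    rw [← (h c' hq').2 a le_rfl, LocalSection.jetMap_repr hm hm']
    exact BundleChart.changeJet_congr a (orderZero_coord_mem hq hq') (h c hq).1 (h c hq).2

theorem coord_injOn (c : BundleChart n m π) : InjOn c.coord c.dom := by
  intro q hq q' hq' h
  refine Subtype.ext (funext fun r => ?_)
  obtain ⟨s, hs, hv, h1⟩ := exists_section_coord q r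
  obtain ⟨s', hs', hv', h1'⟩ := exists_section_coord q' r
  have hval : val q = val q' :=
    c.total.injOn (val_mem_source hq) (val_mem_source hq') (by
      rw [← orderZero_coord hq, ← orderZero_coord hq', h])
  rw [← hs, ← hs']
  refine Quotient.sound (LocalSection.jetSetoid_of_chart (c := c) (by rw [hv]; exact hq)
    (by rw [hv, hv', hval]) fun i Λ hΛ => ?_)
  have e := (h1 c hq).2 (i, Λ) hΛ
  rw [h, ← (h1' c hq').2 (i, Λ) hΛ] at e
  exact e

/-- Every point of the model over the image of the bundle chart has a point of `J^∞ Y` with these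
coordinates: the jets of order `r` are those of polynomial sections. -/
theorem exists_coord_eq (c : BundleChart n m π) {z : Model n m}
    (hz : orderZero z ∈ c.total.target) : ∃ q ∈ c.dom, c.coord q = z := by
  classical
  obtain ⟨hb, hbπ⟩ := c.base_symm_eq hz
  -- the coordinates up to the order `r`, and the section with these derivatives in the chart
  let a : ℕ → Fin m → MultiIndex n → ℝ := fun r i Λ => if Λ.len ≤ r then z.2 (i, Λ) else 0
  have ha : ∀ r i, (a r i).support.Finite := by
    intro r i
    refine (Set.finite_Icc (0 : MultiIndex n) (fun _ => r)).subset fun Λ hΛ => ?_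
    have : Λ.len ≤ r := by
      by_contra hc
      exact hΛ (if_neg hc)
    exact ⟨fun l => Nat.zero_le _, fun l =>
      (Finset.single_le_sum (f := Λ) (fun _ _ => Nat.zero_le _) (Finset.mem_univ l)).trans this⟩
  let f : ℕ → (Fin n → ℝ) → (Fin n → ℝ) × (Fin m → ℝ) :=
    fun r x => (x, fun i => jetPolynomial z.1 (a r i) x)
  have hf : ∀ r, ContDiff ℝ ∞ (f r) := fun r =>
    contDiff_id.prodMk (contDiff_pi.2 fun i => contDiff_jetPolynomial z.1 (ha r i))
  have hfz : ∀ r, f r z.1 = orderZero z := by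
    intro r
    refine Prod.ext rfl (funext fun i => ?_)
    simp [f, a, jetPolynomial_self, orderZero, MultiIndex.len_zero]
  let p : X := c.base.symm z.1
  have hp : p ∈ c.base.source := c.base.map_target hb
  have hbp : c.base p = z.1 := c.base.right_inv hb
  let U : ℕ → Set X := fun r => c.base.source ∩ c.base ⁻¹' (f r ⁻¹' c.total.target)
  have hU : ∀ r, IsOpen (U r) := fun r => c.base.continuousOn.isOpen_inter_preimage
    c.base.open_source (c.total.open_target.preimage (hf r).continuous)
  have hpU : ∀ r, p ∈ U r := fun r => ⟨hp, by
    rw [mem_preimage, mem_preimage, hbp, hfz]; exact hz⟩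
  let s : ℕ → LocalSection n m π := fun r =>
    { pt := p
      toFun := fun x => c.total.symm (f r (c.base x))
      isSection := by
        refine ⟨U r, hU r, hpU r, ?_, fun x hx => ?_⟩
        · exact c.contMDiffOn_total_symm.comp ((hf r).contMDiff.comp_contMDiffOn
            (c.contMDiffOn_base.mono inter_subset_left)) fun x hx => hx.2
        · rw [← (c.base_symm_eq hx.2).2]
          exact c.base.left_inv hx.1 }
  have hval : ∀ r, (s r).toFun (s r).pt = c.total.symm (orderZero z) := by
    intro r
    change c.total.symm (f r (c.base p)) = _
    rw [hbp, hfz]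
  have hmem : ∀ r, (s r).toFun (s r).pt ∈ c.total.source := fun r => by
    rw [hval]; exact c.total.map_target hz
  have hpd : ∀ r i Λ, (s r).partialDeriv c i Λ = a r i Λ := by
    intro r i Λ
    have he : (fun x => (c.total ((s r).toFun (c.base.symm x))).2 i) =ᶠ[𝓝 z.1]
        jetPolynomial z.1 (a r i) := by
      have h1 : ∀ᶠ x in 𝓝 z.1, x ∈ c.base.target := c.base.open_target.mem_nhds hb
      have h2 : ∀ᶠ x in 𝓝 z.1, f r x ∈ c.total.target :=
        (hf r).continuous.continuousAt.eventually
          (c.total.open_target.mem_nhds (by rw [hfz]; exact hz))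
      filter_upwards [h1, h2] with x hx hx'
      change (c.total (c.total.symm (f r (c.base (c.base.symm x))))).2 i = _
      rw [c.base.right_inv hx, c.total.right_inv hx']
    have h3 := (iterOp_partialD_congr he Λ).self_of_nhds
    rw [iterOp_partialD_jetPolynomial z.1 (ha r i)] at h3
    rw [← h3]
    change iterOp partialD Λ _ (c.base p) = _
    rw [hbp]
  refine ⟨⟨fun r => Quotient.mk _ (s r), fun r => ?_⟩, hmem 0, ?_⟩
  · refine Quotient.sound (LocalSection.jetSetoid_of_chart (c := c) (hmem _)
      (by rw [hval, hval]) fun i Λ hΛ => ?_)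
    rw [hpd, hpd]
    simp [a, hΛ, hΛ.trans r.le_succ]
  · refine Prod.ext ?_ (funext fun b => ?_)
    · change c.base (π ((s 0).toFun (s 0).pt)) = z.1
      rw [(s 0).proj_val, hbp]
    · change (if (s b.2.len).toFun (s b.2.len).pt ∈ c.total.source then
        (s b.2.len).partialDeriv c b.1 b.2 else 0) = z.2 b
      rw [if_pos (hmem _), hpd]
      simp [a]

/-! ### The topology of the infinite order jet space -/

theorem continuous_jet (r : ℕ) : Continuous fun q : InfJet n m π => q.1 r :=
  (continuous_apply r).comp continuous_subtype_val

theorem isOpen_dom (c : BundleChart n m π) : IsOpen c.dom := by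
  have : IsOpen {j : Jet n m π 0 | j.val ∈ c.total.source ∧ j.coord c ∈ univ} :=
    isOpen_generateFrom_of_mem ⟨c, univ, isOpen_univ, rfl⟩
  have h := this.preimage (continuous_jet (n := n) (m := m) (π := π) 0)
  convert h using 1
  ext q
  simp [BundleChart.dom]

theorem continuousAt_jetCoord {r : ℕ} {j : Jet n m π r} (hj : j.val ∈ c.total.source) :
    ContinuousAt (Jet.coord c) j := by
  intro W hW
  obtain ⟨W', hW', ho, hm⟩ := mem_nhds_iff.1 hW
  have : IsOpen {j : Jet n m π r | j.val ∈ c.total.source ∧ j.coord c ∈ W'} :=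
    isOpen_generateFrom_of_mem ⟨c, W', ho, rfl⟩
  exact (this.eventually_mem ⟨hj, hm⟩).mono fun j h => hW' h.2

theorem continuousAt_coord (hq : q ∈ c.dom) : ContinuousAt c.coord q := by
  have h : ∀ r, ContinuousAt (fun q : InfJet n m π => (q.1 r).coord c) q := fun r =>
    ContinuousAt.comp (f := fun q : InfJet n m π => q.1 r) (g := Jet.coord c)
      (continuousAt_jetCoord (by rw [val_eq]; exact hq)) (continuous_jet r).continuousAt
  refine ContinuousAt.prodMk ?_ (continuousAt_pi.2 fun a => ?_)
  · exact continuousAt_fst.comp (h 0)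
  · exact continuousAt_pi.1 (continuousAt_snd.comp (h a.2.len)) (a.1, ⟨a.2, le_rfl⟩)

theorem nhds_eq_comap_coord (hq : q ∈ c.dom) : 𝓝 q = comap c.coord (𝓝 (c.coord q)) ⊓ 𝓟 c.dom := by
  refine le_antisymm (le_inf (continuousAt_coord hq).le_comap
    (le_principal_iff.2 ((isOpen_dom c).mem_nhds hq))) ?_
  refine tendsto_id'.1 (tendsto_subtype_rng.2 (tendsto_pi_nhds.2 fun r => ?_))
  refine tendsto_nhds_generateFrom_iff.2 ?_
  rintro _ ⟨c', W, hW, rfl⟩ ⟨h1, h2⟩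
  have hq' : q ∈ c'.dom := by rw [val_eq] at h1; exact h1
  -- the jet coordinates of order `r` in the chart `c'`, as functions of the coordinates in `c`
  let g : Model n m → (Fin n → ℝ) × (Fin m × {Λ : MultiIndex n // Λ.len ≤ r} → ℝ) :=
    fun z => ((c.change c' z).1, fun a => (c.change c' z).2 (a.1, a.2.1))
  have hg : ∀ q : InfJet n m π, q ∈ c.dom → q ∈ c'.dom → (q.1 r).coord c' = g (c.coord q) := by
    intro q hq hq'
    refine Prod.ext ?_ (funext fun a => ?_)
    · have := congrArg Prod.fst (coord_eq_change hq hq')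
      rw [← this]
      change c'.base (π (q.1 r).val) = c'.base (π (val q))
      rw [val_eq]
    · change (q.1 r).fibreCoord c' a.1 ⟨a.2.1, a.2.2⟩ = _
      rw [fibreCoord_eq, coord_eq_change hq hq']
  have hm := orderZero_coord_mem hq hq'
  have hcont := (BundleChart.finiteOrderMapAt_change hm).continuousAt
  have hgc : ContinuousAt g (c.coord q) :=
    ContinuousAt.prodMk (continuousAt_fst.comp hcont) (continuousAt_pi.2 fun a =>
      continuousAt_pi.1 (continuousAt_snd.comp hcont) (a.1, a.2.1))
  have hev : ∀ᶠ z in 𝓝 (c.coord q), orderZero z ∈ c.overlap c' ∧ g z ∈ W :=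
    ((c.isOpen_preimage_overlap c').eventually_mem hm).and
      (hgc.preimage_mem_nhds (hW.mem_nhds (by rw [← hg q hq hq']; exact h2)))
  have hev' : ∀ᶠ q' in comap c.coord (𝓝 (c.coord q)) ⊓ 𝓟 c.dom,
      orderZero (c.coord q') ∈ c.overlap c' ∧ g (c.coord q') ∈ W :=
    (tendsto_comap.mono_left inf_le_left).eventually hev
  filter_upwards [hev', mem_inf_of_right (mem_principal_self c.dom)] with q' ⟨h3, h4⟩ hq'c
  have h5 : q' ∈ c'.dom := by
    have := h3.2
    rw [orderZero_coord hq'c, mem_preimage, c.total.left_inv (val_mem_source hq'c)] at this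
    exact this
  refine ⟨?_, ?_⟩
  · change (q'.1 r).val ∈ _
    rw [val_eq]; exact h5
  · change (q'.1 r).coord c' ∈ W
    rw [hg q' hq'c h5]; exact h4

theorem map_coord_nhds (hq : q ∈ c.dom) : map c.coord (𝓝 q) = 𝓝 (c.coord q) := by
  refine le_antisymm (continuousAt_coord hq) fun s hs => ?_
  rw [mem_map, nhds_eq_comap_coord hq, mem_inf_principal, mem_comap] at hs
  obtain ⟨t, ht, h⟩ := hs
  filter_upwards [ht, (c.total.open_target.preimage continuous_orderZero).mem_nhds
    (orderZero_coord_mem_target hq)] with z hz hz'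
  obtain ⟨q', hq', rfl⟩ := exists_coord_eq c hz'
  exact h hz hq'

theorem eventually_coord (hq : q ∈ c.dom) {P : Model n m → Prop} :
    (∀ᶠ q' in 𝓝 q, P (c.coord q')) ↔ ∀ᶠ z in 𝓝 (c.coord q), P z := by
  rw [← map_coord_nhds hq, eventually_map]

theorem eventually_mem_dom (hq : q ∈ c.dom) : ∀ᶠ q' in 𝓝 q, q' ∈ c.dom :=
  (isOpen_dom c).mem_nhds hq

theorem val_eq_symm (hq : q ∈ c.dom) : val q = c.total.symm (orderZero (c.coord q)) := by
  rw [orderZero_coord hq, c.total.left_inv (val_mem_source hq)]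

theorem continuousAt_val (hq : q ∈ c.dom) : ContinuousAt (val : InfJet n m π → Y) q := by
  have h1 : ContinuousAt (fun q => c.total.symm (orderZero (c.coord q))) q :=
    (c.total.symm.continuousAt (orderZero_coord_mem_target hq)).comp
      (f := fun q => orderZero (c.coord q))
      (continuous_orderZero.continuousAt.comp (f := c.coord) (continuousAt_coord hq))
  exact h1.congr ((eventually_mem_dom hq).mono fun q' hq' => (val_eq_symm hq').symm)

/-! ### Functions and forms read in a chart -/

theorem read_coord {V : Type*} [Zero V] (f : ∀ q : InfJet n m π, q ∈ c.dom → V) (hq : q ∈ c.dom) :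
    c.read f (c.coord q) = f q hq := by
  have hinj : Function.Injective fun q : c.dom => c.coord q.1 := fun q q' h =>
    Subtype.ext (coord_injOn c q.2 q'.2 h)
  exact hinj.extend_apply _ _ ⟨q, hq⟩

theorem eventually_read {V : Type*} [Zero V] {f : ∀ q : InfJet n m π, q ∈ c.dom → V}
    {P : V → Model n m → Prop}     (hq : q ∈ c.dom) : (∀ᶠ z in 𝓝 (c.coord q), P (c.read f z) z) ↔
      ∀ᶠ q' in 𝓝 q, ∀ h : q' ∈ c.dom, P (f q' h) (c.coord q') := by
  rw [← eventually_coord hq]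
  constructor
  · intro h
    filter_upwards [h] with q' h' hq'
    rwa [read_coord f hq'] at h'
  · intro h
    filter_upwards [h, eventually_mem_dom hq] with q' h' hq'
    rw [read_coord f hq']
    exact h' hq'

/-- The change of coordinates whose tangent map is `changeVec`. -/
def transition (c c' : BundleChart n m π) (z : Model n m) : Model n m :=
  (fun l => c.read (fun q' _ => (c'.coord q').1 l) z,
    fun a => c.read (fun q' _ => (c'.coord q').2 a) z)

theorem transition_coord (hq : q ∈ c.dom) (c' : BundleChart n m π) :
    transition c c' (c.coord q) = c'.coord q :=
  Prod.ext (funext fun l => read_coord (fun q' _ => (c'.coord q').1 l) hq)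
    (funext fun a => read_coord (fun q' _ => (c'.coord q').2 a) hq)

theorem transition_eq_change (hq : q ∈ c.dom) (hq' : q ∈ c'.dom) :
    transition c c' =ᶠ[𝓝 (c.coord q)] c.change c' := by
  refine (eventually_coord hq).1 ?_
  filter_upwards [eventually_mem_dom hq, eventually_mem_dom hq'] with q' h h'
  rw [transition_coord h, coord_eq_change h h']

theorem finiteOrderMapAt_transition (hq : q ∈ c.dom) (hq' : q ∈ c'.dom) :
    ∀ᶠ z in 𝓝 (c.coord q), FiniteOrderMapAt (transition c c') z := by
  filter_upwards [(transition_eq_change hq hq').eventuallyEq_nhds,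
    (c.isOpen_preimage_overlap c').mem_nhds (orderZero_coord_mem hq hq')] with z h1 h2
  exact (BundleChart.finiteOrderMapAt_change h2).congr h1

/-! ### Changes of charts are jet transitions -/

/-- The new total derivatives of the new jet coordinates. It suffices to verify this on jets of
sections. -/
theorem fieldDeriv_changeJet {z : Model n m} (hz : orderZero z ∈ c.overlap c') (μ : Fin n)
    (j : Fin m) (Λ : MultiIndex n) : fieldDeriv (c.fieldCoeff c') μ (c.changeJet c' (j, Λ)) z =
      c.changeJet c' (j, Λ.cons μ) z := by
  obtain ⟨q, hq, rfl⟩ := exists_coord_eq c hz.1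
  have hf := BundleChart.finiteOrderAt_changeJet hz (j, Λ)
  have h1 := BundleChart.finiteOrderAt_fieldDeriv hz hf μ
  have h2 := BundleChart.finiteOrderAt_changeJet hz (j, Λ.cons μ)
  -- a function of finite order takes the same value on a jet of high order
  have key : ∀ F : Model n m → ℝ, FiniteOrderAt F (c.coord q) → ∃ r : ℕ, ∀ z' : Model n m,
      z'.1 = (c.coord q).1 → (∀ a : Fin m × MultiIndex n, a.2.len ≤ r →
        z'.2 a = (c.coord q).2 a) → F z' = F (c.coord q) := by
    rintro F ⟨S, W, g, -, -, -, hg⟩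
    obtain ⟨r, hr⟩ := exists_order_of_eventually hg
    refine ⟨max r (S.sup fun a => a.2.len), fun z' h1 h2 => ?_⟩
    rw [hr z' h1 fun a ha => h2 a (ha.trans (le_max_left _ _)), hg.self_of_nhds]
    congr 1
    exact Prod.ext h1 (funext fun a => h2 a
      ((Finset.le_sup (f := fun a : Fin m × MultiIndex n => a.2.len) a.2).trans (le_max_right _ _)))
  obtain ⟨r1, hr1⟩ := key _ h1
  obtain ⟨r2, hr2⟩ := key _ h2
  obtain ⟨s, -, hv, hs⟩ := exists_section_coord q (max r1 r2)
  obtain ⟨e1, e2⟩ := hs c hq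
  have hm : s.toFun s.pt ∈ c.total.source := by rw [hv]; exact hq
  have hq' : q ∈ c'.dom := by
    have := hz.2
    rw [orderZero_coord hq, mem_preimage, c.total.left_inv (val_mem_source hq)] at this
    exact this
  have hm' : s.toFun s.pt ∈ c'.total.source := by rw [hv]; exact hq'
  rw [← hr1 _ e1 fun a ha => e2 a (ha.trans (le_max_left _ _)),
    ← hr2 _ e1 fun a ha => e2 a (ha.trans (le_max_right _ _))]
  have e3 : c'.changeBase c (c'.base s.pt) = c.base s.pt := by
    rw [BundleChart.changeBase, c'.base.left_inv (LocalSection.pt_mem_source hm')]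
  have hsm := LocalSection.smoothNear_repr hm' j
  have h3 := (LocalSection.partialD_eq_fieldDeriv hm hm'
    (fun z hz => BundleChart.finiteOrderAt_changeJet hz (j, Λ))
    (LocalSection.eventually_iterOp_repr hm hm' (j, Λ)) μ (hsm.iterOp Λ)).self_of_nhds
  have h4 := (LocalSection.eventually_iterOp_repr hm hm' (j, Λ.cons μ)).self_of_nhds
  rw [e3] at h3 h4
  rw [← h3, ← h4]
  exact (iterOp_partialD_cons hsm Λ μ).self_of_nhds.symm

theorem mapDeriv_change_totalField {z : Model n m} (hz : orderZero z ∈ c.overlap c') (μ : Fin n) :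
    mapDeriv (c.change c') z (totalField (c.fieldCoeff c' μ) z) = totalVec μ (c.change c' z) := by
  refine Prod.ext (funext fun l => ?_) (funext fun a => fieldDeriv_changeJet hz μ a.1 a.2)
  have hb : z.1 ∈ c.baseOverlap c' := c.fst_mem_baseOverlap c' hz
  obtain ⟨hb', he⟩ := c.changeBase_mem c' hb
  have hψ := ((c.contDiffOn_changeBase c').contDiffAt
    ((c.isOpen_baseOverlap c').mem_nhds hb)).differentiableAt (by simp)
  have hχ := ((c'.contDiffOn_changeBase c).contDiffAt
    ((c'.isOpen_baseOverlap c).mem_nhds hb')).differentiableAt (by simp)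
  -- the base component of the field is the image of the coordinate field of the new base chart
  have e1 : (totalField (c.fieldCoeff c' μ) z).1 =
      fderiv ℝ (c'.changeBase c) (c.changeBase c' z.1) (Pi.single μ 1) := by
    funext l'
    have := (hasFDerivAt_pi'.1 hχ.hasFDerivAt l').fderiv
    rw [show fderiv ℝ (c'.changeBase c) (c.changeBase c' z.1) (Pi.single μ 1) l' =
      c.fieldCoeff c' μ l' z.1 by rw [BundleChart.fieldCoeff, partialD, this]; rfl]
    simp [totalField, Prod.fst_sum, totalVec, Pi.single_apply]
  have e2 : HasFDerivAt (fun x => c.changeBase c' (c'.changeBase c x))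
      (ContinuousLinearMap.id ℝ (Fin n → ℝ)) (c.changeBase c' z.1) := by
    refine (hasFDerivAt_id _).congr_of_eventuallyEq ?_
    filter_upwards [(c'.isOpen_baseOverlap c).mem_nhds hb'] with x hx
      using (c'.changeBase_mem c hx).2
  have e3 : (fderiv ℝ (c.changeBase c') z.1).comp
      (fderiv ℝ (c'.changeBase c) (c.changeBase c' z.1)) = ContinuousLinearMap.id ℝ _ := by
    have := HasFDerivAt.comp (c.changeBase c' z.1) (g := c.changeBase c') (f := c'.changeBase c)
      (by rw [he]; exact hψ.hasFDerivAt) hχ.hasFDerivAt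
    exact this.unique e2
  have e4 : HasDerivAt (fun t : ℝ => c.changeBase c' (z.1 + t • (totalField
      (c.fieldCoeff c' μ) z).1)) (fderiv ℝ (c.changeBase c') z.1
        (totalField (c.fieldCoeff c' μ) z).1) 0 := by
    have h1 : HasDerivAt (fun t : ℝ => z.1 + t • (totalField (c.fieldCoeff c' μ) z).1)
        (totalField (c.fieldCoeff c' μ) z).1 0 := by
      simpa using ((hasDerivAt_id (0 : ℝ)).smul_const
        (totalField (c.fieldCoeff c' μ) z).1).const_add z.1
    exact HasFDerivAt.comp_hasDerivAt (0 : ℝ) (l := c.changeBase c')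
      (f := fun t : ℝ => z.1 + t • (totalField (c.fieldCoeff c' μ) z).1)
      (by simpa using hψ.hasFDerivAt) h1
  have e5 := (hasDerivAt_pi.1 e4 l).deriv
  rw [e1] at e5
  have e6 := congrFun (congrArg (fun L : (Fin n → ℝ) →L[ℝ] (Fin n → ℝ) => L (Pi.single μ 1)) e3) l
  refine Eq.trans ?_ (e5.trans e6)
  rw [← e1]
  rfl

theorem isJetTransitionAt_change {z : Model n m} (hz : orderZero z ∈ c.overlap c') :
    IsJetTransitionAt (c.change c') (c.fieldCoeff c') z where
  finiteOrder := ((c.isOpen_preimage_overlap c').eventually_mem hz).mono fun _ h =>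
    BundleChart.finiteOrderMapAt_change h
  coeff := BundleChart.finiteOrderAt_fieldCoeff hz
  totalVec_eq := ((c.isOpen_preimage_overlap c').eventually_mem hz).mono fun _ h =>
    mapDeriv_change_totalField h
  vertical := .of_forall fun z v hv => funext fun l =>
    lineDeriv_of_fst_eq_zero (fun x => c.changeBase c' x l) z hv
  orderZero := by
    refine ((c.isOpen_preimage_overlap c').eventually_mem hz).mono fun z h v hv j => ?_
    have hf := BundleChart.finiteOrderAt_changeJet h (j, 0)
    have e : lineDeriv ℝ (c.changeJet c' (j, 0)) z v =
        lineDeriv ℝ (c.changeJet c' (j, 0)) z (∑ i, v.2 (i, 0) • fibreVec (i, 0)) := by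
      have e0 : ∀ t : ℝ, orderZero (z + t • v) =
          orderZero (z + t • ∑ i, v.2 (i, 0) • fibreVec (i, 0)) := fun t =>
        Prod.ext (by simp [_root_.orderZero, hv, fibreVec, Prod.fst_sum])
          (by simp [_root_.orderZero, fibreVec, Prod.snd_sum, Pi.single_apply])
      simp only [lineDeriv, BundleChart.changeJet, iterOp_zero, e0]
    refine e.trans ((hf.lineDeriv_sum_vec _ _).trans (Finset.sum_congr rfl fun i _ => ?_))
    rw [lineDeriv_smul, smul_eq_mul, mul_comm]
    rfl

theorem IsJetTransitionAt.congr {T U : Model n m → Model n m}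
    {B : Fin n → Fin n → (Fin n → ℝ) → ℝ} {z : Model n m} (h : IsJetTransitionAt T B z)
    (e : U =ᶠ[𝓝 z] T) : IsJetTransitionAt U B z where
  finiteOrder := by
    filter_upwards [h.finiteOrder, e.eventuallyEq_nhds] with z h1 h2 using h1.congr h2
  coeff := h.coeff
  totalVec_eq := by
    filter_upwards [h.totalVec_eq, e.eventuallyEq_nhds] with z h1 h2 μ
    rw [mapDeriv_congr_nhds h2, h2.self_of_nhds, h1]
  vertical := by
    filter_upwards [h.vertical, e.eventuallyEq_nhds] with z h1 h2 v hv
    rw [mapDeriv_congr_nhds h2, h1 v hv]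
  orderZero := by
    filter_upwards [h.orderZero, e.eventuallyEq_nhds] with z h1 h2 v hv j
    simp only [mapDeriv_congr_nhds h2]
    exact h1 v hv j

theorem isJetTransitionAt_transition (hq : q ∈ c.dom) (hq' : q ∈ c'.dom) :
    IsJetTransitionAt (transition c c') (c.fieldCoeff c') (c.coord q) :=
  (isJetTransitionAt_change (orderZero_coord_mem hq hq')).congr (transition_eq_change hq hq')

end JetSpace

/-! ### The operator `τ` on the infinite order jet space -/

section Tau

variable {n m : ℕ} {X Y : Type u}
  [TopologicalSpace X] [ChartedSpace (EuclideanSpace ℝ (Fin n)) X]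
  [TopologicalSpace Y] [ChartedSpace (EuclideanSpace ℝ (Fin (n + m))) Y] {π : Y → X}
  {p k : ℕ} {q : InfJet n m π} {c c' : BundleChart n m π}

/-- The components of a form in a chart. -/
def formRead (c : BundleChart n m π) (φ : ∀ q : InfJet n m π, FormValue p q) : ModelForm n m p :=
  c.read fun q hq => φ q ⟨c, hq⟩

theorem formRead_coord (φ : ∀ q : InfJet n m π, FormValue p q) (hq : q ∈ c.dom) :
    formRead c φ (c.coord q) = φ q ⟨c, hq⟩ :=
  read_coord (fun q hq => φ q ⟨c, hq⟩) hq

theorem formRead_eventuallyEq {φ : ∀ q : InfJet n m π, FormValue p q} {ψ : ModelForm n m p}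
    (hq : q ∈ c.dom) : formRead c φ =ᶠ[𝓝 (c.coord q)] ψ ↔
      ∀ᶠ q' in 𝓝 q, ∀ h : q' ∈ c.dom, φ q' ⟨c, h⟩ = ψ (c.coord q') :=
  eventually_read (f := fun q hq => φ q ⟨c, hq⟩) (P := fun a z => a = ψ z) hq

/-- Near `q`, the components of the family `φ` in different charts are related by pull-back. -/
def IsTensorialAt (φ : ∀ q : InfJet n m π, FormValue p q) (q : InfJet n m π) : Prop :=
  ∀ᶠ q' in 𝓝 q, ∀ c c' : {c : BundleChart n m π // q' ∈ c.dom}, ∀ v : Fin p → Model n m,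
    φ q' c v = φ q' c' (fun j => changeVec c.1 c'.1 q' (v j))

theorem IsTensorialAt.formRead_eq {φ : ∀ q : InfJet n m π, FormValue p q}
    (h : IsTensorialAt φ q) (hq : q ∈ c.dom) (hq' : q ∈ c'.dom) :
    formRead c φ =ᶠ[𝓝 (c.coord q)] formPullback (transition c c') (formRead c' φ) := by
  refine (formRead_eventuallyEq hq).2 ?_
  filter_upwards [h, eventually_mem_dom hq'] with q' h' h1 h2
  funext v
  rw [h' ⟨c, h2⟩ ⟨c', h1⟩ v, formPullback, transition_coord h2, formRead_coord φ h1]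
  rfl

/-- A form is a `k`-contact form of finite order near `q` as soon as it is so in one chart. -/
theorem isContactFormAt_iff {φ : ∀ q : InfJet n m π, FormValue p q} (hq : q ∈ c.dom) :
    IsContactFormAt k φ q ↔ IsTensorialAt φ q ∧ FiniteOrderFormAt (formRead c φ) (c.coord q) ∧
      HasContactDegreeAt k (formRead c φ) (c.coord q) := by
  have hread : ∀ {c : BundleChart n m π}, q ∈ c.dom →
      ((∃ (S : Finset (Fin m × MultiIndex n)) (W : Set ((Fin n → ℝ) × (S → ℝ)))
      (α : (Fin n → ℝ) × (S → ℝ) → ((Fin n → ℝ) × (S → ℝ)) [⋀^Fin p]→L[ℝ] ℝ),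
      IsOpen W ∧ restrictTo S (c.coord q) ∈ W ∧ ContDiffOn ℝ ∞ α W ∧
      ∀ᶠ q' in 𝓝 q, ∀ hq' : q' ∈ c.dom, ∀ v : Fin p → Model n m,
        φ q' ⟨c, hq'⟩ v = α (restrictTo S (c.coord q')) (fun j => restrictTo S (v j))) ↔
      FiniteOrderFormAt (formRead c φ) (c.coord q)) := by
    intro c hq
    refine exists_congr fun S => exists_congr fun W => exists_congr fun α => and_congr_right
      fun _ => and_congr_right fun _ => and_congr_right fun _ => ?_
    exact (eventually_read (f := fun q hq => φ q ⟨c, hq⟩)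
      (P := fun a z => ∀ v, a v = α (restrictTo S z) fun j => restrictTo S (v j)) hq).symm
  constructor
  · rintro ⟨⟨h1, h2⟩, h3⟩
    have h4 := (hread hq).1 (h2 c hq)
    refine ⟨h1, h4, ?_⟩
    have h5 : ∀ᶠ z in 𝓝 (c.coord q), contactPart k z (formRead c φ z) = formRead c φ z :=
      (eventually_read (f := fun q hq => φ q ⟨c, hq⟩)
        (P := fun a z => contactPart k z a = a) hq).2 (h3.mono fun q' h hq' => h ⟨c, hq'⟩)
    filter_upwards [h5, h4.eventually] with z h6 h7
    exact (contactPart_eq_self_iff h7.isAlternating k z).1 h6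
  · rintro ⟨h1, h2, h3⟩
    have hfo : ∀ {q' : InfJet n m π} {c' : BundleChart n m π}, IsTensorialAt φ q' → q' ∈ c.dom →
        q' ∈ c'.dom → FiniteOrderFormAt (formRead c φ) (c.coord q') →
        FiniteOrderFormAt (formRead c' φ) (c'.coord q') := by
      intro q' c' h1 hq hq' h2
      refine (FiniteOrderFormAt.pullback ?_ (finiteOrderMapAt_transition hq' hq)).congr
        (h1.formRead_eq hq' hq)
      rwa [transition_coord hq']
    refine ⟨⟨h1, fun c' hq' => (hread hq').2 (hfo h1 hq hq' h2)⟩, ?_⟩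
    have h4 := (eventually_coord hq).2 (h2.eventually.and h3.eventually_nhds)
    filter_upwards [h4, eventually_mem_dom hq, Filter.Eventually.eventually_nhds h1]
      with q' ⟨h5, h6⟩ hqc h7 ⟨c', hq'⟩
    have h8 : HasContactDegreeAt k (formRead c' φ) (c'.coord q') := by
      refine ((isJetTransitionAt_transition hq' hqc).hasContactDegreeAt ?_).congr
        (IsTensorialAt.formRead_eq h7 hq' hqc)
      rwa [transition_coord hq']
    have h9 := (contactPart_eq_self_iff (hfo h7 hqc hq' h5).isAlternating k _).2 h8.self_of_nhds
    rwa [formRead_coord φ hq'] at h9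

theorem IsContactFormAt.finiteOrder {φ : ∀ q : InfJet n m π, FormValue p q}
    (h : IsContactFormAt k φ q) (hq : q ∈ c.dom) :
    FiniteOrderFormAt (formRead c φ) (c.coord q) := ((isContactFormAt_iff hq).1 h).2.1

theorem IsContactFormAt.hasContactDegreeAt {φ : ∀ q : InfJet n m π, FormValue p q}
    (h : IsContactFormAt k φ q) (hq : q ∈ c.dom) :
    HasContactDegreeAt k (formRead c φ) (c.coord q) := ((isContactFormAt_iff hq).1 h).2.2

theorem IsContactFormAt.isTensorialAt {φ : ∀ q : InfJet n m π, FormValue p q}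
    (h : IsContactFormAt k φ q) : IsTensorialAt φ q := h.1.1

theorem IsContactFormAt.eventually {φ : ∀ q : InfJet n m π, FormValue p q}
    (h : IsContactFormAt k φ q) (hq : q ∈ c.dom) : ∀ᶠ q' in 𝓝 q, IsContactFormAt k φ q' := by
  have h4 := (eventually_coord hq).2
    ((h.finiteOrder hq).eventually.and (h.hasContactDegreeAt hq).eventually_nhds)
  filter_upwards [h4, eventually_mem_dom hq, Filter.Eventually.eventually_nhds h.isTensorialAt]
    with q' h5 h6 h7 using (isContactFormAt_iff h6).2 ⟨h7, h5.1, h5.2⟩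

theorem formRead_congr {φ ψ : ∀ q : InfJet n m π, FormValue p q} (hq : q ∈ c.dom)
    (h : ∀ᶠ q' in 𝓝 q, φ q' = ψ q') : formRead c φ =ᶠ[𝓝 (c.coord q)] formRead c ψ :=
  (formRead_eventuallyEq hq).2 (h.mono fun q' e hq' => by rw [formRead_coord ψ hq', e])

theorem IsContactFormAt.congr {φ ψ : ∀ q : InfJet n m π, FormValue p q}
    (h : IsContactFormAt k φ q) (hq : q ∈ c.dom) (e : ∀ᶠ q' in 𝓝 q, ψ q' = φ q') :
    IsContactFormAt k ψ q := by
  refine (isContactFormAt_iff hq).2 ⟨?_, (h.finiteOrder hq).congr (formRead_congr hq e),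
    (h.hasContactDegreeAt hq).congr (formRead_congr hq e)⟩
  filter_upwards [h.isTensorialAt, e] with q' h1 h2 c c' v
  rw [h2, h1 c c' v]

theorem formRead_add (φ ψ : ∀ q : InfJet n m π, FormValue p q) (hq : q ∈ c.dom) :
    formRead c (φ + ψ) =ᶠ[𝓝 (c.coord q)] formRead c φ + formRead c ψ :=
  (formRead_eventuallyEq hq).2 (.of_forall fun q' hq' => by
    rw [Pi.add_apply, Pi.add_apply, Pi.add_apply, formRead_coord φ hq', formRead_coord ψ hq'])

theorem formRead_smul (f : InfJet n m π → ℝ) (φ : ∀ q : InfJet n m π, FormValue p q)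
    (hq : q ∈ c.dom) : formRead c (fun q => f q • φ q) =ᶠ[𝓝 (c.coord q)]
      funSmul (c.read fun q _ => f q) (formRead c φ) :=
  (formRead_eventuallyEq hq).2 (.of_forall fun q' hq' => by
    rw [funSmul, formRead_coord φ hq', read_coord (fun q _ => f q) hq']; rfl)

theorem IsContactFormAt.zero (hq : q ∈ c.dom) :
    IsContactFormAt k (0 : ∀ q : InfJet n m π, FormValue p q) q := by
  have e : formRead c (0 : ∀ q : InfJet n m π, FormValue p q) =ᶠ[𝓝 (c.coord q)] 0 :=
    (formRead_eventuallyEq hq).2 (.of_forall fun q' hq' => rfl)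
  refine (isContactFormAt_iff hq).2 ⟨.of_forall fun _ _ _ _ => rfl,
    (finiteOrderFormAt_zero _).congr e, HasContactDegreeAt.congr (.of_forall fun z => ?_) e⟩
  funext v
  simp [derivAction]

theorem IsContactFormAt.add {φ ψ : ∀ q : InfJet n m π, FormValue p q}
    (hφ : IsContactFormAt k φ q) (hψ : IsContactFormAt k ψ q) (hq : q ∈ c.dom) :
    IsContactFormAt k (φ + ψ) q := by
  have e := formRead_add φ ψ hq
  refine (isContactFormAt_iff hq).2 ⟨?_,
    ((hφ.finiteOrder hq).add (hψ.finiteOrder hq)).congr e, HasContactDegreeAt.congr ?_ e⟩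
  · filter_upwards [hφ.isTensorialAt, hψ.isTensorialAt] with q' h1 h2 c c' v
    exact congrArg₂ (· + ·) (h1 c c' v) (h2 c c' v)
  · filter_upwards [hφ.hasContactDegreeAt hq, hψ.hasContactDegreeAt hq] with z h1 h2
    rw [Pi.add_apply, smul_add, ← h1, ← h2]
    funext v
    exact Finset.sum_add_distrib

/-- The product of a contact form with a function of locally finite order. -/
theorem IsContactFormAt.smul {f : InfJet n m π → ℝ} {φ : ∀ q : InfJet n m π, FormValue p q}
    (hφ : IsContactFormAt k φ q) (hq : q ∈ c.dom)
    (hf : FiniteOrderAt (c.read fun q _ => f q) (c.coord q)) :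
    IsContactFormAt k (fun q => f q • φ q) q := by
  have e := formRead_smul f φ hq
  refine (isContactFormAt_iff hq).2 ⟨?_, (FiniteOrderFormAt.funSmul hf (hφ.finiteOrder hq)).congr e,
    ((hφ.hasContactDegreeAt hq).funSmul _).congr e⟩
  filter_upwards [hφ.isTensorialAt] with q' h1 c c' v
  exact congrArg (f q' * ·) (h1 c c' v)

theorem finiteOrderAt_read_const (r : ℝ) (hq : q ∈ c.dom) :
    FiniteOrderAt (c.read fun (_ : InfJet n m π) _ => r) (c.coord q) :=
  (finiteOrderAt_const r _).congr ((eventually_read (f := fun (_ : InfJet n m π) _ => r)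
    (P := fun a _ => a = r) hq).2 (.of_forall fun _ _ => rfl))

theorem IsContactFormAt.const_smul {φ : ∀ q : InfJet n m π, FormValue p q}
    (hφ : IsContactFormAt k φ q) (hq : q ∈ c.dom) (r : ℝ) : IsContactFormAt k (r • φ) q :=
  hφ.smul hq (finiteOrderAt_read_const r hq)

theorem IsLocallyFiniteOrder.finiteOrderAt {f : InfJet n m π → ℝ} (hf : IsLocallyFiniteOrder f)
    (hq : q ∈ c.dom) : FiniteOrderAt (c.read fun q _ => f q) (c.coord q) := by
  obtain ⟨S, W, g, hW, hz, hg, h⟩ := hf q c hq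
  exact ⟨S, W, g, hW, hz, hg, (eventually_read (f := fun (q : InfJet n m π) _ => f q)
    (P := fun a z => a = g (restrictTo S z)) hq).2 (h.mono fun _ e _ => e)⟩

/-! ### Properties of `τ` -/

theorem tau_congr {φ ψ : ∀ q : InfJet n m π, FormValue (p + 1) q}
    (h : ∀ᶠ q' in 𝓝 q, φ q' = ψ q') : tau k φ q = tau k ψ q := by
  funext c v
  have e : (fun z => contactPart k z (formRead c.1 φ z)) =ᶠ[𝓝 (c.1.coord q)]
      fun z => contactPart k z (formRead c.1 ψ z) :=
    (formRead_congr c.2 h).mono fun z hz => by simp only [hz]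
  exact congrArg (1 / (k : ℝ) * ·) (congrFun (tauBar_congr e).self_of_nhds v)

theorem tau_apply {φ : ∀ q : InfJet n m π, FormValue (p + 1) q} (hφ : IsContactFormAt k φ q)
    (hq : q ∈ c.dom) : tau k φ q ⟨c, hq⟩ = (1 / (k : ℝ)) • tauBar (formRead c φ) (c.coord q) := by
  funext v
  have e : (fun z => contactPart k z (formRead c φ z)) =ᶠ[𝓝 (c.coord q)] formRead c φ := by
    filter_upwards [hφ.hasContactDegreeAt hq, (hφ.finiteOrder hq).eventually] with z h1 h2
    exact (contactPart_eq_self_iff h2.isAlternating k z).2 h1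
  exact congrArg (1 / (k : ℝ) * ·) (congrFun (tauBar_congr e).self_of_nhds v)

theorem formRead_tau {φ : ∀ q : InfJet n m π, FormValue (p + 1) q} (hφ : IsContactFormAt k φ q)
    (hq : q ∈ c.dom) : formRead c (tau k φ) =ᶠ[𝓝 (c.coord q)]
      (1 / (k : ℝ)) • tauBar (formRead c φ) :=
  (formRead_eventuallyEq hq).2 ((hφ.eventually hq).mono fun _ h hq' => tau_apply h hq')

theorem tau_add {φ ψ : ∀ q : InfJet n m π, FormValue (p + 1) q} (hφ : IsContactFormAt k φ q)
    (hψ : IsContactFormAt k ψ q) : tau k (φ + ψ) q = tau k φ q + tau k ψ q := by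
  funext ⟨c, hq⟩
  rw [tau_apply (hφ.add hψ hq) hq, Pi.add_apply, tau_apply hφ hq, tau_apply hψ hq,
    (tauBar_congr (formRead_add φ ψ hq)).self_of_nhds,
    (tauBar_add (hφ.finiteOrder hq) (hψ.finiteOrder hq)).self_of_nhds, Pi.add_apply, smul_add]

theorem tau_const_smul {φ : ∀ q : InfJet n m π, FormValue (p + 1) q} (hφ : IsContactFormAt k φ q)
    (r : ℝ) : tau k (r • φ) q = r • tau k φ q := by
  funext ⟨c, hq⟩
  have e : formRead c (r • φ) =ᶠ[𝓝 (c.coord q)] r • formRead c φ :=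
    (formRead_eventuallyEq hq).2 (.of_forall fun q' hq' => by
      rw [Pi.smul_apply, Pi.smul_apply, Pi.smul_apply, formRead_coord φ hq'])
  rw [tau_apply (hφ.const_smul hq r) hq, Pi.smul_apply, tau_apply hφ hq,
    (tauBar_congr e).self_of_nhds, (tauBar_const_smul (hφ.finiteOrder hq) r).self_of_nhds,
    Pi.smul_apply, smul_comm]

theorem tau_zero (q : InfJet n m π) :
    tau k (0 : ∀ q : InfJet n m π, FormValue (p + 1) q) q = 0 := by
  funext ⟨c, hq⟩
  have := tau_const_smul (k := k) (φ := (0 : ∀ q : InfJet n m π, FormValue (p + 1) q))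
    (IsContactFormAt.zero hq) 0
  rw [zero_smul, zero_smul] at this
  rw [this]

/-- The operator `τ` maps contact forms to contact forms. In particular its definition does not
depend on the charts. -/
theorem IsContactFormAt.tau {φ : ∀ q : InfJet n m π, FormValue (p + 1) q} (hp : p + 1 = k + n)
    (hk : 0 < k) (hφ : IsContactFormAt k φ q) (hq : q ∈ c.dom) : IsContactFormAt k (tau k φ) q := by
  obtain ⟨k, rfl⟩ := Nat.exists_eq_add_of_lt hk
  simp only [zero_add] at hp hφ ⊢
  have e := formRead_tau hφ hq
  refine (isContactFormAt_iff hq).2 ⟨?_, ((hφ.finiteOrder hq).tauBar.const_smul _).congr e,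
    (((hφ.hasContactDegreeAt hq).tauBar (hφ.finiteOrder hq)).const_smul _).congr e⟩
  filter_upwards [hφ.eventually hq] with q' h ⟨c, hc⟩ ⟨c', hc'⟩ v
  rw [tau_apply h hc, tau_apply h hc',
    (tauBar_congr (h.isTensorialAt.formRead_eq hc hc')).self_of_nhds]
  have hφ' : FiniteOrderFormAt (formRead c' φ) (transition c c' (c.coord q')) := by
    rw [transition_coord hc]; exact h.finiteOrder hc'
  have hk' : HasContactDegreeAt ((k : ℝ) + 1) (formRead c' φ) (transition c c' (c.coord q')) := by
    rw [transition_coord hc]; exact_mod_cast h.hasContactDegreeAt hc'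
  rw [((isJetTransitionAt_transition hc hc').tauBar_formPullback (k := k) (by omega)
    hφ' hk').self_of_nhds]
  simp only [Pi.smul_apply, formPullback, transition_coord hc]
  rfl

/-- The operator `τ` is a projector. -/
theorem tau_tau {φ : ∀ q : InfJet n m π, FormValue (p + 1) q} (hp : p + 1 = k + n)
    (hk : 0 < k) (hφ : IsContactFormAt k φ q) : tau k (tau k φ) q = tau k φ q := by
  funext ⟨c, hq⟩
  have hT := (hφ.finiteOrder hq).tauBar
  rw [tau_apply (hφ.tau hp hk hq) hq, tau_apply hφ hq,
    (tauBar_congr (formRead_tau hφ hq)).self_of_nhds, (tauBar_const_smul hT _).self_of_nhds,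
    Pi.smul_apply, (tauBar_tauBar (hφ.hasContactDegreeAt hq) (hφ.finiteOrder hq)).self_of_nhds,
    Pi.smul_apply, smul_smul (1 / (k : ℝ)) (k : ℝ), one_div_mul_cancel (by positivity), one_smul]

end Tau

/-! ### Existence of bundle charts -/

section ChartExistence

/-- A chart of a manifold with values in `ℝ^d`, given by coordinates. -/
def coordChart (d : ℕ) {M : Type*} [TopologicalSpace M] [ChartedSpace (EuclideanSpace ℝ (Fin d)) M]
    (x : M) : OpenPartialHomeomorph M (Fin d → ℝ) :=
  (chartAt (EuclideanSpace ℝ (Fin d)) x).transHomeomorph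
    (EuclideanSpace.equiv (Fin d) ℝ).toHomeomorph

variable {d : ℕ} {M : Type*} [TopologicalSpace M] [ChartedSpace (EuclideanSpace ℝ (Fin d)) M]

theorem mem_coordChart_source (x : M) : x ∈ (coordChart d x).source :=
  mem_chart_source (EuclideanSpace ℝ (Fin d)) x

theorem contMDiffOn_coordChart [IsManifold (𝓡 d) ∞ M] (x : M) :
    ContMDiffOn (𝓡 d) 𝓘(ℝ, Fin d → ℝ) ∞ (coordChart d x) (coordChart d x).source :=
  (EuclideanSpace.equiv (Fin d) ℝ).contDiff.contMDiff.comp_contMDiffOn contMDiffOn_chart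

theorem contMDiffOn_coordChart_symm [IsManifold (𝓡 d) ∞ M] (x : M) :
    ContMDiffOn 𝓘(ℝ, Fin d → ℝ) (𝓡 d) ∞ (coordChart d x).symm (coordChart d x).target :=
  contMDiffOn_chart_symm.comp
    (EuclideanSpace.equiv (Fin d) ℝ).symm.contDiff.contMDiff.contMDiffOn fun _ h => h

theorem IsSmoothBundle.exists_chart {n m : ℕ} {X Y : Type u} {F : Type v}
    [TopologicalSpace X] [ChartedSpace (EuclideanSpace ℝ (Fin n)) X] [IsManifold (𝓡 n) ∞ X]
    [TopologicalSpace Y] [ChartedSpace (EuclideanSpace ℝ (Fin (n + m))) Y]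
    [TopologicalSpace F] [ChartedSpace (EuclideanSpace ℝ (Fin m)) F] [IsManifold (𝓡 m) ∞ F]
    {π : Y → X} (hπ : IsSmoothBundle n m F π) (y : Y) :
    ∃ c : BundleChart n m π, y ∈ c.total.source := by
  obtain ⟨e, he, h1, h2⟩ := hπ (π y)
  have hy : y ∈ e.source := e.mem_source.2 he
  let φ : OpenPartialHomeomorph X (Fin n → ℝ) := coordChart n (π y)
  let ψ : OpenPartialHomeomorph F (Fin m → ℝ) := coordChart m (e y).2
  have hφ := contMDiffOn_coordChart (d := n) (π y)
  have hφ' := contMDiffOn_coordChart_symm (d := n) (π y)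
  have hψ := contMDiffOn_coordChart (d := m) (e y).2
  have hψ' := contMDiffOn_coordChart_symm (d := m) (e y).2
  refine ⟨{ base := φ
            total := e.toOpenPartialHomeomorph.trans (φ.prod ψ)
            contMDiffOn_base := hφ
            contMDiffOn_base_symm := hφ'
            contMDiffOn_total := ?_
            contMDiffOn_total_symm := ?_
            mapsTo := ?_
            fst_total := ?_ }, ?_⟩
  · have h3 := h1.mono (inter_subset_left :
      (e.toOpenPartialHomeomorph.trans (φ.prod ψ)).source ⊆ e.source)
    refine ContMDiffOn.prodMk_space (hφ.comp (contMDiff_fst.comp_contMDiffOn h3) fun z hz => ?_)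
      (hψ.comp (contMDiff_snd.comp_contMDiffOn h3) fun z hz => ?_)
    · exact hz.2.1
    · exact hz.2.2
  · have h3 : ContMDiffOn 𝓘(ℝ, (Fin n → ℝ) × (Fin m → ℝ)) ((𝓡 n).prod (𝓡 m)) ∞
        (fun w => (φ.symm w.1, ψ.symm w.2)) (φ.target ×ˢ ψ.target) :=
      ContMDiffOn.prodMk (hφ'.comp contDiff_fst.contMDiff.contMDiffOn fun w hw => hw.1)
        (hψ'.comp contDiff_snd.contMDiff.contMDiffOn fun w hw => hw.2)
    exact h2.comp (h3.mono fun w hw => hw.1) fun w hw => hw.2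
  · intro z hz
    have h3 : (e z).1 ∈ φ.source := hz.2.1
    rwa [e.coe_fst hz.1] at h3
  · intro z hz
    change φ (e z).1 = φ (π z)
    rw [e.coe_fst hz.1]
  · refine ⟨hy, ?_, mem_coordChart_source (d := m) (e y).2⟩
    change (e y).1 ∈ φ.source
    rw [e.coe_fst hy]
    exact mem_coordChart_source (d := n) (π y)

/-- A connected paracompact locally compact Hausdorff space is `σ`-compact: starting from one set
of a locally finite covering by relatively compact open sets, one reaches only countably many
others, and these exhaust the space by connectedness. -/
theorem sigmaCompactSpace_of_connected (Z : Type*) [TopologicalSpace Z] [T2Space Z]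
    [ParacompactSpace Z] [ConnectedSpace Z] [WeaklyLocallyCompactSpace Z] :
    SigmaCompactSpace Z := by
  choose K hK hKn using fun z : Z => exists_compact_mem_nhds z
  obtain ⟨t, ht, hcov, hfin, htK⟩ := precise_refinement (fun z => interior (K z))
    (fun _ => isOpen_interior)
    (iUnion_eq_univ_iff.2 fun z => ⟨z, mem_interior_iff_mem_nhds.2 (hKn z)⟩)
  obtain ⟨z₀⟩ : Nonempty Z := inferInstance
  obtain ⟨a₀, ha₀⟩ := mem_iUnion.1 (hcov ▸ mem_univ z₀)
  -- the indices reached from `a₀` in `k` steps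
  let A : ℕ → Set Z := fun k =>
    Nat.rec {a₀} (fun _ B => ⋃ a ∈ B, {b | (t b ∩ K a).Nonempty}) k
  have hA : ∀ k, (A k).Finite := by
    intro k
    induction k with
    | zero => exact finite_singleton a₀
    | succ k ih => exact ih.biUnion fun a _ => hfin.finite_nonempty_inter_compact (hK a)
  have hne : (⋃ a ∈ ⋃ k, A k, t a).Nonempty :=
    ⟨z₀, mem_biUnion (mem_iUnion.2 ⟨0, mem_singleton a₀⟩) ha₀⟩
  have hcl : IsClosed (⋃ a ∈ ⋃ k, A k, t a) := by
    refine isClosed_of_closure_subset fun z hz => ?_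
    obtain ⟨b, hb⟩ := mem_iUnion.1 (hcov ▸ mem_univ z)
    obtain ⟨z', h1, h2⟩ := mem_closure_iff.1 hz (t b) (ht b) hb
    obtain ⟨a, ha, h3⟩ := mem_iUnion₂.1 h2
    obtain ⟨k, hk⟩ := mem_iUnion.1 ha
    exact mem_biUnion (mem_iUnion.2 ⟨k + 1, mem_biUnion hk
      ⟨z', h1, interior_subset (htK a h3)⟩⟩) hb
  have huniv := IsClopen.eq_univ ⟨hcl, isOpen_biUnion fun a _ => ht a⟩ hne
  refine SigmaCompactSpace.of_countable (K '' ⋃ k, A k)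
    ((countable_iUnion fun k => (hA k).countable).image K) ?_ ?_
  · rintro _ ⟨a, _, rfl⟩
    exact hK a
  · refine eq_univ_of_forall fun z => ?_
    obtain ⟨a, ha, hz⟩ := mem_iUnion₂.1 (huniv ▸ mem_univ z)
    exact ⟨K a, mem_image_of_mem K ha, interior_subset (htK a hz)⟩

end ChartExistence

/-! ### Functions of locally finite order -/

section LocallyFiniteOrder

variable {n m : ℕ} {X Y : Type u}
  [TopologicalSpace X] [ChartedSpace (EuclideanSpace ℝ (Fin n)) X]
  [TopologicalSpace Y] [ChartedSpace (EuclideanSpace ℝ (Fin (n + m))) Y] {π : Y → X}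
  {q : InfJet n m π} {c c' : BundleChart n m π}

open InfJet

/-- Near `q`, in every chart, the function `f` is a smooth function of finitely many jet
coordinates. -/
def FiniteOrderJetAt (f : InfJet n m π → ℝ) (q : InfJet n m π) : Prop :=
  ∀ c : BundleChart n m π, q ∈ c.dom → ∃ F : Model n m → ℝ, FiniteOrderAt F (c.coord q) ∧
    ∀ᶠ q' in 𝓝 q, f q' = F (c.coord q')

theorem isLocallyFiniteOrder_iff {f : InfJet n m π → ℝ} :
    IsLocallyFiniteOrder f ↔ ∀ q, FiniteOrderJetAt f q := by
  constructor
  · intro h q c hq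
    obtain ⟨S, W, g, hW, hz, hg, e⟩ := h q c hq
    exact ⟨fun z => g (restrictTo S z), .of_restrictTo S hW hz hg, e⟩
  · intro h q c hq
    obtain ⟨F, ⟨S, W, g, hW, hz, hg, e⟩, e'⟩ := h q c hq
    refine ⟨S, W, g, hW, hz, hg, ?_⟩
    filter_upwards [e', (eventually_coord hq).2 e] with q' h1 h2 using h1.trans h2

theorem FiniteOrderJetAt.of_chart {f : InfJet n m π → ℝ} {F : Model n m → ℝ} (hq : q ∈ c.dom)
    (hF : FiniteOrderAt F (c.coord q)) (h : ∀ᶠ q' in 𝓝 q, f q' = F (c.coord q')) :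
    FiniteOrderJetAt f q := by
  intro c' hq'
  refine ⟨fun z => F (transition c' c z), FiniteOrderAt.comp_map (by rwa [transition_coord hq'])
    (finiteOrderMapAt_transition hq' hq).self_of_nhds, ?_⟩
  filter_upwards [h, eventually_mem_dom hq'] with q' h1 h2
  rw [h1, transition_coord h2]

theorem FiniteOrderJetAt.congr {f g : InfJet n m π → ℝ} (hf : FiniteOrderJetAt f q)
    (h : g =ᶠ[𝓝 q] f) : FiniteOrderJetAt g q := fun c hq =>
  let ⟨F, hF, e⟩ := hf c hq
  ⟨F, hF, by filter_upwards [h, e] with q' h1 h2 using h1.trans h2⟩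

theorem finiteOrderJetAt_const (r : ℝ) (q : InfJet n m π) : FiniteOrderJetAt (fun _ => r) q :=
  fun _ _ => ⟨fun _ => r, finiteOrderAt_const r _, .of_forall fun _ => rfl⟩

theorem FiniteOrderJetAt.comp {f : InfJet n m π → ℝ} (hf : FiniteOrderJetAt f q) {s : ℝ → ℝ}
    (hs : ContDiff ℝ ∞ s) : FiniteOrderJetAt (fun q => s (f q)) q := fun c hq =>
  let ⟨F, hF, e⟩ := hf c hq
  ⟨fun z => s (F z), hF.contDiff_comp hs, e.mono fun _ h => congrArg s h⟩

theorem FiniteOrderJetAt.mul {f g : InfJet n m π → ℝ} (hf : FiniteOrderJetAt f q)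
    (hg : FiniteOrderJetAt g q) : FiniteOrderJetAt (fun q => f q * g q) q := fun c hq =>
  let ⟨F, hF, e⟩ := hf c hq
  let ⟨G, hG, e'⟩ := hg c hq
  ⟨fun z => F z * G z, hF.mul hG, by filter_upwards [e, e'] with q' h1 h2 using by rw [h1, h2]⟩

theorem FiniteOrderJetAt.div {f g : InfJet n m π → ℝ} (hf : FiniteOrderJetAt f q)
    (hg : FiniteOrderJetAt g q) (h0 : g q ≠ 0) : FiniteOrderJetAt (fun q => f q / g q) q := by
  intro c hq
  obtain ⟨F, hF, e⟩ := hf c hq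
  obtain ⟨G, hG, e'⟩ := hg c hq
  refine ⟨fun z => F z / G z, (hF.prodMk hG).comp (W := {x | x.2 ≠ 0})
    (g := fun x : ℝ × ℝ => x.1 / x.2) (isOpen_ne_fun continuous_snd continuous_const)
    (contDiffOn_fst.div contDiffOn_snd fun x hx => hx) ?_, ?_⟩
  · change G (c.coord q) ≠ 0
    rwa [← e'.self_of_nhds]
  · filter_upwards [e, e'] with q' h1 h2 using by rw [h1, h2]

theorem FiniteOrderJetAt.sum {κ : Type*} {s : Finset κ} {f : κ → InfJet n m π → ℝ}
    (hf : ∀ a ∈ s, FiniteOrderJetAt (f a) q) : FiniteOrderJetAt (fun q => ∑ a ∈ s, f a q) q := by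
  intro c hq
  choose! F hF e using fun a ha => hf a ha c hq
  refine ⟨fun z => ∑ a ∈ s, F a z, .sum hF, ?_⟩
  filter_upwards [(Finset.eventually_all s).2 e] with q' h using Finset.sum_congr rfl h

theorem FiniteOrderJetAt.prod {κ : Type*} {s : Finset κ} {f : κ → InfJet n m π → ℝ}
    (hf : ∀ a ∈ s, FiniteOrderJetAt (f a) q) : FiniteOrderJetAt (fun q => ∏ a ∈ s, f a q) q := by
  intro c hq
  choose! F hF e using fun a ha => hf a ha c hq
  refine ⟨fun z => ∏ a ∈ s, F a z, .prod hF, ?_⟩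
  filter_upwards [(Finset.eventually_all s).2 e] with q' h using Finset.prod_congr rfl h

theorem FiniteOrderJetAt.continuousAt {f : InfJet n m π → ℝ} (hf : FiniteOrderJetAt f q)
    (hq : q ∈ c.dom) : ContinuousAt f q := by
  obtain ⟨F, hF, e⟩ := hf c hq
  exact (ContinuousAt.comp (f := c.coord) (g := F) hF.continuousAt (continuousAt_coord hq)).congr
    (e.mono fun _ h => h.symm)

theorem continuous_val (hc : ∀ y : Y, ∃ c : BundleChart n m π, y ∈ c.total.source) :
    Continuous (val : InfJet n m π → Y) :=
  continuous_iff_continuousAt.2 fun q =>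
    let ⟨_, hcq⟩ := hc (val q)
    continuousAt_val hcq

theorem isInducing_coord (c : BundleChart n m π) : IsInducing fun q : c.dom => c.coord q.1 := by
  refine isInducing_iff_nhds.2 fun q => ?_
  rw [nhds_subtype_eq_comap, nhds_eq_comap_coord q.2, comap_inf, comap_comap, comap_principal,
    Subtype.coe_preimage_self, principal_univ, inf_top_eq]
  rfl

theorem secondCountableTopology_infJet
    (hc : ∀ y : Y, ∃ c : BundleChart n m π, y ∈ c.total.source) [SecondCountableTopology Y] :
    SecondCountableTopology (InfJet n m π) := by
  choose c hcy using hc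
  obtain ⟨s, hs, hcov⟩ := TopologicalSpace.countable_cover_nhds fun y : Y =>
    (c y).total.open_source.mem_nhds (hcy y)
  have := hs.to_subtype
  have : ∀ y : s, SecondCountableTopology (c y).dom := fun y =>
    (isInducing_coord (c y)).secondCountableTopology
  refine secondCountableTopology_of_countable_cover (U := fun y : s => (c y).dom)
    (fun y => isOpen_dom _) (eq_univ_of_forall fun q => ?_)
  obtain ⟨y, hy, hq⟩ := mem_iUnion₂.1 (hcov ▸ mem_univ (val q))
  exact mem_iUnion.2 ⟨⟨y, hy⟩, hq⟩

/-! ### Bump functions -/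

theorem exists_restrictTo_preimage_subset {z : Model n m} {t : Set (Model n m)} (ht : t ∈ 𝓝 z) :
    ∃ S : Finset (Fin m × MultiIndex n), (∀ i, (i, 0) ∈ S) ∧
      ∃ s ∈ 𝓝 (restrictTo S z), restrictTo S ⁻¹' s ⊆ t := by
  classical
  rw [nhds_prod_eq] at ht
  obtain ⟨t₁, h1, t₂, h2, h3⟩ := mem_prod_iff.1 ht
  rw [nhds_pi] at h2
  obtain ⟨I, hI, w, hw, h4⟩ := Filter.mem_pi.1 h2
  refine ⟨hI.toFinset ∪ Finset.univ.image fun i => (i, 0), fun i => by simp,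
    t₁ ×ˢ (univ.pi fun a => w a.1), ?_, fun z' hz' => h3 ⟨hz'.1, h4 fun a ha => ?_⟩⟩
  · rw [restrictTo]
    exact prod_mem_nhds h1 (set_pi_mem_nhds finite_univ fun a _ => hw a)
  · exact hz'.2 ⟨a, by simp [ha]⟩ (mem_univ _)

/-- A bump function at `q`. Its support in `J^∞ Y` is closed since it is bounded, by closed
conditions, inside the preimage of a compact subset of the domain of a bundle chart. -/
theorem exists_bump [T2Space Y] (hc : ∀ y : Y, ∃ c : BundleChart n m π, y ∈ c.total.source)
    (q : InfJet n m π) {U : Set (InfJet n m π)} (hU : U ∈ 𝓝 q) :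
    ∃ f : InfJet n m π → ℝ, (∀ q', FiniteOrderJetAt f q') ∧ 0 < f q ∧ tsupport f ⊆ U := by
  classical
  obtain ⟨c, hcq⟩ := hc (val q)
  have hq : q ∈ c.dom := hcq
  rw [nhds_eq_comap_coord hq, mem_inf_principal, mem_comap] at hU
  obtain ⟨t, ht, htU⟩ := hU
  have ht' := inter_mem ht ((c.total.open_target.preimage continuous_orderZero).mem_nhds
    (orderZero_coord_mem_target hq))
  -- `S` contains the indices of order zero, so that the coordinates of the point of `Y` are seen
  obtain ⟨S, hS0, s, hs, hst⟩ := exists_restrictTo_preimage_subset ht'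
  obtain ⟨ε, hε, hball⟩ := Metric.nhds_basis_closedBall.mem_iff.1 hs
  let χ : ContDiffBump (restrictTo S (c.coord q)) := ⟨ε / 2, ε, half_pos hε, half_lt_self hε⟩
  let D : Set ((Fin n → ℝ) × (S → ℝ)) := Metric.closedBall (restrictTo S (c.coord q)) ε
  have hD : ∀ z : Model n m, restrictTo S z ∈ D → z ∈ t ∧ orderZero z ∈ c.total.target :=
    fun z hz => hst (hball hz)
  -- the compact set of `Y` under the support
  let w : (Fin n → ℝ) × (S → ℝ) → (Fin n → ℝ) × (Fin m → ℝ) :=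
    fun x => (x.1, fun i => x.2 ⟨(i, 0), hS0 i⟩)
  have hw : Continuous w := by fun_prop
  have hwD : w '' D ⊆ c.total.target := by
    rintro _ ⟨x, hx, rfl⟩
    have e : restrictTo S ((x.1, fun a => if h : a ∈ S then x.2 ⟨a, h⟩ else 0) : Model n m) = x :=
      Prod.ext rfl (funext fun a => by simp [restrictTo])
    have := (hD _ (by rw [e]; exact hx)).2
    have e' : orderZero ((x.1, fun a => if h : a ∈ S then x.2 ⟨a, h⟩ else 0) : Model n m) = w x :=
      Prod.ext rfl (funext fun i => by simp [orderZero, w, hS0 i])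
    rwa [e'] at this
  have hKc : IsClosed (c.total.symm '' (w '' D)) :=
    (((isCompact_closedBall _ _).image hw).image_of_continuousOn
      (c.total.symm.continuousOn.mono hwD)).isClosed
  let A : Set (InfJet n m π) := {q' | q' ∈ c.dom ∧ restrictTo S (c.coord q') ∈ D}
  have hA : IsClosed A := by
    refine isOpen_compl_iff.1 (isOpen_iff_mem_nhds.2 fun q' hq' => ?_)
    by_cases hd : q' ∈ c.dom
    · have h1 : restrictTo S (c.coord q') ∈ Dᶜ := fun h => hq' ⟨hd, h⟩
      have h2 : ContinuousAt (fun q => restrictTo S (c.coord q)) q' :=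
        ContinuousAt.comp (f := c.coord) (g := restrictTo S) (continuous_restrictTo S).continuousAt
          (continuousAt_coord hd)
      filter_upwards [h2.preimage_mem_nhds (Metric.isClosed_closedBall.isOpen_compl.mem_nhds h1)]
        with q'' h3 h4 using h3 h4.2
    · have h1 : val q' ∈ (c.total.symm '' (w '' D))ᶜ := by
        rintro ⟨x, hx, e⟩
        refine hd ?_
        change val q' ∈ c.total.source
        rw [← e]
        exact c.total.map_target (hwD hx)
      filter_upwards [(hKc.isOpen_compl.preimage (continuous_val hc)).mem_nhds h1] with q'' h3 h4
      refine h3 ?_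
      rw [val_eq_symm h4.1]
      exact mem_image_of_mem _ ⟨_, h4.2, rfl⟩
  let f : InfJet n m π → ℝ := fun q' => if q' ∈ c.dom then χ (restrictTo S (c.coord q')) else 0
  have hfA : ∀ q' ∉ A, f q' = 0 := by
    intro q' hq'
    by_cases hd : q' ∈ c.dom
    · simp only [f, if_pos hd]
      refine χ.zero_of_le_dist (le_of_lt ?_)
      by_contra hle
      exact hq' ⟨hd, Metric.mem_closedBall.2 (not_lt.1 hle)⟩
    · simp only [f, if_neg hd]
  have hts : tsupport f ⊆ A :=
    closure_minimal (fun q' hq' => by_contra fun h => hq' (hfA q' h)) hA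
  refine ⟨f, fun q' => ?_, ?_, hts.trans fun q' h => htU (hD _ h.2).1 h.1⟩
  · by_cases hd : q' ∈ c.dom
    · refine FiniteOrderJetAt.of_chart (F := fun z => χ (restrictTo S z)) hd
        (.of_restrictTo S isOpen_univ (mem_univ _) χ.contDiff.contDiffOn) ?_
      filter_upwards [eventually_mem_dom hd] with q'' h using if_pos h
    · refine (finiteOrderJetAt_const 0 q').congr ?_
      filter_upwards [hA.isOpen_compl.mem_nhds fun h => hd h.1] with q'' h using hfA q'' h
  · simp only [f, if_pos hq]
    exact χ.pos_of_mem_ball (Metric.mem_ball_self χ.rOut_pos)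

end LocallyFiniteOrder

/-! ### Partitions of unity of locally finite order -/

section PartitionOfUnity

variable {n m : ℕ} {X Y : Type u}
  [TopologicalSpace X] [ChartedSpace (EuclideanSpace ℝ (Fin n)) X]
  [TopologicalSpace Y] [ChartedSpace (EuclideanSpace ℝ (Fin (n + m))) Y] {π : Y → X}

/-- A countable family of non-negative functions of locally finite order, locally finite and
nowhere all zero, subordinate to the supports of countably many given functions: with
`s = expNegInvGlue`, which is positive exactly on the positive reals, the function
`s (h n) ∏_{j < n} s (1 / (n + 1) - h j)` is positive where `h n` is the first positive function,
and it vanishes where some `h j`, `j < n`, is at least `1 / (n + 1)`. -/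
theorem exists_locallyFinite_family (hc : ∀ q : InfJet n m π, ∃ c : BundleChart n m π, q ∈ c.dom)
    {h : ℕ → InfJet n m π → ℝ} (hf : ∀ k q, FiniteOrderJetAt (h k) q)
    (hcov : ∀ q, ∃ k, 0 < h k q) :
    ∃ g : ℕ → InfJet n m π → ℝ, (∀ k q, FiniteOrderJetAt (g k) q) ∧ (∀ k q, 0 ≤ g k q) ∧
      (∀ q, ∃ k, 0 < g k q) ∧ (∀ k, tsupport (g k) ⊆ tsupport (h k)) ∧
      ∀ q, ∃ N, ∀ᶠ q' in 𝓝 q, ∀ k, N ≤ k → g k q' = 0 := by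
  have hs : ContDiff ℝ ∞ expNegInvGlue := expNegInvGlue.contDiff
  refine ⟨fun k q => expNegInvGlue (h k q) *
    ∏ j ∈ Finset.range k, expNegInvGlue (1 / ((k : ℝ) + 1) - h j q), fun k q => ?_, fun k q => ?_,
    fun q => ?_, fun k => ?_, fun q => ?_⟩
  · exact ((hf k q).comp hs).mul (.prod fun j _ =>
      (hf j q).comp (s := fun x => expNegInvGlue (1 / ((k : ℝ) + 1) - x))
        (hs.comp (contDiff_const.sub contDiff_id)))
  · exact mul_nonneg (expNegInvGlue.nonneg _) (Finset.prod_nonneg fun _ _ => expNegInvGlue.nonneg _)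
  · classical
    refine ⟨Nat.find (hcov q), mul_pos (expNegInvGlue.pos_of_pos (Nat.find_spec (hcov q)))
      (Finset.prod_pos fun j hj => expNegInvGlue.pos_of_pos ?_)⟩
    have := not_lt.1 (Nat.find_min (hcov q) (Finset.mem_range.1 hj))
    have h1 : (0 : ℝ) < 1 / ((Nat.find (hcov q) : ℝ) + 1) := by positivity
    linarith
  · refine closure_mono fun q hq h0 => hq ?_
    change expNegInvGlue (h k q) * _ = 0
    rw [h0, expNegInvGlue.zero, zero_mul]
  · obtain ⟨j, hj⟩ := hcov q
    obtain ⟨c, hq⟩ := hc q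
    obtain ⟨N, hN⟩ := exists_nat_one_div_lt hj
    refine ⟨max N (j + 1), ?_⟩
    filter_upwards [((hf j q).continuousAt hq).eventually (lt_mem_nhds hN)] with q' hq' k hk
    refine mul_eq_zero_of_right _ (Finset.prod_eq_zero (Finset.mem_range.2
      (lt_of_lt_of_le (Nat.lt_succ_self j) ((le_max_right _ _).trans hk)))
      (expNegInvGlue.zero_of_nonpos ?_))
    have h1 : 1 / ((k : ℝ) + 1) ≤ 1 / ((N : ℝ) + 1) := by
      apply one_div_le_one_div_of_le (by positivity)
      have : (N : ℝ) ≤ k := by exact_mod_cast (le_max_left _ _).trans hk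
      linarith
    linarith

theorem exists_partitionOfUnity [T2Space Y] [SecondCountableTopology Y]
    (hc : ∀ y : Y, ∃ c : BundleChart n m π, y ∈ c.total.source) {ι : Type w}
    (U : ι → Opens (InfJet n m π)) (hU : (⨆ i, U i) = ⊤) :
    ∃ f : ι → InfJet n m π → ℝ, IsPartitionOfUnityFor U f := by
  classical
  rcases isEmpty_or_nonempty (InfJet n m π) with hempty | hne
  · exact ⟨fun _ _ => 0, fun i q => isEmptyElim q, fun i q => isEmptyElim q,
      fun i q => isEmptyElim q, fun q => isEmptyElim q⟩
  have hcd : ∀ q : InfJet n m π, ∃ c : BundleChart n m π, q ∈ c.dom := fun q => hc (InfJet.val q)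
  have := secondCountableTopology_infJet hc
  have hmem : ∀ q : InfJet n m π, ∃ i, q ∈ U i := fun q =>
    Opens.mem_iSup.1 (hU ▸ Opens.mem_top q)
  choose a ha using hmem
  choose b hb hb0 hbU using fun q => exists_bump hc q ((U (a q)).isOpen.mem_nhds (ha q))
  obtain ⟨s, hs, hscov⟩ := TopologicalSpace.countable_cover_nhds
    (f := fun q : InfJet n m π => {q' | 0 < b q q'}) fun q =>
    let ⟨c, hq⟩ := hcd q
    ((hb q q).continuousAt hq).eventually (lt_mem_nhds (hb0 q))
  have hsne : s.Nonempty := by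
    obtain ⟨q⟩ := hne
    obtain ⟨y, hy, -⟩ := mem_iUnion₂.1 (hscov ▸ mem_univ q)
    exact ⟨y, hy⟩
  obtain ⟨e, rfl⟩ := hs.exists_eq_range hsne
  obtain ⟨g, hg, hg0, hgpos, hgs, hgf⟩ := exists_locallyFinite_family hcd
    (h := fun k => b (e k)) (fun k => hb (e k)) fun q => by
      obtain ⟨_, ⟨k, rfl⟩, hk⟩ := mem_iUnion₂.1 (hscov ▸ mem_univ q)
      exact ⟨k, hk⟩
  have hsum : ∀ {N : ℕ} {q : InfJet n m π}, (∀ k, N ≤ k → g k q = 0) →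
      (∑ᶠ k, g k q = ∑ k ∈ Finset.range N, g k q) ∧ ∀ i, (∑ᶠ k, if a (e k) = i then g k q else 0) =
        ∑ k ∈ Finset.range N, if a (e k) = i then g k q else 0 := by
    intro N q hN
    have h1 : ∀ k, k ∉ Finset.range N → g k q = 0 := fun k hk => hN k (by simpa using hk)
    exact ⟨finsum_eq_sum_of_support_subset _ fun k hk => by_contra fun h => hk (h1 k h),
      fun i => finsum_eq_sum_of_support_subset _ fun k hk => by_contra fun h => hk (by
        simp only [h1 k h, ite_self])⟩
  have hpos : ∀ q, 0 < ∑ᶠ k, g k q := by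
    intro q
    obtain ⟨N, hN⟩ := hgf q
    obtain ⟨k, hk⟩ := hgpos q
    rw [(hsum hN.self_of_nhds).1]
    refine Finset.sum_pos' (fun k _ => hg0 k q) ⟨k, ?_, hk⟩
    by_contra h
    exact hk.ne' (hN.self_of_nhds k (by simpa using h))
  -- `g k` is assigned to one index `a (e k)` whose open set contains its support
  refine ⟨fun i q => (∑ᶠ k, if a (e k) = i then g k q else 0) / ∑ᶠ k, g k q,
    fun i => isLocallyFiniteOrder_iff.2 fun q => ?_, fun i q => ?_, fun i q hq => ?_, fun q => ?_⟩
  · obtain ⟨N, hN⟩ := hgf q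
    have h1 : FiniteOrderJetAt (fun q => ∑ᶠ k, if a (e k) = i then g k q else 0) q := by
      refine FiniteOrderJetAt.congr (.sum (s := Finset.range N)
        (f := fun k q => if a (e k) = i then g k q else 0) fun k _ => ?_)
        (hN.mono fun q' h => (hsum h).2 i)
      by_cases h : a (e k) = i
      · simpa only [if_pos h] using hg k q
      · simpa only [if_neg h] using finiteOrderJetAt_const 0 q
    have h2 : FiniteOrderJetAt (fun q => ∑ᶠ k, g k q) q :=
      FiniteOrderJetAt.congr (.sum (s := Finset.range N) fun k _ => hg k q)
        (hN.mono fun q' h => (hsum h).1)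
    exact h1.div h2 (hpos q).ne'
  · refine div_nonneg (finsum_nonneg fun k => ?_) (hpos q).le
    split_ifs
    exacts [hg0 k q, le_rfl]
  · by_contra hqU
    obtain ⟨N, hN⟩ := hgf q
    refine notMem_tsupport_iff_eventuallyEq.2 ?_ hq
    have h1 : ∀ k, a (e k) = i → ∀ᶠ q' in 𝓝 q, g k q' = 0 := fun k hk =>
      notMem_tsupport_iff_eventuallyEq.1 fun h => hqU (hk ▸ hbU (e k) (hgs k h))
    filter_upwards [hN, (Finset.eventually_all (Finset.range N)).2 fun k _ =>
      eventually_imp_distrib_left.2 (h1 k)] with q' h2 h3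
    rw [(hsum h2).2 i, Finset.sum_eq_zero, zero_div, Pi.zero_apply]
    intro k hk
    split_ifs with h
    exacts [h3 k hk h, rfl]
  · obtain ⟨N, hN⟩ := hgf q
    simp only [(hsum hN.self_of_nhds).2]
    rw [finsum_eq_sum_of_support_subset (s := (Finset.range N).image fun k => a (e k)),
      ← Finset.sum_div, Finset.sum_comm, (hsum hN.self_of_nhds).1]
    · rw [Finset.sum_congr rfl fun k hk => ?_, div_self]
      · rw [← (hsum hN.self_of_nhds).1]
        exact (hpos q).ne'
      · rw [Finset.sum_ite_eq, if_pos (Finset.mem_image_of_mem _ hk)]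
    · intro i hi
      by_contra hni
      refine hi ?_
      simp only
      rw [Finset.sum_eq_zero, zero_div]
      intro k hk
      rw [if_neg]
      exact fun h => hni (Finset.mem_coe.2 (Finset.mem_image.2 ⟨k, hk, h⟩))

end PartitionOfUnity

/-! ### The endomorphisms `τ ∘ f` of the sheaf of variational forms -/

section Sheaf

variable {n m : ℕ} {X Y : Type u}
  [TopologicalSpace X] [ChartedSpace (EuclideanSpace ℝ (Fin n)) X]
  [TopologicalSpace Y] [ChartedSpace (EuclideanSpace ℝ (Fin (n + m))) Y] {π : Y → X}
  {k : ℕ} {q : InfJet n m π} {c : BundleChart n m π}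

/-- The variational forms are contact forms invariant under `τ`. -/
theorem isContactFormAt_of_mem_variationalGerms (hk : 0 < k) (hq : q ∈ c.dom)
    {ψ : ∀ q : InfJet n m π, FormValue (k - 1 + n + 1) q} (h : ψ ∈ variationalGerms n m π k q) :
    IsContactFormAt k ψ q ∧ ∀ᶠ q' in 𝓝 q, tau k ψ q' = ψ q' := by
  have hp : k - 1 + n + 1 = k + n := by omega
  induction h using Submodule.span_induction with
  | mem ψ h =>
    obtain ⟨φ, hφ, rfl⟩ := h
    exact ⟨hφ.tau hp hk hq, (hφ.eventually hq).mono fun q' h => tau_tau hp hk h⟩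
  | zero => exact ⟨.zero hq, .of_forall fun q' => tau_zero q'⟩
  | add φ ψ _ _ hφ hψ =>
    refine ⟨hφ.1.add hψ.1 hq, ?_⟩
    filter_upwards [hφ.1.eventually hq, hψ.1.eventually hq, hφ.2, hψ.2] with q' h1 h2 h3 h4
    rw [tau_add h1 h2, h3, h4, Pi.add_apply]
  | smul r φ _ hφ =>
    refine ⟨hφ.1.const_smul hq r, ?_⟩
    filter_upwards [hφ.1.eventually hq, hφ.2] with q' h1 h2
    rw [tau_const_smul h1, h2, Pi.smul_apply]

theorem extendByZero_apply {V : Opens (InfJet n m π)} {p : ℕ} (s : ∀ q : V, FormValue p q.1)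
    (hq : q ∈ V) : extendByZero s q = s ⟨q, hq⟩ := dif_pos hq

theorem extendByZero_spec (hk : 0 < k) {V : Opens (InfJet n m π)} (hV : q ∈ V) (hq : q ∈ c.dom)
    (s : germSections (variationalGerms n m π k) V) : IsContactFormAt k (extendByZero s.1) q ∧
      ∀ᶠ q' in 𝓝 q, tau k (extendByZero s.1) q' = extendByZero s.1 q' := by
  obtain ⟨φ, hφ, h⟩ := s.2 q hV
  obtain ⟨h1, h2⟩ := isContactFormAt_of_mem_variationalGerms hk hq hφ
  have e : ∀ᶠ q' in 𝓝 q, extendByZero s.1 q' = φ q' := by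
    filter_upwards [h, V.isOpen.mem_nhds hV] with q' h3 h4
    rw [extendByZero_apply s.1 h4, h3 h4]
  refine ⟨h1.congr hq e, ?_⟩
  filter_upwards [e.eventually_nhds, h2] with q' h3 h4
  rw [tau_congr h3, h4, h3.self_of_nhds]

theorem isContactFormAt_mul_section (hk : 0 < k) {V : Opens (InfJet n m π)} (hV : q ∈ V)
    (hq : q ∈ c.dom) {f : InfJet n m π → ℝ} (hf : IsLocallyFiniteOrder f)
    (s : germSections (variationalGerms n m π k) V) :
    IsContactFormAt k (fun q' => f q' • extendByZero s.1 q') q :=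
  (extendByZero_spec hk hV hq s).1.smul hq (hf.finiteOrderAt hq)

/-- The map `s ↦ τ (f s)` on sections. -/
def tauMulSection (hk : 0 < k) (hc : ∀ q : InfJet n m π, ∃ c : BundleChart n m π, q ∈ c.dom)
    {f : InfJet n m π → ℝ} (hf : IsLocallyFiniteOrder f) (V : Opens (InfJet n m π)) :
    germSections (variationalGerms n m π k) V →ₗ[ℝ] germSections (variationalGerms n m π k) V where
  toFun s := ⟨fun q => tau k (fun q' => f q' • extendByZero s.1 q') q, fun q hq =>
    ⟨_, Submodule.subset_span ⟨_, isContactFormAt_mul_section hk hq (hc q).choose_spec hf s, rfl⟩,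
      .of_forall fun _ _ => rfl⟩⟩
  map_add' s t := by
    refine Subtype.ext (funext fun q => ?_)
    obtain ⟨c, hq⟩ := hc q
    refine Eq.trans (tau_congr ?_) (tau_add (isContactFormAt_mul_section hk q.2 hq hf s)
      (isContactFormAt_mul_section hk q.2 hq hf t))
    filter_upwards [V.isOpen.mem_nhds q.2] with q' h
    rw [Pi.add_apply, extendByZero_apply _ h, extendByZero_apply _ h, extendByZero_apply _ h]
    exact smul_add _ _ _
  map_smul' r s := by
    refine Subtype.ext (funext fun q => ?_)
    obtain ⟨c, hq⟩ := hc q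
    refine Eq.trans (tau_congr ?_) (tau_const_smul (isContactFormAt_mul_section hk q.2 hq hf s) r)
    filter_upwards [V.isOpen.mem_nhds q.2] with q' h
    rw [Pi.smul_apply, extendByZero_apply _ h, extendByZero_apply _ h]
    exact smul_comm (f q') r (s.1 ⟨q', h⟩)

/-- The endomorphism `τ ∘ f` of the sheaf of variational forms. -/
def tauMulHom (hk : 0 < k) (hc : ∀ q : InfJet n m π, ∃ c : BundleChart n m π, q ∈ c.dom)
    {f : InfJet n m π → ℝ} (hf : IsLocallyFiniteOrder f) :
    (variationalSheaf n m π k).presheaf ⟶ (variationalSheaf n m π k).presheaf where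
  app V := ModuleCat.ofHom (tauMulSection hk hc hf V.unop)
  naturality V W i := by
    refine ModuleCat.hom_ext (LinearMap.ext fun s => Subtype.ext (funext fun q => tau_congr ?_))
    filter_upwards [W.unop.isOpen.mem_nhds q.2] with q' h
    refine congrArg (f q' • ·) ?_
    exact (extendByZero_apply _ h).trans (extendByZero_apply _ (i.unop.le h)).symm

theorem isTauMul_tauMulHom (hk : 0 < k)
    (hc : ∀ q : InfJet n m π, ∃ c : BundleChart n m π, q ∈ c.dom) {f : InfJet n m π → ℝ}
    (hf : IsLocallyFiniteOrder f) : IsTauMul k f (tauMulHom (k := k) hk hc hf) :=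
  fun _ _ _ => rfl

/-- Two morphisms to the sections over `U` are equal in the stalk at `x` if they are equal on a
smaller neighbourhood of `x`. -/
theorem comp_germ_congr {Z : TopCat.{u}} {F : TopCat.Presheaf (ModuleCat.{u} ℝ) Z} {x : Z}
    {U W : Opens Z} (i : W ≤ U) (hx : x ∈ W) {M : ModuleCat.{u} ℝ}
    {a b : M ⟶ F.obj (Opposite.op U)}
    (h : a ≫ F.map (homOfLE i).op = b ≫ F.map (homOfLE i).op) :
    a ≫ F.germ U x (i hx) = b ≫ F.germ U x (i hx) := by
  rw [← F.germ_res (homOfLE i) x hx, ← Category.assoc, h, Category.assoc]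

theorem sum_stalkMap_germ {Z : TopCat.{u}} {F : TopCat.Presheaf (ModuleCat.{u} ℝ) Z} {x : Z}
    {κ : Type*} (J : Finset κ) (h : κ → (F ⟶ F)) {V : Opens Z} (hV : x ∈ V) :
    F.germ V x hV ≫ (∑ i ∈ J, (TopCat.Presheaf.stalkFunctor (ModuleCat.{u} ℝ) x).map (h i) :
      (TopCat.Presheaf.stalkFunctor (ModuleCat.{u} ℝ) x).obj F ⟶
        (TopCat.Presheaf.stalkFunctor (ModuleCat.{u} ℝ) x).obj F) =
      (∑ i ∈ J, (h i).app (Opposite.op V)) ≫ F.germ V x hV :=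
  (Preadditive.comp_sum J (F.germ V x hV) _).trans ((Finset.sum_congr rfl fun i _ =>
    TopCat.Presheaf.stalkFunctor_map_germ V x hV (h i)).trans
      (Preadditive.sum_comp J _ (F.germ V x hV)).symm)

/-- The endomorphisms `τ ∘ f_i` given by a partition of unity. -/
theorem isFineFamily_tauMulHom (hk : 0 < k)
    (hc : ∀ q : InfJet n m π, ∃ c : BundleChart n m π, q ∈ c.dom) {ι : Type w}
    {U : ι → Opens (InfJet n m π)} (hlf : LocallyFinite fun i => (U i : Set (InfJet n m π)))
    {f : ι → InfJet n m π → ℝ} (hf : IsPartitionOfUnityFor U f) :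
    IsFineFamily (variationalSheaf n m π k) U fun i => tauMulHom hk hc (hf.1 i) := by
  classical
  obtain ⟨hfo, hf0, hfU, hf1⟩ := hf
  have hzero : ∀ i, ∀ x ∉ tsupport (f i),
      (TopCat.Presheaf.stalkFunctor (ModuleCat.{u} ℝ) x).map
        (tauMulHom (k := k) hk hc (hfo i)) = 0 := by
    intro i x hx
    refine TopCat.Presheaf.stalk_hom_ext _ fun V hV => ?_
    refine (TopCat.Presheaf.stalkFunctor_map_germ V x hV _).trans
      (Eq.trans ?_ Limits.comp_zero.symm)
    let W : Opens (InfJet n m π) := V ⊓ ⟨(tsupport (f i))ᶜ, (isClosed_tsupport _).isOpen_compl⟩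
    have hW : W ≤ V := inf_le_left
    have hxW : x ∈ W := ⟨hV, hx⟩
    refine (comp_germ_congr (F := (variationalSheaf n m π k).presheaf) (W := W) (b := 0) hW hxW
      ?_).trans Limits.zero_comp
    refine ModuleCat.hom_ext (LinearMap.ext fun s => Subtype.ext (funext fun q => ?_))
    refine (tau_congr ?_).trans (tau_zero q.1)
    filter_upwards [notMem_tsupport_iff_eventuallyEq.1 q.2.2] with q' h
    rw [h]
    exact zero_smul _ _
  refine ⟨fun i => ⟨tsupport (f i), isClosed_tsupport _, hfU i, hzero i⟩, fun x => ?_⟩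
  -- on a neighbourhood `N` of `x` only finitely many of the `f i` are nonzero
  obtain ⟨t, ht, htf⟩ := hlf x
  obtain ⟨N, hNt, hN, hxN⟩ := mem_nhds_iff.1 ht
  have hJ : ∀ q ∈ N, ∀ i ∉ htf.toFinset, q ∉ tsupport (f i) := fun q hq i hi h =>
    hi (htf.mem_toFinset.2 ⟨q, hfU i h, hNt hq⟩)
  have hsum : ∀ q ∈ N, ∑ i ∈ htf.toFinset, f i q = 1 := by
    intro q hq
    rw [← hf1 q, finsum_eq_sum_of_support_subset]
    exact fun i hi => by_contra fun h => hJ q hq i h (subset_tsupport _ hi)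
  rw [finsum_eq_sum_of_support_subset (s := htf.toFinset) _ fun i hi =>
    by_contra fun h => hi (hzero i x (hJ x hxN i h))]
  refine TopCat.Presheaf.stalk_hom_ext _ fun V hV => ?_
  refine (sum_stalkMap_germ _ _ hV).trans (Eq.trans ?_ (Category.comp_id _).symm)
  -- over `W`, the finite sum of the `τ (f_i s)` is equal to `s`
  let W : Opens (InfJet n m π) := V ⊓ ⟨N, hN⟩
  have hW : W ≤ V := inf_le_left
  have hxW : x ∈ W := ⟨hV, hxN⟩
  refine (comp_germ_congr (F := (variationalSheaf n m π k).presheaf) (W := W) (b := 𝟙 _) hW hxW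
    ?_).trans (Category.id_comp _)
  refine ModuleCat.hom_ext (LinearMap.ext fun s => Subtype.ext (funext fun q => ?_))
  obtain ⟨c, hq⟩ := hc q
  have hqV : q.1 ∈ V := q.2.1
  have key : ∀ J : Finset ι,
      IsContactFormAt k (fun q' => (∑ i ∈ J, f i q') • extendByZero s.1 q') q.1 ∧
      tau k (fun q' => (∑ i ∈ J, f i q') • extendByZero s.1 q') q.1 =
        ∑ i ∈ J, tau k (fun q' => f i q' • extendByZero s.1 q') q.1 := by
    intro J
    induction J using Finset.induction_on with
    | empty =>
      simp only [Finset.sum_empty, zero_smul]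
      exact ⟨.zero hq, tau_zero q.1⟩
    | insert i J hi ih =>
      have hi' := isContactFormAt_mul_section hk hqV hq (hfo i) s
      simp only [Finset.sum_insert hi, add_smul]
      exact ⟨hi'.add ih.1 hq, (tau_add hi' ih.1).trans (by rw [ih.2])⟩
  have h1 : ∑ i ∈ htf.toFinset, tau k (fun q' => f i q' • extendByZero s.1 q') q.1 =
      s.1 ⟨q.1, hqV⟩ := by
    rw [← (key _).2, ← extendByZero_apply s.1 hqV,
      ← (extendByZero_spec hk hqV hq s).2.self_of_nhds]
    refine tau_congr ?_
    filter_upwards [hN.mem_nhds q.2.2] with q' h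
    rw [hsum q' h, one_smul]
  have happ : ∀ J : Finset ι,
      (show germSections (variationalGerms n m π k) V from
        (∑ i ∈ J, (tauMulHom (k := k) hk hc (hfo i)).app (Opposite.op V)) s).1 ⟨q.1, hqV⟩ =
        ∑ i ∈ J, tau k (fun q' => f i q' • extendByZero s.1 q') q.1 := by
    intro J
    induction J using Finset.induction_on with
    | empty => rfl
    | insert i J hi ih =>
      rw [Finset.sum_insert hi, Finset.sum_insert hi, ← ih]
      rfl
  exact (happ _).trans h1

end Sheaf

end

theorem mainTheorem9 {n m : ℕ} {X Y : Type u} {F : Type v}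
    [TopologicalSpace X] [ChartedSpace (EuclideanSpace ℝ (Fin n)) X] [IsManifold (𝓡 n) ∞ X]
    [T2Space X] [ParacompactSpace X] [ConnectedSpace X]
    [TopologicalSpace Y] [ChartedSpace (EuclideanSpace ℝ (Fin (n + m))) Y]
    [IsManifold (𝓡 (n + m)) ∞ Y] [T2Space Y] [ParacompactSpace Y] [ConnectedSpace Y]
    [TopologicalSpace F] [ChartedSpace (EuclideanSpace ℝ (Fin m)) F] [IsManifold (𝓡 m) ∞ F]
    (π : Y → X) (hπ : IsSmoothBundle n m F π) (k : ℕ) (hk : 0 < k) :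
    IsFine.{u, w} (variationalSheaf n m π k) ∧
    ∀ (ι : Type w) (U : ι → Opens (InfJet n m π)), (⨆ i, U i) = ⊤ →
      LocallyFinite (fun i => (U i : Set (InfJet n m π))) →
      (∃ f : ι → InfJet n m π → ℝ, IsPartitionOfUnityFor U f) ∧
      ∀ f : ι → InfJet n m π → ℝ, IsPartitionOfUnityFor U f →
        ∃ h : ι → ((variationalSheaf n m π k).presheaf ⟶ (variationalSheaf n m π k).presheaf),
          (∀ i, IsTauMul k (f i) (h i)) ∧ IsFineFamily (variationalSheaf n m π k) U h := by
  have : LocallyCompactSpace Y :=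
    ChartedSpace.locallyCompactSpace (EuclideanSpace ℝ (Fin (n + m))) Y
  have : SigmaCompactSpace Y := sigmaCompactSpace_of_connected Y
  have : SecondCountableTopology Y :=
    ChartedSpace.secondCountable_of_sigmaCompact (EuclideanSpace ℝ (Fin (n + m))) Y
  have hc : ∀ q : InfJet n m π, ∃ c : BundleChart n m π, q ∈ c.dom := fun q =>
    hπ.exists_chart (q.1 0).val
  refine ⟨fun ι U hU hlf => ?_, fun ι U hU hlf =>
    ⟨exists_partitionOfUnity hπ.exists_chart U hU, fun f hf => ⟨fun i => tauMulHom hk hc (hf.1 i),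
      fun i => isTauMul_tauMulHom hk hc (hf.1 i), isFineFamily_tauMulHom hk hc hlf hf⟩⟩⟩
  obtain ⟨f, hf⟩ := exists_partitionOfUnity hπ.exists_chart U hU
  exact ⟨_, isFineFamily_tauMulHom hk hc hlf hf⟩
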